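/- Let $V$ be a finite-dimensional real vector space and $\Delta$ a (finite) fan in $V$: a finite set of strictly convex polyhedral cones, closed under taking faces, any two of which meet in a common face. For $\sigma\in\Delta$ let $V_\sigma$ be the linear span of $\sigma$, $A_\sigma^\bullet=S^\bullet(V_\sigma^*)$ the algebra of polynomials on $V_\sigma$, graded so that linear forms have degree $2$, $\mathfrak m_\sigma=A_\sigma^{>0}$, and let $\det V_\sigma^*=\bigwedge^{\dim\sigma}V_\sigma^*$, placed in degree $2\dim\sigma$. A sheaf of graded modules $\mathcal F$ on $\Delta$ (whose open sets are the subfans) consists of $\mathbb Z$-graded $A_\sigma^\bullet$-modules $F_\sigma$, $\sigma\in\Delta$, and functorial restriction maps $F_\sigma\to F_\tau$ for faces $\tau\le\sigma$, homogeneous of degree $0$ and compatible with $A^\bullet_\sigma\to A^\bullet_\tau$. Let $F_{\partial\sigma}$ be the module of compatible families in $(F_\gamma)_{\gamma<\sigma}$ and $F_{(\sigma,\partial\sigma)}=\ker(F_\sigma\to F_{\partial\sigma})$. The sheaf $\mathcal F$ is perverse if all maps $F_\sigma\to F_{\partial\sigma}$ are surjective and every $F_\sigma$ is a finitely generated free $A_\sigma$-module.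 *Simple sheaves.* For $\sigma\in\Delta$, a simple sheaf ${}_\sigma\mathcal L$ is a sheaf obtained as follows: ${}_\sigma L_\sigma= A_\sigma^\bullet$; ${}_\sigma L_\tau=0$ if $\tau\ne\sigma$ and $\dim\tau\le\dim\sigma$; and, inductively, if $\dim\tau>\dim\sigma$, then ${}_\sigma L_\tau= A_\tau^\bullet\otimes_{\mathbb R}({}_\sigma L_{\partial\tau}/\mathfrak m_\tau\,{}_\sigma L_{\partial\tau})$, with restriction map to ${}_\sigma L_{\partial\tau}$ the $A_\tau$-linear extension of a graded linear section of ${}_\sigma L_{\partial\tau}\to{}_\sigma L_{\partial\tau}/\mathfrak m_\tau\,{}_\sigma L_{\partial\tau}$ (all identifications being isomorphisms of graded modules). For the zero cone $o$ this is the intersection cohomology (minimal extension) sheaf $\mathcal E={}_o\mathcal L$. *Dual.* Choose an orientation of $V_\sigma$ for each $\sigma\in\Delta$. The dual of a perverse sheaf $\mathcal F$ is given by $$(D\mathcal F)_\sigma=\operatorname{Hom}_{A_\sigma}(F_{(\sigma,\partial\sigma)},A_\sigma)\otimes_{\mathbb R}\det V_\sigma^*$$ with its natural grading. For a facet $\tau$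 of $\sigma$ the restriction map is $\varepsilon^\sigma_\tau\,\varphi_h\otimes\psi_h$, where $\varepsilon^\sigma_\tau=\pm1$ compares the orientation of $V_\tau$ with that induced from $V_\sigma$, $h\in V_\sigma^*$ is any linear form with kernel $V_\tau$, $\psi_h(h\wedge\eta)=\eta|_{V_\tau}$, and $\varphi_h(f)(g)=f(h\hat g)|_\tau$ with $\hat g\in F_\sigma$ any section that restricts to $g$ on $\tau$ and to $0$ on all other proper faces of $\sigma$. For an arbitrary face $\tau\le\sigma$ the restriction map is the composition of these maps along an ascending chain of facets from $\tau$ to $\sigma$. **Corollary.** For every $\sigma\in\Delta$ a simple sheaf ${}_\sigma\mathcal L$ exists, and every simple sheaf ${}_\sigma\mathcal L$ is perverse and satisfies $$D({}_\sigma\mathcal L)\;\cong\;{}_\sigma\mathcal L\otimes_{\mathbb R}\det V_\sigma^*,$$ by isomorphisms of graded $A_\tau$-modules ($\tau\in\Delta$), homogeneous of degree $0$, commuting with all restriction maps. In particular the intersection cohomology sheaf is self-dual: $D\mathcal E\cong\mathcal E$. -/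

import Mathlib

universe u

open scoped TensorProduct

noncomputable section

/-! ### Fans -/

/-- `τ` is a face of the polyhedral cone `σ`: it is cut out of `σ` by a supporting hyperplane. -/
def PointedCone.IsExposedFace {V : Type u} [AddCommGroup V] [Module ℝ V]
    (τ σ : PointedCone ℝ V) : Prop :=
  ∃ l : Module.Dual ℝ V, (∀ x ∈ σ, 0 ≤ l x) ∧ ∀ x, x ∈ τ ↔ x ∈ σ ∧ l x = 0

/-- A fan in `V`: a finite set of strictly convex polyhedral cones, closed under taking faces,
any two of which meet in a common face. -/
structure Fan (V : Type u) [AddCommGroup V] [Module ℝ V] where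
  cones : Set (PointedCone ℝ V)
  finite : cones.Finite
  polyhedral : ∀ σ ∈ cones, σ.FG
  strictlyConvex : ∀ σ ∈ cones, σ.toConvexCone.Salient
  face_mem : ∀ σ ∈ cones, ∀ τ : PointedCone ℝ V, τ.IsExposedFace σ → τ ∈ cones
  inter_face : ∀ σ ∈ cones, ∀ τ ∈ cones, (τ ⊓ σ).IsExposedFace σ

namespace Fan

variable {V : Type u} [AddCommGroup V] [Module ℝ V] {Δ : Fan V}

/-- The cones of a fan, ordered by inclusion, which is the same as the face relation
(`Fan.le_iff_isExposedFace`). -/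
abbrev Cone (Δ : Fan V) : Type u := {σ : PointedCone ℝ V // σ ∈ Δ.cones}

theorem le_iff_isExposedFace (τ σ : Δ.Cone) : τ ≤ σ ↔ τ.1.IsExposedFace σ.1 := by
  constructor
  · intro h
    have := Δ.inter_face σ.1 σ.2 τ.1 τ.2
    rwa [inf_eq_left.2 (show τ.1 ≤ σ.1 from h)] at this
  · rintro ⟨l, -, hl⟩ x hx
    exact ((hl x).1 hx).1

/-- The linear span `V_σ` of a cone. -/
def lin (σ : Δ.Cone) : Submodule ℝ V := Submodule.span ℝ (σ.1 : Set V)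

theorem lin_mono {τ σ : Δ.Cone} (h : τ ≤ σ) : lin τ ≤ lin σ :=
  Submodule.span_mono h

/-- The dimension of a cone. -/
def dim (σ : Δ.Cone) : ℕ := Module.finrank ℝ (lin σ)

/-- `τ` is a facet of `σ`: a face of codimension one. -/
def IsFacet (τ σ : Δ.Cone) : Prop := τ ≤ σ ∧ dim σ = dim τ + 1

theorem exists_support {τ σ : Δ.Cone} (h : τ < σ) :
    ∃ l : Module.Dual ℝ V, (∀ x ∈ σ.1, 0 ≤ l x) ∧ (∀ x, x ∈ τ.1 ↔ x ∈ σ.1 ∧ l x = 0) ∧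
      lin τ ≤ LinearMap.ker l ∧ ∃ x ∈ σ.1, l x ≠ 0 := by
  obtain ⟨l, h0, hl⟩ := (le_iff_isExposedFace τ σ).1 h.le
  refine ⟨l, h0, hl, Submodule.span_le.2 fun x hx => ((hl x).1 hx).2, ?_⟩
  by_contra! hc
  exact h.not_ge fun x hx => (hl x).2 ⟨hx, hc x hx⟩

theorem lin_lt {τ σ : Δ.Cone} (h : τ < σ) : lin τ < lin σ := by
  obtain ⟨l, -, -, hk, x, hx, hlx⟩ := exists_support h
  exact lt_of_le_of_ne (lin_mono h.le) fun e =>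
    hlx (hk (e ▸ (Submodule.subset_span hx : x ∈ lin σ)))

theorem dim_lt [FiniteDimensional ℝ V] {τ σ : Δ.Cone} (h : τ < σ) : dim τ < dim σ :=
  Submodule.finrank_lt_finrank_of_lt (lin_lt h)

theorem IsFacet.lt {τ σ : Δ.Cone} (h : IsFacet τ σ) : τ < σ :=
  lt_of_le_of_ne h.1 fun e => by have := h.2; subst e; omega

theorem IsFacet.eq_of_le [FiniteDimensional ℝ V] {τ γ σ : Δ.Cone} (h : IsFacet τ σ)
    (h₁ : τ ≤ γ) (h₂ : γ < σ) : γ = τ := by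
  by_contra hne
  have a := dim_lt h₂
  have b := dim_lt (lt_of_le_of_ne h₁ (Ne.symm hne))
  have c := h.2
  omega

/-! ### Ascending chains of facets -/

/-- An ascending chain of cones from `τ` to `σ`, each a facet of the next one. -/
inductive FacetChain : Δ.Cone → Δ.Cone → Type u
  | refl (σ : Δ.Cone) : FacetChain σ σ
  | step {γ τ σ : Δ.Cone} (c : FacetChain γ τ) (h : IsFacet τ σ) : FacetChain γ σ

theorem exists_between [FiniteDimensional ℝ V] {τ σ : Δ.Cone} (h : τ < σ)
    (hd : dim τ + 1 < dim σ) : ∃ γ : Δ.Cone, τ < γ ∧ γ < σ := by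
  classical
  obtain ⟨l, l0, hl, hk, y, hy, hly⟩ := exists_support h
  obtain ⟨S, hS⟩ := Δ.polyhedral σ.1 σ.2
  have hSσ : ∀ v ∈ S, v ∈ σ.1 := fun v hv => hS ▸ Submodule.subset_span hv
  -- a form `m` vanishing on `lin τ` and on `y`, but not on `σ`
  obtain ⟨m, hmτ, hmy, z, hz, hmz⟩ : ∃ m : Module.Dual ℝ V, (∀ x ∈ lin τ, m x = 0) ∧
      m y = 0 ∧ ∃ z ∈ S, m z ≠ 0 := by
    have hlt : ¬ lin σ ≤ lin τ ⊔ Submodule.span ℝ {y} := by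
      intro hle
      have h1 := Submodule.finrank_mono hle
      have h2 := Submodule.finrank_add_le_finrank_add_finrank (lin τ) (Submodule.span ℝ {y})
      have h3 : Module.finrank ℝ (Submodule.span ℝ {y}) = 1 :=
        finrank_span_singleton fun e => hly (by rw [e, map_zero])
      unfold dim at hd
      omega
    have hne : ∃ z ∈ S, z ∉ lin τ ⊔ Submodule.span ℝ {y} := by
      by_contra! hc
      apply hlt
      refine Submodule.span_le.2 fun x hx => ?_
      have hx' : x ∈ PointedCone.hull ℝ (S : Set V) := by rw [← hS] at hx; exact hx
      exact (Submodule.span_le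
        (p := PointedCone.ofSubmodule (lin τ ⊔ Submodule.span ℝ {y}))).2
        (fun v hv => hc v hv) hx'
    obtain ⟨z, hz, hzn⟩ := hne
    obtain ⟨m, hm, hmz⟩ := Submodule.exists_le_ker_of_notMem hzn
    exact ⟨m, fun x hx => hmz (Submodule.mem_sup_left hx),
      hmz (Submodule.mem_sup_right (Submodule.mem_span_singleton_self y)), z, hz, hm⟩
  -- we may assume that `m` is negative on a generator
  wlog hneg : m z < 0 generalizing m
  · exact this (-m) (fun x hx => by simp [hmτ x hx]) (by simp [hmy]) (by simpa using hmz)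
      (by have := lt_of_le_of_ne (not_lt.1 hneg) (Ne.symm hmz); simpa using this)
  -- tilt `l` towards `m` until a further generator is reached
  obtain ⟨w, hw, hmin⟩ := (S.filter fun v => m v < 0).exists_min_image (fun v => l v / (-m v))
    ⟨z, by simp [hz, hneg]⟩
  simp only [Finset.mem_filter] at hw hmin
  set t := l w / (-m w) with ht
  have ht0 : 0 ≤ t := div_nonneg (l0 w (hSσ w hw.1)) (by linarith [hw.2])
  have hgen : ∀ v ∈ S, 0 ≤ (l + t • m) v := by
    intro v hv
    simp only [LinearMap.add_apply, LinearMap.smul_apply, smul_eq_mul]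
    rcases lt_or_ge (m v) 0 with hv0 | hv0
    · have := hmin v ⟨hv, hv0⟩
      rw [le_div_iff₀ (by linarith)] at this
      linarith
    · have := l0 v (hSσ v hv)
      positivity
  have hpos : ∀ x ∈ σ.1, 0 ≤ (l + t • m) x := by
    intro x hx
    rw [← hS] at hx
    induction hx using Submodule.span_induction with
    | mem v hv => exact hgen v hv
    | zero => simp
    | add a b _ _ ha hb => rw [map_add]; exact add_nonneg ha hb
    | smul c a _ ha =>
      have : (l + t • m) (c • a) = (c : ℝ) * (l + t • m) a := by
        rw [← smul_eq_mul, ← map_smul]; rfl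
      rw [this]; exact mul_nonneg c.2 ha
  have hw0 : (l + t • m) w = 0 := by
    have : m w ≠ 0 := ne_of_lt hw.2
    simp only [LinearMap.add_apply, LinearMap.smul_apply, smul_eq_mul, ht]
    field_simp
    ring
  let γ : PointedCone ℝ V := σ.1 ⊓ PointedCone.ofSubmodule (LinearMap.ker (l + t • m))
  have hγ : γ.IsExposedFace σ.1 := ⟨l + t • m, hpos, fun x => by
    simp [γ, Submodule.mem_inf]⟩
  have hwτ : w ∉ τ.1 := fun hc => by
    have := hmτ w (Submodule.subset_span hc)
    linarith [hw.2]
  refine ⟨⟨γ, Δ.face_mem _ σ.2 _ hγ⟩, lt_of_le_of_ne ?_ ?_, lt_of_le_of_ne ?_ ?_⟩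
  · intro x hx
    refine ⟨h.le hx, ?_⟩
    have h1 := hmτ x (Submodule.subset_span hx)
    have h2 := ((hl x).1 hx).2
    simp [h1, h2]
  · intro e
    apply hwτ
    rw [e]
    exact ⟨hSσ w hw.1, hw0⟩
  · exact fun x hx => hx.1
  · intro e
    have : y ∈ γ := by
      have h' := congrArg Subtype.val e
      change γ = σ.1 at h'
      rw [h']; exact hy
    have h2 : (l + t • m) y = 0 := this.2
    simp [hmy, hly] at h2

theorem exists_facet [FiniteDimensional ℝ V] {τ σ : Δ.Cone} (h : τ < σ) :
    ∃ γ : Δ.Cone, τ ≤ γ ∧ IsFacet γ σ := by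
  induction hn : dim σ - dim τ using Nat.strong_induction_on generalizing τ with
  | _ n ih =>
    by_cases hd : dim τ + 1 < dim σ
    · obtain ⟨γ, h1, h2⟩ := exists_between h hd
      have a := dim_lt h1
      have b := dim_lt h2
      obtain ⟨δ, h3, h4⟩ := ih (dim σ - dim γ) (by omega) h2 rfl
      exact ⟨δ, h1.le.trans h3, h4⟩
    · have := dim_lt h
      exact ⟨τ, le_rfl, h.le, by omega⟩

theorem nonempty_facetChain [FiniteDimensional ℝ V] {τ σ : Δ.Cone} (h : τ ≤ σ) :
    Nonempty (FacetChain τ σ) := by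
  induction hn : dim σ using Nat.strong_induction_on generalizing σ with
  | _ n ih =>
    rcases h.eq_or_lt with rfl | hlt
    · exact ⟨.refl _⟩
    · obtain ⟨γ, h1, h2⟩ := exists_facet hlt
      obtain ⟨c⟩ := ih (dim γ) (hn ▸ dim_lt h2.lt) h1 rfl
      exact ⟨.step c h2⟩

/-! ### Polynomials on the cones -/

/-- The algebra `A_σ = S(V_σ^*)` of polynomials on `V_σ`. -/
abbrev Poly (σ : Δ.Cone) : Type u := SymmetricAlgebra ℝ (Module.Dual ℝ (lin σ))

/-- The grading of `A_σ` in which linear forms have degree `2`. -/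
def polyDeg (σ : Δ.Cone) (q : ℤ) : Submodule ℝ (Poly σ) :=
  ⨆ (k : ℕ) (_ : 2 * (k : ℤ) = q),
    LinearMap.range (SymmetricAlgebra.ι ℝ (Module.Dual ℝ (lin σ))) ^ k

/-- The ideal `𝔪 = A_σ^{>0}`. -/
def polyIdeal (σ : Δ.Cone) : Ideal (Poly σ) :=
  Ideal.span {a | ∃ q : ℤ, 0 < q ∧ a ∈ polyDeg σ q}

/-- Restriction of linear forms from `V_σ` to `V_τ`. -/
def resForm {τ σ : Δ.Cone} (h : τ ≤ σ) : Module.Dual ℝ (lin σ) →ₗ[ℝ] Module.Dual ℝ (lin τ) :=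
  (Submodule.inclusion (lin_mono h)).dualMap

/-- Restriction of polynomials from `V_σ` to `V_τ`. -/
def resPoly {τ σ : Δ.Cone} (h : τ ≤ σ) : Poly σ →ₐ[ℝ] Poly τ :=
  SymmetricAlgebra.lift (SymmetricAlgebra.ι ℝ (Module.Dual ℝ (lin τ)) ∘ₗ resForm h)

theorem resPoly_ι {τ σ : Δ.Cone} (h : τ ≤ σ) (l : Module.Dual ℝ (lin σ)) :
    resPoly h (SymmetricAlgebra.ι ℝ _ l) = SymmetricAlgebra.ι ℝ _ (resForm h l) := by
  simp [resPoly]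

theorem resPoly_comp {γ τ σ : Δ.Cone} (h₁ : γ ≤ τ) (h₂ : τ ≤ σ) (a : Poly σ) :
    resPoly h₁ (resPoly h₂ a) = resPoly (h₁.trans h₂) a := by
  have : (resPoly h₁).comp (resPoly h₂) = resPoly (h₁.trans h₂) := by
    apply SymmetricAlgebra.algHom_ext
    ext l
    change resPoly h₁ (resPoly h₂ (SymmetricAlgebra.ι ℝ _ l)) =
      resPoly (h₁.trans h₂) (SymmetricAlgebra.ι ℝ _ l)
    rw [resPoly_ι, resPoly_ι, resPoly_ι]
    rfl
  rw [← this]; rfl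

theorem resPoly_surjective {τ σ : Δ.Cone} (h : τ ≤ σ) : Function.Surjective (resPoly h) := by
  intro a
  induction a using SymmetricAlgebra.induction with
  | algebraMap r => exact ⟨algebraMap ℝ _ r, by simp⟩
  | ι l =>
    obtain ⟨l', hl'⟩ := LinearMap.dualMap_surjective_of_injective
      (Submodule.inclusion_injective (lin_mono h)) l
    exact ⟨SymmetricAlgebra.ι ℝ _ l', by rw [resPoly_ι]; exact congrArg _ hl'⟩
  | mul a b ha hb =>
    obtain ⟨a', rfl⟩ := ha
    obtain ⟨b', rfl⟩ := hb
    exact ⟨a' * b', map_mul _ _ _⟩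
  | add a b ha hb =>
    obtain ⟨a', rfl⟩ := ha
    obtain ⟨b', rfl⟩ := hb
    exact ⟨a' + b', map_add _ _ _⟩

/-- The degrees of `M ⊗ N`, for subspaces `dM`, `dN` of the homogeneous elements. -/
def tensorDeg {M N : Type u} [AddCommGroup M] [Module ℝ M] [AddCommGroup N] [Module ℝ N]
    (dM : ℤ → Submodule ℝ M) (dN : ℤ → Submodule ℝ N) (q : ℤ) : Submodule ℝ (M ⊗[ℝ] N) :=
  ⨆ i : ℤ, Submodule.map₂ (TensorProduct.mk ℝ M N) (dM i) (dN (q - i))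

/-! ### Sheaves of graded modules -/

/-- The data of a graded `A_σ`-module `F_σ` for each cone `σ`, with linear maps `F_σ → F_τ` for
the faces `τ ≤ σ`. -/
structure ModuleSystem (Δ : Fan V) where
  obj : Δ.Cone → Type u
  [addCommGroup : ∀ σ, AddCommGroup (obj σ)]
  [moduleReal : ∀ σ, Module ℝ (obj σ)]
  [modulePoly : ∀ σ, Module (Poly σ) (obj σ)]
  [isScalarTower : ∀ σ, IsScalarTower ℝ (Poly σ) (obj σ)]
  /-- the homogeneous elements of degree `q` -/
  deg : ∀ σ, ℤ → Submodule ℝ (obj σ)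
  res : ∀ {τ σ : Δ.Cone}, τ ≤ σ → obj σ →ₗ[ℝ] obj τ

attribute [instance] ModuleSystem.addCommGroup ModuleSystem.moduleReal ModuleSystem.modulePoly
  ModuleSystem.isScalarTower

/-- Isomorphisms of degree zero, compatible with all restriction maps. -/
structure ModuleSystem.Iso (F G : ModuleSystem Δ) where
  equiv : ∀ σ, F.obj σ ≃ₗ[Poly σ] G.obj σ
  mem_deg_iff : ∀ σ q x, equiv σ x ∈ G.deg σ q ↔ x ∈ F.deg σ q
  res_equiv : ∀ {τ σ : Δ.Cone} (h : τ ≤ σ) (x : F.obj σ),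
    G.res h (equiv σ x) = equiv τ (F.res h x)

/-- A sheaf of graded `𝒜`-modules on the fan space of `Δ`, whose open sets are the subfans.
Each affine fan `⟨σ⟩` is the smallest open set containing `σ`, so that a sheaf is the same as
the collection of its sections `F_σ` over the `⟨σ⟩`, with functorial restriction maps; the
sections over a subfan are the compatible families. -/
structure Sheaf (Δ : Fan V) extends ModuleSystem Δ where
  isInternal : ∀ σ, DirectSum.IsInternal (deg σ)
  smul_mem : ∀ {σ : Δ.Cone} {i j : ℤ} {a : Poly σ} {x : obj σ},
    a ∈ polyDeg σ i → x ∈ deg σ j → a • x ∈ deg σ (i + j)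
  res_mem : ∀ {τ σ : Δ.Cone} (h : τ ≤ σ) {q : ℤ} {x : obj σ}, x ∈ deg σ q → res h x ∈ deg τ q
  res_smul : ∀ {τ σ : Δ.Cone} (h : τ ≤ σ) (a : Poly σ) (x : obj σ),
    res h (a • x) = resPoly h a • res h x
  res_refl : ∀ (σ : Δ.Cone) (x : obj σ), res le_rfl x = x
  res_res : ∀ {γ τ σ : Δ.Cone} (h₁ : γ ≤ τ) (h₂ : τ ≤ σ) (x : obj σ),
    res h₁ (res h₂ x) = res (h₁.trans h₂) x

namespace Sheaf

variable (F : Sheaf Δ)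

/-- The sections `F_{∂σ}` over the boundary fan `∂σ` of all proper faces of `σ`. -/
def Boundary (σ : Δ.Cone) : Submodule ℝ (∀ γ : {γ : Δ.Cone // γ < σ}, F.obj γ.1) where
  carrier := {x | ∀ (γ δ : {γ : Δ.Cone // γ < σ}) (h : δ.1 ≤ γ.1), F.res h (x γ) = x δ}
  add_mem' hx hy γ δ h := by simp [hx γ δ h, hy γ δ h]
  zero_mem' γ δ h := by simp
  smul_mem' c x hx γ δ h := by simp [hx γ δ h]

instance (σ : Δ.Cone) : SMul (Poly σ) (F.Boundary σ) where
  smul a x := ⟨fun γ => resPoly γ.2.le a • x.1 γ, fun γ δ h => by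
    rw [F.res_smul, resPoly_comp, x.2 γ δ h]⟩

theorem boundary_smul_apply {σ : Δ.Cone} (a : Poly σ) (x : F.Boundary σ)
    (γ : {γ : Δ.Cone // γ < σ}) : (a • x).1 γ = resPoly γ.2.le a • x.1 γ := rfl

instance (σ : Δ.Cone) : Module (Poly σ) (F.Boundary σ) where
  one_smul x := by ext γ; simp [boundary_smul_apply]
  mul_smul a b x := by ext γ; simp [boundary_smul_apply, mul_smul]
  smul_zero a := by ext γ; simp [boundary_smul_apply]
  smul_add a x y := by ext γ; simp [boundary_smul_apply]
  add_smul a b x := by ext γ; simp [boundary_smul_apply, add_smul]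
  zero_smul x := by ext γ; simp [boundary_smul_apply]

instance (σ : Δ.Cone) : IsScalarTower ℝ (Poly σ) (F.Boundary σ) where
  smul_assoc r a x := by ext γ; simp [boundary_smul_apply]

/-- The grading of `F_{∂σ}`. -/
def boundaryDeg (σ : Δ.Cone) (q : ℤ) : Submodule ℝ (F.Boundary σ) where
  carrier := {x | ∀ γ, x.1 γ ∈ F.deg γ.1 q}
  add_mem' hx hy γ := add_mem (hx γ) (hy γ)
  zero_mem' _ := zero_mem _
  smul_mem' c _ hx γ := Submodule.smul_mem _ c (hx γ)

/-- The restriction map `F_σ → F_{∂σ}`. -/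
def resBoundary (σ : Δ.Cone) : F.obj σ →ₗ[Poly σ] F.Boundary σ where
  toFun x := ⟨fun γ => F.res γ.2.le x, fun γ δ h => F.res_res h γ.2.le x⟩
  map_add' x y := by ext γ; simp
  map_smul' a x := by ext γ; simp [boundary_smul_apply, F.res_smul]

/-- The module `F_{(σ,∂σ)}` of the sections over `σ` that vanish on `∂σ`. -/
def relative (σ : Δ.Cone) : Submodule (Poly σ) (F.obj σ) := LinearMap.ker (F.resBoundary σ)

theorem mem_relative {σ : Δ.Cone} {x : F.obj σ} :
    x ∈ F.relative σ ↔ ∀ (γ : Δ.Cone) (h : γ < σ), F.res h.le x = 0 := by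
  rw [relative, LinearMap.mem_ker, Subtype.ext_iff, funext_iff]
  exact ⟨fun h γ hγ => h ⟨γ, hγ⟩, fun h γ => h γ.1 γ.2⟩

/-- A perverse sheaf: flabby, with all `F_σ` finitely generated and free over `A_σ`. -/
structure IsPerverse : Prop where
  flabby : ∀ σ, Function.Surjective (F.resBoundary σ)
  finite : ∀ σ, Module.Finite (Poly σ) (F.obj σ)
  free : ∀ σ, Module.Free (Poly σ) (F.obj σ)

/-! ### Simple sheaves -/

/-- The reduction of `F_{∂τ}` modulo `𝔪`. -/
abbrev ReducedBoundary (τ : Δ.Cone) : Type u :=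
  F.Boundary τ ⧸ (polyIdeal τ • ⊤ : Submodule (Poly τ) (F.Boundary τ))

/-- The reduction map `F_{∂τ} → F_{∂τ} / 𝔪 F_{∂τ}`. -/
def reduction (τ : Δ.Cone) : F.Boundary τ →ₗ[ℝ] F.ReducedBoundary τ :=
  (Submodule.mkQ (polyIdeal τ • ⊤ : Submodule (Poly τ) (F.Boundary τ))).restrictScalars ℝ

/-- The grading of the reduction. -/
def reducedDeg (τ : Δ.Cone) (q : ℤ) : Submodule ℝ (F.ReducedBoundary τ) :=
  (F.boundaryDeg τ q).map (F.reduction τ)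

/-- `F` is a simple sheaf of the cone `σ`, obtained by the inductive construction:
`F_σ = A_σ`; the other `F_τ` with `dim τ ≤ dim σ` vanish; and if `dim τ > dim σ`, then
`F_τ = A_τ ⊗ (F_{∂τ} / 𝔪 F_{∂τ})`, the restriction map to `F_{∂τ}` being the `A_τ`-linear
extension of a graded section `s` of the reduction map. -/
structure IsSimple (σ : Δ.Cone) : Prop where
  self : ∃ e : Poly σ ≃ₗ[Poly σ] F.obj σ, ∀ q a, e a ∈ F.deg σ q ↔ a ∈ polyDeg σ q
  eq_zero : ∀ τ, dim τ ≤ dim σ → τ ≠ σ → Subsingleton (F.obj τ)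
  extend : ∀ τ, dim σ < dim τ →
    ∃ s : F.ReducedBoundary τ →ₗ[ℝ] F.Boundary τ,
      (∀ w, F.reduction τ (s w) = w) ∧
      (∀ q, ∀ w ∈ F.reducedDeg τ q, s w ∈ F.boundaryDeg τ q) ∧
      ∃ e : (Poly τ ⊗[ℝ] F.ReducedBoundary τ) ≃ₗ[Poly τ] F.obj τ,
        (∀ q x, e x ∈ F.deg τ q ↔ x ∈ tensorDeg (polyDeg τ) (F.reducedDeg τ) q) ∧
        ∀ a w, F.resBoundary τ (e (a ⊗ₜ w)) = a • s w

end Sheaf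

/-! ### Determinants -/

/-- The line `det V_σ^* = ⋀^{dim σ} V_σ^*`, as the space of alternating forms of top degree on
`V_σ`. -/
abbrev Det (σ : Δ.Cone) : Type u := (lin σ) [⋀^Fin (dim σ)]→ₗ[ℝ] ℝ

/-- `det V_σ^*` is concentrated in degree `2 dim σ`. -/
def detDeg (σ : Δ.Cone) (q : ℤ) : Submodule ℝ (Det σ) := ⨆ _ : q = 2 * (dim σ : ℤ), ⊤

/-- The sheaf `F ⊗ det V_σ^*`, for a fixed cone `σ`. -/
def Sheaf.tensorDet (F : Sheaf Δ) (σ : Δ.Cone) : ModuleSystem Δ where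
  obj τ := F.obj τ ⊗[ℝ] Det σ
  deg τ := tensorDeg (F.deg τ) (detDeg σ)
  res h := (F.res h).rTensor (Det σ)

/-- `h` is a linear form on `V_σ` with kernel `V_τ`. -/
def HasKernel {τ σ : Δ.Cone} (_ : IsFacet τ σ) (h : Module.Dual ℝ (lin σ)) : Prop :=
  ∀ v : lin σ, h v = 0 ↔ (v : V) ∈ lin τ

theorem HasKernel.exists_eq_one {τ σ : Δ.Cone} {hτ : IsFacet τ σ} {h : Module.Dual ℝ (lin σ)}
    (hh : HasKernel hτ h) : ∃ v, h v = 1 := by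
  obtain ⟨x, hx, hxτ⟩ := SetLike.exists_of_lt (lin_lt hτ.lt)
  have : h ⟨x, hx⟩ ≠ 0 := fun e => hxτ ((hh _).1 e)
  exact ⟨(h ⟨x, hx⟩)⁻¹ • ⟨x, hx⟩, by
    rw [map_smul, smul_eq_mul, inv_mul_cancel₀ this]⟩

theorem HasKernel.exists_smul {τ σ : Δ.Cone} {hτ : IsFacet τ σ} {h h' : Module.Dual ℝ (lin σ)}
    (hh : HasKernel hτ h) (hh' : HasKernel hτ h') : ∃ c : ℝ, h' = c • h := by
  obtain ⟨v, hv⟩ := hh.exists_eq_one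
  refine ⟨h' v, LinearMap.ext fun x => ?_⟩
  have : h' (x - h x • v) = 0 := (hh' _).2 ((hh _).1 (by simp [hv]))
  rw [map_sub, map_smul, sub_eq_zero] at this
  rw [this]
  simp [mul_comm]

/-- The contraction `ω ↦ ω(v, ·)|_{V_τ}` of top degree forms. -/
def contract {τ σ : Δ.Cone} (hτ : IsFacet τ σ) (v : lin σ) : Det σ →ₗ[ℝ] Det τ where
  toFun ω := ((ω.domDomCongr (finCongr hτ.2)).curryLeft v).compLinearMap
    (Submodule.inclusion (lin_mono hτ.1))
  map_add' _ _ := rfl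
  map_smul' _ _ := rfl

/-- The map `ψ_h : det V_σ^* → det V_τ^*`, `h ∧ η ↦ η|_{V_τ}`: as `h` vanishes on `V_τ`,
it is the contraction with any vector `v` such that `h v = 1`. -/
def psi {τ σ : Δ.Cone} {hτ : IsFacet τ σ} {h : Module.Dual ℝ (lin σ)} (hh : HasKernel hτ h) :
    Det σ →ₗ[ℝ] Det τ :=
  contract hτ hh.exists_eq_one.choose

/-! ### The dual sheaf -/

/-- `g'` is an extension to `σ` of the trivial extension to `∂σ` of `g`. -/
def Sheaf.IsExtension (F : Sheaf Δ) {τ σ : Δ.Cone} (hτ : IsFacet τ σ) (g : F.obj τ)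
    (g' : F.obj σ) : Prop :=
  F.res hτ.1 g' = g ∧ ∀ (γ : Δ.Cone) (h : γ < σ), γ ≠ τ → F.res h.le g' = 0

theorem resForm_eq_zero {τ σ : Δ.Cone} {hτ : IsFacet τ σ} {h : Module.Dual ℝ (lin σ)}
    (hh : HasKernel hτ h) : resForm hτ.1 h = 0 := by
  ext v
  exact (hh _).2 v.2

theorem Sheaf.IsPerverse.exists_isExtension [FiniteDimensional ℝ V] {F : Sheaf Δ}
    (hF : F.IsPerverse) {τ σ : Δ.Cone} (hτ : IsFacet τ σ) (g : F.relative τ) :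
    ∃ g', F.IsExtension hτ g.1 g' := by
  classical
  have hg := F.mem_relative.1 g.2
  have key : ∀ γ : Δ.Cone, ∀ h : γ ≤ τ, γ ≠ τ → F.res h g.1 = 0 :=
    fun γ h hne => hg γ (lt_of_le_of_ne h hne)
  let x : F.Boundary σ := ⟨fun γ => if h : γ.1 ≤ τ then F.res h g.1 else 0, by
    intro γ δ hδ
    by_cases h : γ.1 ≤ τ
    · simp only [h, hδ.trans h, dif_pos, F.res_res]
    · have hδτ : δ.1 ≠ τ := fun e => h (hτ.eq_of_le (e ▸ hδ) γ.2).le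
      by_cases h' : δ.1 ≤ τ
      · simp [h, h', key δ.1 h' hδτ]
      · simp [h, h']⟩
  obtain ⟨g', hg'⟩ := hF.flabby σ x
  have hx : ∀ (γ : Δ.Cone) (h : γ < σ),
      F.res h.le g' = if h : γ ≤ τ then F.res h g.1 else 0 := fun γ h =>
    congrFun (congrArg Subtype.val hg') ⟨γ, h⟩
  refine ⟨g', ?_, fun γ h hne => ?_⟩
  · have := hx τ hτ.lt
    simpa [F.res_refl] using this
  · rw [hx γ h]
    split_ifs with h'
    · exact key γ h' hne
    · rfl

section Phi

variable {F : Sheaf Δ} {τ σ : Δ.Cone} {hτ : IsFacet τ σ}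

theorem Sheaf.IsExtension.add {x y : F.obj τ} {x' y' : F.obj σ} (hx : F.IsExtension hτ x x')
    (hy : F.IsExtension hτ y y') : F.IsExtension hτ (x + y) (x' + y') :=
  ⟨by rw [map_add, hx.1, hy.1], fun γ hγ e => by
    rw [map_add, hx.2 γ hγ e, hy.2 γ hγ e, add_zero]⟩

theorem Sheaf.IsExtension.smul {x : F.obj τ} {x' : F.obj σ} (hx : F.IsExtension hτ x x')
    (b : Poly σ) : F.IsExtension hτ (resPoly hτ.1 b • x) (b • x') :=
  ⟨by rw [F.res_smul, hx.1], fun γ hγ e => by rw [F.res_smul, hx.2 γ hγ e, smul_zero]⟩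

theorem Sheaf.IsExtension.smul_mem {g : F.obj τ} {g' : F.obj σ} (hg : F.IsExtension hτ g g')
    {h : Module.Dual ℝ (lin σ)} (hh : HasKernel hτ h) :
    SymmetricAlgebra.ι ℝ _ h • g' ∈ F.relative σ := by
  rw [F.mem_relative]
  intro γ hγ
  rw [F.res_smul]
  by_cases e : γ = τ
  · subst e
    rw [resPoly_ι, resForm_eq_zero hh, map_zero, zero_smul]
  · rw [hg.2 γ hγ e, smul_zero]

/-- The value `f(h g')|_τ` does not depend on the chosen extension `g'` of `g`. -/
theorem Sheaf.IsExtension.map_eq (f : F.relative σ →ₗ[Poly σ] Poly σ) {g : F.obj τ}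
    {g₁ g₂ : F.obj σ} (h₁ : F.IsExtension hτ g g₁) (h₂ : F.IsExtension hτ g g₂)
    {h : Module.Dual ℝ (lin σ)} (hh : HasKernel hτ h) :
    resPoly hτ.1 (f ⟨_, h₁.smul_mem hh⟩) = resPoly hτ.1 (f ⟨_, h₂.smul_mem hh⟩) := by
  have hmem : g₁ - g₂ ∈ F.relative σ := by
    rw [F.mem_relative]
    intro γ hγ
    rw [map_sub]
    by_cases e : γ = τ
    · subst e
      rw [show F.res hγ.le g₁ = g from h₁.1, show F.res hγ.le g₂ = g from h₂.1, sub_self]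
    · rw [h₁.2 γ hγ e, h₂.2 γ hγ e, sub_self]
  have e : (⟨_, h₁.smul_mem hh⟩ : F.relative σ) - ⟨_, h₂.smul_mem hh⟩ =
      SymmetricAlgebra.ι ℝ _ h • ⟨g₁ - g₂, hmem⟩ := by
    ext
    simp [smul_sub]
  rw [← sub_eq_zero, ← map_sub, ← map_sub, e, map_smul, smul_eq_mul, map_mul, resPoly_ι,
    resForm_eq_zero hh, map_zero, zero_mul]

variable [FiniteDimensional ℝ V]

/-- The homomorphism `φ_h(f) : F_{(τ,∂τ)} → A_τ`, `g ↦ f(h g')|_τ`, where `g'` is an extension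
to `σ` of the trivial extension to `∂σ` of `g`. -/
def phiAux (hF : F.IsPerverse) {h : Module.Dual ℝ (lin σ)} (hh : HasKernel hτ h)
    (f : F.relative σ →ₗ[Poly σ] Poly σ) : F.relative τ →ₗ[Poly τ] Poly τ where
  toFun g := resPoly hτ.1 (f ⟨_, (hF.exists_isExtension hτ g).choose_spec.smul_mem hh⟩)
  map_add' x y := by
    have hx := (hF.exists_isExtension hτ x).choose_spec
    have hy := (hF.exists_isExtension hτ y).choose_spec
    have hxy := hx.add hy
    rw [(hF.exists_isExtension hτ (x + y)).choose_spec.map_eq f hxy hh, ← map_add, ← map_add]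
    congr 2
    ext
    exact smul_add _ _ _
  map_smul' a x := by
    obtain ⟨b, rfl⟩ := resPoly_surjective hτ.1 a
    have hx := (hF.exists_isExtension hτ x).choose_spec
    have hbx := hx.smul b
    rw [(hF.exists_isExtension hτ _).choose_spec.map_eq f hbx hh, RingHom.id_apply, smul_eq_mul,
      ← map_mul, ← smul_eq_mul, ← map_smul]
    congr 2
    ext
    exact smul_comm _ _ _

theorem phiAux_apply (hF : F.IsPerverse) {h : Module.Dual ℝ (lin σ)} (hh : HasKernel hτ h)
    (f : F.relative σ →ₗ[Poly σ] Poly σ) (g : F.relative τ) {g' : F.obj σ}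
    (hg : F.IsExtension hτ g.1 g') :
    phiAux hF hh f g = resPoly hτ.1 (f ⟨_, hg.smul_mem hh⟩) :=
  (hF.exists_isExtension hτ g).choose_spec.map_eq f hg hh

/-- The map `φ_h : Hom(F_{(σ,∂σ)}, A_σ) → Hom(F_{(τ,∂τ)}, A_τ)`. -/
def phi (hF : F.IsPerverse) {h : Module.Dual ℝ (lin σ)} (hh : HasKernel hτ h) :
    (F.relative σ →ₗ[Poly σ] Poly σ) →ₗ[ℝ] (F.relative τ →ₗ[Poly τ] Poly τ) where
  toFun := phiAux hF hh
  map_add' f f' := by ext g; exact map_add (resPoly hτ.1) _ _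
  map_smul' c f := by ext g; exact map_smul (resPoly hτ.1) c _

end Phi

theorem exists_outward {τ σ : Δ.Cone} (hτ : IsFacet τ σ) [FiniteDimensional ℝ V] :
    ∃ h : Module.Dual ℝ (lin σ), HasKernel hτ h ∧ ∀ v : lin σ, (v : V) ∈ σ.1 → h v ≤ 0 := by
  obtain ⟨l, h0, -, hk, x, hx, hlx⟩ := exists_support hτ.lt
  refine ⟨-(l ∘ₗ (lin σ).subtype), fun v => ?_, fun v hv => by simpa using h0 v hv⟩
  have hle : lin τ ≤ lin σ ⊓ LinearMap.ker l := le_inf (lin_mono hτ.1) hk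
  have hlt : lin σ ⊓ LinearMap.ker l < lin σ := lt_of_le_of_ne inf_le_left fun e => by
    have h1 : x ∈ lin σ := Submodule.subset_span hx
    rw [← e] at h1
    exact hlx h1.2
  have h1 := Submodule.finrank_lt_finrank_of_lt hlt
  have h2 := hτ.2
  unfold dim at h2
  have e : lin τ = lin σ ⊓ LinearMap.ker l :=
    Submodule.eq_of_le_of_finrank_le hle (by omega)
  rw [e]
  simp

variable [FiniteDimensional ℝ V]

/-- A linear form on `V_σ` with kernel `V_τ` which is nonpositive on `σ`. -/
def outward {τ σ : Δ.Cone} (hτ : IsFacet τ σ) : Module.Dual ℝ (lin σ) := (exists_outward hτ).choose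

theorem hasKernel_outward {τ σ : Δ.Cone} (hτ : IsFacet τ σ) : HasKernel hτ (outward hτ) :=
  (exists_outward hτ).choose_spec.1

/-- A choice of an orientation for each cone of `Δ`. -/
abbrev Orientations (Δ : Fan V) : Type u := ∀ σ : Δ.Cone, Orientation ℝ (lin σ) (Fin (dim σ))

/-- `ω` is a volume form that represents the given orientation. -/
def Represents {σ : Δ.Cone} (ω : Det σ) (o : Orientation ℝ (lin σ) (Fin (dim σ))) : Prop :=
  ∃ h : ω ≠ 0, rayOfNeZero ℝ ω h = o

open Classical in
/-- The transition coefficient `ε^σ_τ = ±1`: it is `1` if the orientation of `τ` is the one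
induced by the orientation of `σ` (outward normal first), and `-1` otherwise. -/
def transition (o : Orientations Δ) {τ σ : Δ.Cone} (hτ : IsFacet τ σ) : ℝ :=
  if ∃ ω : Det σ, Represents ω (o σ) ∧ Represents (psi (hasKernel_outward hτ) ω) (o τ)
    then 1 else -1

/-! `φ_h ⊗ ψ_h` does not depend on `h`: two forms with kernel `V_τ` are proportional, and
`φ_{ch} = c φ_h`, `ψ_{ch} = c⁻¹ ψ_h`. -/

theorem phi_smul {F : Sheaf Δ} (hF : F.IsPerverse) {τ σ : Δ.Cone} {hτ : IsFacet τ σ}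
    {h : Module.Dual ℝ (lin σ)} (hh : HasKernel hτ h) {c : ℝ} (hc : HasKernel hτ (c • h)) :
    phi hF hc = c • phi hF hh := by
  ext f g
  obtain ⟨g', hg'⟩ := hF.exists_isExtension hτ g
  change phiAux hF hc f g = c • phiAux hF hh f g
  rw [phiAux_apply hF hc f g hg', phiAux_apply hF hh f g hg', ← map_smul,
    ← LinearMap.map_smul_of_tower]
  congr 2
  ext
  change SymmetricAlgebra.ι ℝ _ (c • h) • g' = c • (SymmetricAlgebra.ι ℝ _ h • g')
  rw [map_smul, smul_assoc]

theorem contract_eq {τ σ : Δ.Cone} (hτ : IsFacet τ σ) {v w : lin σ}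
    (h : ((v - w : lin σ) : V) ∈ lin τ) : contract hτ v = contract hτ w := by
  have h0 : contract hτ (v - w) = 0 := by
    ext ω x
    change (ω.domDomCongr (finCongr hτ.2)) (Matrix.vecCons (v - w) _) = 0
    apply AlternatingMap.map_linearDependent
    intro hli
    let u : Fin (dim τ + 1) → lin τ := Matrix.vecCons ⟨_, h⟩ x
    have hu : LinearIndependent ℝ u := by
      refine LinearIndependent.of_comp (Submodule.inclusion (lin_mono hτ.1)) ?_
      have e : Submodule.inclusion (lin_mono hτ.1) ∘ u = Matrix.vecCons (v - w)
          fun i => Submodule.inclusion (lin_mono hτ.1) (x i) := by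
        funext i
        exact Fin.cases rfl (fun i => rfl) i
      rw [e]
      exact hli
    have := hu.fintype_card_le_finrank
    rw [Fintype.card_fin] at this
    exact absurd this (Nat.not_succ_le_self _)
  have h1 : contract hτ v = contract hτ (v - w) + contract hτ w := by
    ext ω x
    change ((ω.domDomCongr (finCongr hτ.2)).curryLeft v) _ =
      ((ω.domDomCongr (finCongr hτ.2)).curryLeft (v - w)) _ +
        ((ω.domDomCongr (finCongr hτ.2)).curryLeft w) _
    rw [map_sub]
    simp
  rw [h1, h0, zero_add]

theorem psi_eq_contract {τ σ : Δ.Cone} {hτ : IsFacet τ σ} {h : Module.Dual ℝ (lin σ)}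
    (hh : HasKernel hτ h) {v : lin σ} (hv : h v = 1) : psi hh = contract hτ v :=
  contract_eq hτ ((hh _).1 (by rw [map_sub, hv, hh.exists_eq_one.choose_spec, sub_self]))

theorem psi_smul {τ σ : Δ.Cone} {hτ : IsFacet τ σ} {h : Module.Dual ℝ (lin σ)}
    (hh : HasKernel hτ h) {c : ℝ} (hc : HasKernel hτ (c • h)) : psi hc = c⁻¹ • psi hh := by
  obtain ⟨v, hv⟩ := hh.exists_eq_one
  obtain ⟨w, hw⟩ := hc.exists_eq_one
  have c0 : c ≠ 0 := by rintro rfl; simp at hw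
  have e : (c • h) (c⁻¹ • v) = 1 := by simp [hv, c0]
  rw [psi_eq_contract hc e, psi_eq_contract hh hv]
  ext ω x
  change ((ω.domDomCongr (finCongr hτ.2)).curryLeft (c⁻¹ • v)) _ =
    c⁻¹ • ((ω.domDomCongr (finCongr hτ.2)).curryLeft v) _
  rw [map_smul]
  rfl

theorem map_phi_psi_eq {F : Sheaf Δ} (hF : F.IsPerverse) {τ σ : Δ.Cone} {hτ : IsFacet τ σ}
    {h h' : Module.Dual ℝ (lin σ)} (hh : HasKernel hτ h) (hh' : HasKernel hτ h') :
    TensorProduct.map (phi hF hh') (psi hh') = TensorProduct.map (phi hF hh) (psi hh) := by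
  obtain ⟨c, rfl⟩ := hh.exists_smul hh'
  have c0 : c ≠ 0 := by
    rintro rfl
    obtain ⟨w, hw⟩ := hh'.exists_eq_one
    simp at hw
  rw [phi_smul hF hh hh', psi_smul hh hh', TensorProduct.map_smul_left,
    TensorProduct.map_smul_right, smul_smul, mul_inv_cancel₀ c0, one_smul]

section Dual

variable (F : Sheaf Δ) (hF : F.IsPerverse) (o : Orientations Δ)

/-- `(DF)_σ = Hom(F_{(σ,∂σ)}, A_σ) ⊗ det V_σ^*`. -/
abbrev DualObj (σ : Δ.Cone) : Type u := (F.relative σ →ₗ[Poly σ] Poly σ) ⊗[ℝ] Det σ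

/-- The homomorphisms `F_{(σ,∂σ)} → A_σ` of degree `q`. -/
def homDeg (σ : Δ.Cone) (q : ℤ) : Submodule ℝ (F.relative σ →ₗ[Poly σ] Poly σ) where
  carrier := {f | ∀ (i : ℤ) (x : F.relative σ), x.1 ∈ F.deg σ i → f x ∈ polyDeg σ (i + q)}
  add_mem' hf hg i x hx := add_mem (hf i x hx) (hg i x hx)
  zero_mem' _ _ _ := zero_mem _
  smul_mem' c _ hf i x hx := Submodule.smul_mem _ c (hf i x hx)

variable {F}

/-- The map `r^σ_τ = φ_h ⊗ ψ_h` for a facet `τ` of `σ`, which does not depend on the linear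
form `h` with kernel `V_τ` (`map_phi_psi_eq`). -/
def dualFacetMap {τ σ : Δ.Cone} (hτ : IsFacet τ σ) : DualObj F σ →ₗ[ℝ] DualObj F τ :=
  TensorProduct.map (phi hF (hasKernel_outward hτ)) (psi (hasKernel_outward hτ))

/-- The composition of the maps `ε^σ_τ r^σ_τ` along an ascending chain of facets. -/
def dualChainMap : ∀ {τ σ : Δ.Cone}, FacetChain τ σ → (DualObj F σ →ₗ[ℝ] DualObj F τ)
  | _, _, .refl _ => LinearMap.id
  | _, _, .step c hτ => dualChainMap c ∘ₗ (transition o hτ • dualFacetMap hF hτ)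

variable (F)

/-- The dual sheaf `DF`, with restriction maps `(DF)_σ → (DF)_τ` given by the composition along
an ascending chain of facets from `τ` to `σ`. -/
def Sheaf.dual : ModuleSystem Δ where
  obj σ := DualObj F σ
  deg σ := tensorDeg (homDeg F σ) (detDeg σ)
  res h := dualChainMap hF o (nonempty_facetChain h).some

end Dual

end Fan

end

/-!
The theorem has three parts: a simple sheaf exists, it is perverse, and it is dual to itself up to
the twist by `det V_σ^*`. Existence and perversity are formal. Attaching to the boundary of each
cone `τ` the free module on `F_{∂τ} / 𝔪 F_{∂τ}`, dimension after dimension, constructs a simple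
sheaf (`Fan.exists_isSimple`), and graded Nakayama shows that the resulting modules surject onto the
sections over the boundary (`Fan.Sheaf.IsSimple.isPerverse`). The content is the duality.

*Signs.* Volume forms on the spaces `V_σ` identify `(DF)_σ` with `Hom(F_{(σ,∂σ)}, A_σ)`. They also
single out, for each facet `τ` of `σ`, an equation `h^σ_τ ≤ 0` of `V_τ` whose contraction takes the
volume form of `σ` to plus or minus that of `τ`. The signs that appear are exactly the transition
coefficients, so that the restriction maps of `DF` become the maps `φ_h` for these normalized
equations (`Fan.normalSystem`, `Fan.transition_smul_dualFacetMap`). Let the facets `δ₁` and `δ₂` of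
`σ` meet in a face `ζ` of codimension two. Contracting the volume form of `σ` down to `ζ` in both
orders shows that the equations of `ζ` in `δ₁` and in `δ₂` are the restrictions of those of `δ₂` and
of `δ₁`, multiplied by the same factor. Hence the two compositions of maps `φ_h` from `σ` to `ζ`
agree (`Fan.FormSystem.phi_comm`).

*Sweeping a cone.* Let a point move along a line in `V_σ` in general position and cross the
hyperplanes of the facets of `σ` one at a time, as in a line shelling. The part of the boundary of a
facet `δ` that lies in earlier facets consists of the facets of `δ` visible from the point where the
line meets `V_δ`; this makes induction on the dimension possible. Three facts about a perverse sheaf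
`F` are proved by adding one facet at a time: the sections over `σ` that vanish on the facets
visible from a point form a projective `A_σ`-module, in particular `F_{(σ,∂σ)}` is projective
(`Fan.Sheaf.IsPerverse.projective_relOn`, `Fan.Sheaf.IsPerverse.projective_relative`); sections over
the facets of `σ` that agree on the faces of codimension two extend to `σ`
(`Fan.Sheaf.IsPerverse.exists_res_eq`); and the same is true of the dual
(`Fan.FormSystem.exists_phi_eq`). The last one says that the dual is flabby. It rests on the
division of a homomorphism by equations of facets, and on projectivity to lift homomorphisms from a
facet.

*Minimality.* For a simple sheaf `L` and `dim τ > dim σ` the sections in `L_{(τ,∂τ)}` lie in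
`𝔪 L_τ` (`Fan.Sheaf.IsSimple.relative_le`). The dual inherits this: a homomorphism that restricts to
`0` on all facets of `τ` extends from `L_{(τ,∂τ)}` to `L_τ`, and therefore lies in
`𝔪 Hom(L_{(τ,∂τ)}, A_τ)` (`Fan.FormSystem.mem_smul_top`).

*Conclusion.* The isomorphism from the dual to `L` is constructed dimension by dimension. Both sides
are projective at `τ` and flabby, so that the isomorphism over the boundary of `τ` and its inverse
lift to homogeneous maps in both directions. By minimality on both sides the two lifts are inverse
to each other modulo `𝔪`, and graded Nakayama makes them bijective
(`Fan.FormSystem.exists_isDuality_step`, `bijective_of_graded_nakayama`). On the cones of dimension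
at most `dim σ` there is only `Hom(A_σ, A_σ) = A_σ` to consider.
-/

noncomputable section

/-! ### Internally graded modules -/

section Graded

variable {M N : Type*} [AddCommGroup M] [Module ℝ M] [AddCommGroup N] [Module ℝ N]
  {d : ℤ → Submodule ℝ M} {e : ℤ → Submodule ℝ N}

/-- The decomposition of an internally graded module. -/
def gradedEquiv (h : DirectSum.IsInternal d) : M ≃ₗ[ℝ] DirectSum ℤ fun i => d i :=
  (LinearEquiv.ofBijective (DirectSum.coeLinearMap d)
    (show Function.Bijective (DirectSum.coeLinearMap d) from h)).symm

theorem gradedEquiv_of_mem (h : DirectSum.IsInternal d) {i : ℤ} {x : M} (hx : x ∈ d i) :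
    gradedEquiv h x = DirectSum.lof ℝ ℤ (fun i => d i) i ⟨x, hx⟩ := by
  rw [gradedEquiv, LinearEquiv.symm_apply_eq, LinearEquiv.ofBijective_apply,
    DirectSum.coeLinearMap_lof]

/-- The projection of an internally graded module onto its homogeneous elements of degree `q`. -/
def gradedComp (h : DirectSum.IsInternal d) (q : ℤ) : M →ₗ[ℝ] M :=
  (d q).subtype ∘ₗ DirectSum.component ℝ ℤ (fun i => d i) q ∘ₗ (gradedEquiv h).toLinearMap

theorem gradedComp_mem (h : DirectSum.IsInternal d) (q : ℤ) (x : M) : gradedComp h q x ∈ d q :=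
  Subtype.prop _

theorem gradedComp_of_mem_aux (h : DirectSum.IsInternal d) {i : ℤ} (q : ℤ) {x : M} (hx : x ∈ d i) :
    gradedComp h q x = if q = i then x else 0 := by
  simp only [gradedComp, LinearMap.comp_apply, LinearEquiv.coe_coe, gradedEquiv_of_mem h hx,
    Submodule.subtype_apply]
  split_ifs with hq
  · subst hq
    rw [DirectSum.component.lof_self]
  · rw [DirectSum.component.of]
    simp [Ne.symm hq]

theorem gradedComp_of_mem (h : DirectSum.IsInternal d) {q : ℤ} {x : M} (hx : x ∈ d q) :
    gradedComp h q x = x := by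
  simp [gradedComp_of_mem_aux h q hx]

theorem gradedComp_of_ne (h : DirectSum.IsInternal d) {i q : ℤ} {x : M} (hx : x ∈ d i)
    (hq : q ≠ i) : gradedComp h q x = 0 := by
  simp [gradedComp_of_mem_aux h q hx, hq]

theorem DirectSum.IsInternal.induction {motive : M → Prop} (h : DirectSum.IsInternal d) (x : M)
    (mem : ∀ q, ∀ x ∈ d q, motive x) (add : ∀ x y, motive x → motive y → motive (x + y)) :
    motive x := by
  have hx : x ∈ ⨆ i, d i := h.submodule_iSup_eq_top ▸ Submodule.mem_top
  induction hx using Submodule.iSup_induction' with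
  | mem i x hx => exact mem i x hx
  | zero => exact mem 0 0 (zero_mem _)
  | add x y _ _ hx hy => exact add x y hx hy

/-- Every element is the sum of its homogeneous components. The sum is taken over an arbitrary
large enough finite set of degrees, in order that such sums can be added. -/
theorem exists_eq_sum_gradedComp (h : DirectSum.IsInternal d) (x : M) :
    ∃ s : Finset ℤ, ∀ t : Finset ℤ, s ⊆ t → x = ∑ q ∈ t, gradedComp h q x := by
  classical
  induction x using h.induction with
  | mem q x hx =>
    refine ⟨{q}, fun t ht => ?_⟩
    have hq : q ∈ t := ht (by simp)
    simp [gradedComp_of_mem_aux h _ hx, hq]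
  | add x y hx hy =>
    obtain ⟨s, hs⟩ := hx
    obtain ⟨s', hs'⟩ := hy
    refine ⟨s ∪ s', fun t ht => ?_⟩
    simp only [map_add, Finset.sum_add_distrib]
    rw [← hs t (Finset.subset_union_left.trans ht), ← hs' t (Finset.subset_union_right.trans ht)]

theorem eq_zero_of_gradedComp (h : DirectSum.IsInternal d) {x : M}
    (hx : ∀ q, gradedComp h q x = 0) : x = 0 := by
  obtain ⟨s, hs⟩ := exists_eq_sum_gradedComp h x
  rw [hs s subset_rfl]
  simp [hx]

theorem ext_gradedComp (h : DirectSum.IsInternal d) {x y : M}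
    (hx : ∀ q, gradedComp h q x = gradedComp h q y) : x = y :=
  sub_eq_zero.1 (eq_zero_of_gradedComp h fun q => by rw [map_sub, hx, sub_self])

theorem mem_of_gradedComp (h : DirectSum.IsInternal d) {q : ℤ} {x : M}
    (hx : ∀ i, i ≠ q → gradedComp h i x = 0) : x ∈ d q := by
  have : x = gradedComp h q x := ext_gradedComp h fun i => by
    by_cases hi : i = q
    · subst hi; rw [gradedComp_of_mem h (gradedComp_mem h i x)]
    · rw [hx i hi, gradedComp_of_ne h (gradedComp_mem h q x) hi]
  rw [this]
  exact gradedComp_mem h q x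

/-- A map that shifts degrees by `s` commutes with the projections to the graded pieces. -/
theorem map_gradedComp (h : DirectSum.IsInternal d) (h' : DirectSum.IsInternal e) (s : ℤ)
    (f : M →ₗ[ℝ] N) (hf : ∀ q, ∀ x ∈ d q, f x ∈ e (q + s)) (q : ℤ) (x : M) :
    f (gradedComp h q x) = gradedComp h' (q + s) (f x) := by
  induction x using h.induction with
  | mem i x hx =>
    rw [gradedComp_of_mem_aux h q hx, gradedComp_of_mem_aux h' (q + s) (hf i x hx)]
    by_cases hq : q = i <;> simp [hq]
  | add x y hx hy => simp [hx, hy]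

/-- A family of subspaces that spans `M` is a grading as soon as there are enough linear maps
each of which kills all but one of the subspaces. -/
theorem isInternal_of_separating {κ : Type*} {N : κ → Type*} [∀ k, AddCommGroup (N k)]
    [∀ k, Module ℝ (N k)] (f : ∀ k, M →ₗ[ℝ] N k) (c : κ → ℤ)
    (hf : ∀ k q, ∀ x ∈ d q, q ≠ c k → f k x = 0) (hinj : ∀ x, (∀ k, f k x = 0) → x = 0)
    (htop : ∀ x, x ∈ ⨆ q, d q) : DirectSum.IsInternal d := by
  rw [DirectSum.isInternal_submodule_iff_iSupIndep_and_iSup_eq_top]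
  refine ⟨fun i => Submodule.disjoint_def.2 fun x hx hx' => hinj x fun k => ?_,
    eq_top_iff.2 fun x _ => htop x⟩
  by_cases hk : i = c k
  · have : (⨆ j, ⨆ (_ : j ≠ i), d j) ≤ LinearMap.ker (f k) :=
      iSup₂_le fun j hj y hy => hf k j y hy (hk ▸ hj)
    exact this hx'
  · exact hf k i x hx hk

/-- A subspace that contains the homogeneous components of its elements is graded. -/
theorem isInternal_comap (h : DirectSum.IsInternal d) (K : Submodule ℝ M)
    (hK : ∀ q, ∀ x ∈ K, gradedComp h q x ∈ K) :
    DirectSum.IsInternal fun q => (d q).comap K.subtype := by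
  refine isInternal_of_separating (fun q => gradedComp h q ∘ₗ K.subtype) id
    (fun k q x hx hq => gradedComp_of_ne h hx (Ne.symm hq))
    (fun x hx => Subtype.ext (eq_zero_of_gradedComp h hx)) fun x => ?_
  obtain ⟨s, hs⟩ := exists_eq_sum_gradedComp h x.1
  have : x = ∑ q ∈ s, ⟨gradedComp h q x.1, hK q x.1 x.2⟩ := by
    apply Subtype.ext
    rw [AddSubmonoidClass.coe_finsetSum]
    exact hs s subset_rfl
  rw [this]
  exact Submodule.sum_mem _ fun q _ => Submodule.mem_iSup_of_mem q (gradedComp_mem h q x.1)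

theorem isInternal_tensor {M N : Type u} [AddCommGroup M] [Module ℝ M] [AddCommGroup N]
    [Module ℝ N] {d : ℤ → Submodule ℝ M} {e : ℤ → Submodule ℝ N} (h : DirectSum.IsInternal d)
    (h' : DirectSum.IsInternal e) : DirectSum.IsInternal (Fan.tensorDeg d e) := by
  refine isInternal_of_separating
    (fun k : ℤ × ℤ => TensorProduct.map (gradedComp h k.1) (gradedComp h' k.2))
    (fun k => k.1 + k.2) (fun k q x hx hq => ?_) (fun x hx => ?_) fun x => ?_
  · have : Fan.tensorDeg d e q ≤
        LinearMap.ker (TensorProduct.map (gradedComp h k.1) (gradedComp h' k.2)) := by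
      refine iSup_le fun i => Submodule.map₂_le.2 fun m hm n hn => ?_
      rw [LinearMap.mem_ker, TensorProduct.mk_apply, TensorProduct.map_tmul,
        gradedComp_of_mem_aux h _ hm, gradedComp_of_mem_aux h' _ hn]
      by_cases h1 : k.1 = i
      · rw [if_neg (by omega : k.2 ≠ q - i), TensorProduct.tmul_zero]
      · rw [if_neg h1, TensorProduct.zero_tmul]
    exact this hx
  -- an element is the sum of its bihomogeneous components
  · have key : ∃ s : Finset ℤ, ∀ t, s ⊆ t → x = ∑ k ∈ t ×ˢ t,
        TensorProduct.map (gradedComp h k.1) (gradedComp h' k.2) x := by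
      classical
      clear hx
      induction x using TensorProduct.induction_on with
      | zero => exact ⟨∅, fun t _ => by simp⟩
      | tmul m n =>
        obtain ⟨s, hs⟩ := exists_eq_sum_gradedComp h m
        obtain ⟨s', hs'⟩ := exists_eq_sum_gradedComp h' n
        refine ⟨s ∪ s', fun t ht => ?_⟩
        conv_lhs => rw [hs t (Finset.subset_union_left.trans ht),
          hs' t (Finset.subset_union_right.trans ht)]
        rw [TensorProduct.sum_tmul, Finset.sum_product]
        simp only [TensorProduct.tmul_sum, TensorProduct.map_tmul]
      | add x y hx hy =>
        obtain ⟨s, hs⟩ := hx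
        obtain ⟨s', hs'⟩ := hy
        refine ⟨s ∪ s', fun t ht => ?_⟩
        simp only [map_add, Finset.sum_add_distrib]
        rw [← hs t (Finset.subset_union_left.trans ht),
          ← hs' t (Finset.subset_union_right.trans ht)]
    obtain ⟨s, hs⟩ := key
    rw [hs s subset_rfl]
    exact Finset.sum_eq_zero fun k _ => hx k
  · induction x using TensorProduct.induction_on with
    | zero => exact zero_mem _
    | add x y hx hy => exact add_mem hx hy
    | tmul m n =>
      induction m using h.induction with
      | add x y hx hy => rw [TensorProduct.add_tmul]; exact add_mem hx hy
      | mem i m hm =>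
        induction n using h'.induction with
        | add x y hx hy => rw [TensorProduct.tmul_add]; exact add_mem hx hy
        | mem j n hn =>
          refine Submodule.mem_iSup_of_mem (i + j) (Submodule.mem_iSup_of_mem i ?_)
          exact Submodule.apply_mem_map₂ _ hm (by simpa using hn)

end Graded

/-- If a linear property `C` of pairs admits a partner for every element of a projective module,
then partners can be chosen linearly. -/
theorem exists_lift_of_projective {A M N : Type*} [CommRing A] [AddCommGroup M] [Module A M]
    [AddCommGroup N] [Module A N] [Module.Projective A M] (C : Submodule A (M × N))
    (hsurj : ∀ x, ∃ y, (x, y) ∈ C) : ∃ f : M →ₗ[A] N, ∀ x, (x, f x) ∈ C := by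
  obtain ⟨t, ht⟩ := Module.projective_lifting_property (LinearMap.fst A M N ∘ₗ C.subtype)
    LinearMap.id fun x => by
      obtain ⟨y, hy⟩ := hsurj x
      exact ⟨⟨_, hy⟩, rfl⟩
  refine ⟨LinearMap.snd A M N ∘ₗ C.subtype ∘ₗ t, fun x => ?_⟩
  have h1 : ((t x).1).1 = x := LinearMap.congr_fun ht x
  have h2 : (x, (LinearMap.snd A M N ∘ₗ C.subtype ∘ₗ t) x) = (t x).1 := Prod.ext h1.symm rfl
  rw [h2]
  exact (t x).2

/-! ### Graded modules over a graded algebra -/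

section GradedModule

variable {A M N : Type*} [CommRing A] [Algebra ℝ A] [AddCommGroup M] [Module ℝ M] [Module A M]
  [IsScalarTower ℝ A M] [AddCommGroup N] [Module ℝ N] [Module A N] [IsScalarTower ℝ A N]
  {a : ℤ → Submodule ℝ A} {d : ℤ → Submodule ℝ M} {e : ℤ → Submodule ℝ N}

/-- The homogeneous elements `d` make `M` a graded module over the algebra `A`, graded by `a`. -/
structure IsGradedModule (a : ℤ → Submodule ℝ A) (d : ℤ → Submodule ℝ M) : Prop where
  alg : DirectSum.IsInternal a
  isInternal : DirectSum.IsInternal d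
  smul_mem : ∀ {i j : ℤ} {c : A} {x : M}, c ∈ a i → x ∈ d j → c • x ∈ d (i + j)

theorem IsGradedModule.gradedComp_smul (h : IsGradedModule a d) {i : ℤ} {c : A} (hc : c ∈ a i)
    (q : ℤ) (x : M) :
    gradedComp h.isInternal (q + i) (c • x) = c • gradedComp h.isInternal q x :=
  (map_gradedComp h.isInternal h.isInternal i
    (Module.toModuleEnd ℝ (S := A) M c)
    (fun q x hx => by rw [add_comm]; exact h.smul_mem hc hx) q x).symm

/-- The linear map which is the component of degree `s` of a linear map. -/
def homComp (hd : IsGradedModule a d) (he : IsGradedModule a e) (f : M →ₗ[A] N) (s : ℤ) :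
    M →ₗ[A] N :=
  let g : M →ₗ[ℝ] N :=
    DirectSum.toModule ℝ ℤ N
      (fun i => gradedComp he.isInternal (i + s) ∘ₗ f.restrictScalars ℝ ∘ₗ (d i).subtype) ∘ₗ
    (gradedEquiv hd.isInternal).toLinearMap
  have hg : ∀ i, ∀ x ∈ d i, g x = gradedComp he.isInternal (i + s) (f x) := fun i x hx => by
    simp only [g, LinearMap.comp_apply, LinearEquiv.coe_coe, gradedEquiv_of_mem hd.isInternal hx,
      DirectSum.toModule_lof]
    rfl
  { g with
    map_smul' := fun c x => by
      change g (c • x) = c • g x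
      induction x using hd.isInternal.induction with
      | add x y hx hy => rw [smul_add, map_add, map_add, smul_add, hx, hy]
      | mem j x hx =>
        induction c using hd.alg.induction with
        | add b c hb hc => rw [add_smul, map_add, hb, hc, add_smul]
        | mem i c hc =>
          rw [hg _ _ (hd.smul_mem hc hx), hg _ _ hx, map_smul, ← he.gradedComp_smul hc]
          congr 2
          ring }

theorem homComp_apply (hd : IsGradedModule a d) (he : IsGradedModule a e) (f : M →ₗ[A] N) (s : ℤ)
    {i : ℤ} {x : M} (hx : x ∈ d i) :
    homComp hd he f s x = gradedComp he.isInternal (i + s) (f x) := by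
  change (DirectSum.toModule ℝ ℤ N _ ∘ₗ
    (gradedEquiv hd.isInternal).toLinearMap) x = _
  simp only [LinearMap.comp_apply, LinearEquiv.coe_coe, gradedEquiv_of_mem hd.isInternal hx,
      DirectSum.toModule_lof]
  rfl

theorem homComp_mem (hd : IsGradedModule a d) (he : IsGradedModule a e) (f : M →ₗ[A] N) (s : ℤ)
    {i : ℤ} {x : M} (hx : x ∈ d i) : homComp hd he f s x ∈ e (i + s) := by
  rw [homComp_apply hd he f s hx]
  exact gradedComp_mem _ _ _

/-- A linear map on a finitely generated graded module has only finitely many homogeneous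
components. -/
theorem exists_eq_sum_homComp [Module.Finite A M] (hd : IsGradedModule a d)
    (he : IsGradedModule a e) (f : M →ₗ[A] N) :
    ∃ s : Finset ℤ, f = ∑ q ∈ s, homComp hd he f q := by
  classical
  have key : ∀ x : M, ∃ s : Finset ℤ, ∀ t, s ⊆ t → f x = ∑ q ∈ t, homComp hd he f q x := by
    intro x
    induction x using hd.isInternal.induction with
    | add x y hx hy =>
      obtain ⟨s, hs⟩ := hx
      obtain ⟨s', hs'⟩ := hy
      refine ⟨s ∪ s', fun t ht => ?_⟩
      simp only [map_add, Finset.sum_add_distrib]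
      rw [← hs t (Finset.subset_union_left.trans ht), ← hs' t (Finset.subset_union_right.trans ht)]
    | mem i x hx =>
      obtain ⟨s, hs⟩ := exists_eq_sum_gradedComp he.isInternal (f x)
      refine ⟨s.image (· - i), fun t ht => ?_⟩
      conv_lhs => rw [hs (t.image (i + ·)) fun q hq => by
        refine Finset.mem_image.2 ⟨q - i, ht (Finset.mem_image_of_mem _ hq), by ring⟩]
      rw [Finset.sum_image fun _ _ _ _ => add_left_cancel]
      exact Finset.sum_congr rfl fun q _ => (homComp_apply hd he f q hx).symm
  choose s hs using key
  obtain ⟨G, hG⟩ := Module.Finite.fg_top (R := A) (M := M)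
  refine ⟨G.biUnion s, LinearMap.ext_on hG fun x hx => ?_⟩
  rw [hs x (G.biUnion s) (Finset.subset_biUnion_of_mem s hx)]
  simp

/-- The linear maps on a finitely generated graded module form a graded vector space. -/
theorem isInternal_hom [Module.Finite A M] (hd : IsGradedModule a d) (he : IsGradedModule a e)
    (H : ℤ → Submodule ℝ (M →ₗ[A] N))
    (hH : ∀ q f, f ∈ H q ↔ ∀ i, ∀ x ∈ d i, f x ∈ e (i + q)) : DirectSum.IsInternal H := by
  refine isInternal_of_separating
    (fun k : (Σ i, d i) × ℤ =>
      (gradedComp he.isInternal (k.1.1 + k.2) ∘ₗ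
        { toFun := fun f : M →ₗ[A] N => f k.1.2
          map_add' := fun _ _ => rfl
          map_smul' := fun _ _ => rfl } : (M →ₗ[A] N) →ₗ[ℝ] N)) (fun k => k.2)
    (fun k q f hf hq => ?_) (fun f hf => ?_) fun f => ?_
  · exact gradedComp_of_ne _ ((hH q f).1 hf _ _ k.1.2.2) (by omega)
  · ext x
    induction x using hd.isInternal.induction with
    | add x y hx hy => rw [map_add, hx, hy]; simp
    | mem i x hx =>
      refine eq_zero_of_gradedComp he.isInternal fun q => ?_
      have := hf (⟨i, x, hx⟩, q - i)
      simpa using this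
  · obtain ⟨s, hs⟩ := exists_eq_sum_homComp hd he f
    rw [hs]
    exact Submodule.sum_mem _ fun q _ => Submodule.mem_iSup_of_mem q
      ((hH q _).2 fun i x hx => homComp_mem hd he f q hx)

/-- If a property `C` of pairs is linear and homogeneous, and every element of the projective
module `M` has a partner, then partners can be chosen linearly and homogeneously. -/
theorem exists_graded_lift [Module.Projective A M] (hd : IsGradedModule a d)
    (he : IsGradedModule a e) (s : ℤ) (C : Submodule A (M × N))
    (hC : ∀ q, ∀ z ∈ C, (gradedComp hd.isInternal q z.1,
      gradedComp he.isInternal (q + s) z.2) ∈ C)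
    (hsurj : ∀ x, ∃ y, (x, y) ∈ C) :
    ∃ f : M →ₗ[A] N, (∀ x, (x, f x) ∈ C) ∧ ∀ q, ∀ x ∈ d q, f x ∈ e (q + s) := by
  obtain ⟨f, hf⟩ := exists_lift_of_projective C hsurj
  refine ⟨homComp hd he f s, fun x => ?_, fun q x hx => homComp_mem hd he f s hx⟩
  induction x using hd.isInternal.induction with
  | add x y hx hy =>
    have := add_mem hx hy
    rwa [Prod.mk_add_mk, ← map_add] at this
  | mem q x hx =>
    rw [homComp_apply hd he f s hx]
    have := hC q _ (hf x)
    rwa [gradedComp_of_mem _ hx] at this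

/-- The graded Nakayama lemma, for algebras in nonnegative degrees. -/
theorem graded_nakayama [Module.Finite A M] (hd : IsGradedModule a d)
    (ha : ∀ q < 0, a q = ⊥) (K : Submodule A M)
    (hK : ∀ q, ∀ x ∈ K, gradedComp hd.isInternal q x ∈ K)
    (h : K ⊔ Ideal.span {c | ∃ q : ℤ, 0 < q ∧ c ∈ a q} • (⊤ : Submodule A M) = ⊤) : K = ⊤ := by
  classical
  set I := Ideal.span {c | ∃ q : ℤ, 0 < q ∧ c ∈ a q}
  -- the degrees of `M` are bounded below
  obtain ⟨b, hb⟩ : ∃ b : ℤ, ∀ q < b, d q = ⊥ := by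
    obtain ⟨G, hG⟩ := Module.Finite.fg_top (R := A) (M := M)
    have key : ∀ x : M, ∃ b : ℤ, ∀ c : A, ∀ q < b, gradedComp hd.isInternal q (c • x) = 0 := by
      intro x
      induction x using hd.isInternal.induction with
      | add x y hx hy =>
        obtain ⟨b, hb⟩ := hx
        obtain ⟨b', hb'⟩ := hy
        refine ⟨min b b', fun c q hq => ?_⟩
        rw [smul_add, map_add, hb c q (by omega), hb' c q (by omega), add_zero]
      | mem i x hx =>
        refine ⟨i, fun c q hq => ?_⟩
        induction c using hd.alg.induction with
        | add b c hb hc => rw [add_smul, map_add, hb, hc, add_zero]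
        | mem j c hc =>
          by_cases hj : j < 0
          · rw [ha j hj, Submodule.mem_bot] at hc
            rw [hc, zero_smul, map_zero]
          · exact gradedComp_of_ne _ (hd.smul_mem hc hx) (by omega)
    choose b hb using key
    obtain ⟨B, hB⟩ := (G.image b).bddBelow
    refine ⟨B, fun q hq => ?_⟩
    have hz : ∀ x : M, ∀ c : A, gradedComp hd.isInternal q (c • x) = 0 := by
      intro x
      have hx : x ∈ Submodule.span A (G : Set M) := hG ▸ Submodule.mem_top
      induction hx using Submodule.span_induction with
      | mem x hx =>
        exact fun c => hb x c q (hq.trans_le (hB (Finset.mem_coe.2 (Finset.mem_image_of_mem b hx))))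
      | zero => simp
      | add x y _ _ hx hy => intro c; rw [smul_add, map_add, hx, hy, add_zero]
      | smul r x _ hx => intro c; rw [smul_smul, hx]
    refine (Submodule.eq_bot_iff _).2 fun x hx => ?_
    rw [← gradedComp_of_mem hd.isInternal hx, ← one_smul A x, hz]
  -- an element of degree `q` lies in `K` up to elements `c • n` with `c` of positive degree and
  -- hence `n` of degree less than `q`
  have key : ∀ n : ℕ, ∀ q < b + n, ∀ x ∈ d q, x ∈ K := by
    intro n
    induction n with
    | zero =>
      intro q hq x hx
      rw [hb q (by simpa using hq), Submodule.mem_bot] at hx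
      rw [hx]
      exact zero_mem _
    | succ n ih =>
      intro q hq x hx
      have hI : ∀ y ∈ I • (⊤ : Submodule A M), gradedComp hd.isInternal q y ∈ K := by
        intro y hy
        induction hy using Submodule.smul_induction_on' with
        | add x _ y _ hx hy => rw [map_add]; exact add_mem hx hy
        | smul r hr n _ =>
          induction hr using Submodule.span_induction generalizing n with
          | zero => simp
          | add x y _ _ hx hy =>
            rw [add_smul, map_add]
            exact add_mem (hx n trivial) (hy n trivial)
          | smul r c _ hc =>
            rw [smul_eq_mul, mul_comm, mul_smul]
            exact hc _ trivial
          | mem c hc =>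
            obtain ⟨j, hj, hc⟩ := hc
            have : gradedComp hd.isInternal q (c • n) =
                c • gradedComp hd.isInternal (q - j) n := by
              rw [← hd.gradedComp_smul hc, sub_add_cancel]
            rw [this]
            exact K.smul_mem _ (ih (q - j) (by push_cast at hq; omega) _ (gradedComp_mem _ _ _))
      have hx' : x ∈ K ⊔ I • (⊤ : Submodule A M) := by rw [h]; trivial
      obtain ⟨k, hk, y, hy, rfl⟩ := Submodule.mem_sup.1 hx'
      rw [← gradedComp_of_mem hd.isInternal hx, map_add]
      exact add_mem (hK q k hk) (hI y hy)
  refine eq_top_iff.2 fun x _ => ?_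
  induction x using hd.isInternal.induction with
  | add x y hx hy => exact add_mem (hx trivial) (hy trivial)
  | mem q x hx => exact key (q - b + 1).toNat q (by omega) x hx

/-- A graded linear bijection identifies the homogeneous elements. -/
theorem mem_iff_of_injective (hd : DirectSum.IsInternal d) (he : DirectSum.IsInternal e)
    (f : M →ₗ[ℝ] N) (s : ℤ) (hf : ∀ q, ∀ x ∈ d q, f x ∈ e (q + s)) (hinj : Function.Injective f)
    (q : ℤ) (x : M) : f x ∈ e (q + s) ↔ x ∈ d q := by
  refine ⟨fun h => mem_of_gradedComp hd fun i hi => hinj ?_, hf q x⟩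
  rw [map_gradedComp hd he s f hf, map_zero]
  exact gradedComp_of_ne he h (by omega)

end GradedModule

/-! ### Symmetric algebras and polynomials on cones -/

/-- The algebra homomorphism to the square-zero extension `R ⊕ M` that extends the inclusion of `M`
is a left inverse on the generators. -/
theorem SymmetricAlgebra.ι_injective {R M : Type*} [CommRing R] [AddCommGroup M] [Module R M] :
    Function.Injective (SymmetricAlgebra.ι R M) := by
  intro x y hxy
  let _ : Module Rᵐᵒᵖ M := Module.compHom _ ((RingHom.id R).fromOpposite mul_comm)
  have : IsCentralScalar R M := ⟨fun r m => rfl⟩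
  have h := congrArg (SymmetricAlgebra.lift (TrivSqZeroExt.inrHom R M)) hxy
  rw [SymmetricAlgebra.lift_ι_apply, SymmetricAlgebra.lift_ι_apply] at h
  exact TrivSqZeroExt.inr_injective h

instance SymmetricAlgebra.instIsNoetherianRing {R M : Type*} [CommRing R] [IsNoetherianRing R]
    [AddCommGroup M] [Module R M] [Module.Free R M] [Module.Finite R M] :
    IsNoetherianRing (SymmetricAlgebra R M) :=
  isNoetherianRing_of_ringEquiv _
    (SymmetricAlgebra.equivMvPolynomial (Module.Free.chooseBasis R M)).symm.toRingEquiv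

namespace Fan

variable {V : Type u} [AddCommGroup V] [Module ℝ V] {Δ : Fan V}

theorem mem_polyDeg_of_mem_pow {σ : Δ.Cone} {k : ℕ} {a : Poly σ}
    (ha : a ∈ LinearMap.range (SymmetricAlgebra.ι ℝ (Module.Dual ℝ (lin σ))) ^ k) :
    a ∈ polyDeg σ (2 * k) :=
  Submodule.mem_iSup_of_mem k (Submodule.mem_iSup_of_mem rfl ha)

@[elab_as_elim]
theorem polyDeg_induction {σ : Δ.Cone} {q : ℤ} {motive : ∀ a, a ∈ polyDeg σ q → Prop}
    (pow : ∀ k : ℕ, 2 * (k : ℤ) = q → ∀ a,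
      a ∈ LinearMap.range (SymmetricAlgebra.ι ℝ (Module.Dual ℝ (lin σ))) ^ k →
        ∀ h, motive a h)
    (zero : motive 0 (zero_mem _))
    (add : ∀ a b ha hb, motive a ha → motive b hb → motive (a + b) (add_mem ha hb))
    {a : Poly σ} (ha : a ∈ polyDeg σ q) : motive a ha := by
  have hz : ∃ h, motive 0 h := ⟨_, zero⟩
  have hadd : ∀ a b, (∃ h, motive a h) → (∃ h, motive b h) → ∃ h, motive (a + b) h :=
    fun a b ⟨ha, h1⟩ ⟨hb, h2⟩ => ⟨_, add a b ha hb h1 h2⟩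
  obtain ⟨_, h⟩ : ∃ h, motive a h := by
    refine Submodule.iSup_induction _ (motive := fun a => ∃ h, motive a h) ha
      (fun k b hb => ?_) hz hadd
    refine Submodule.iSup_induction _ (motive := fun a => ∃ h, motive a h) hb
      (fun hk c hc => ?_) hz hadd
    exact ⟨hk ▸ mem_polyDeg_of_mem_pow hc, pow k hk c hc _⟩
  exact h

theorem ι_mem_polyDeg (σ : Δ.Cone) (l : Module.Dual ℝ (lin σ)) :
    SymmetricAlgebra.ι ℝ _ l ∈ polyDeg σ 2 :=
  mem_polyDeg_of_mem_pow (k := 1) (by rw [pow_one]; exact LinearMap.mem_range_self _ _)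

theorem algebraMap_mem_polyDeg (σ : Δ.Cone) (r : ℝ) : algebraMap ℝ (Poly σ) r ∈ polyDeg σ 0 :=
  mem_polyDeg_of_mem_pow (k := 0)
    (by rw [pow_zero]; exact Submodule.algebraMap_mem r)

theorem mul_mem_polyDeg {σ : Δ.Cone} {i j : ℤ} {a b : Poly σ} (ha : a ∈ polyDeg σ i)
    (hb : b ∈ polyDeg σ j) : a * b ∈ polyDeg σ (i + j) := by
  induction ha using polyDeg_induction with
  | zero => rw [zero_mul]; exact zero_mem _
  | add a a' _ _ ha ha' => rw [add_mul]; exact add_mem ha ha'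
  | pow k hk a ha =>
    induction hb using polyDeg_induction with
    | zero => rw [mul_zero]; exact zero_mem _
    | add b b' _ _ hb hb' => rw [mul_add]; exact add_mem hb hb'
    | pow l hl b hb =>
      rw [show i + j = 2 * ((k + l : ℕ) : ℤ) by push_cast; omega]
      exact mem_polyDeg_of_mem_pow (by rw [pow_add]; exact Submodule.mul_mem_mul ha hb)

theorem polyDeg_of_neg (σ : Δ.Cone) (q : ℤ) (hq : q < 0) : polyDeg σ q = ⊥ := by
  refine (Submodule.eq_bot_iff _).2 fun a ha => ?_
  induction ha using polyDeg_induction with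
  | zero => rfl
  | add a b _ _ ha hb => rw [ha, hb, add_zero]
  | pow k hk => omega

theorem mem_iSup_polyDeg (σ : Δ.Cone) (a : Poly σ) : a ∈ ⨆ q, polyDeg σ q := by
  induction a using SymmetricAlgebra.induction with
  | algebraMap r => exact Submodule.mem_iSup_of_mem 0 (algebraMap_mem_polyDeg σ r)
  | ι l => exact Submodule.mem_iSup_of_mem 2 (ι_mem_polyDeg σ l)
  | add a b ha hb => exact add_mem ha hb
  | mul a b ha hb =>
    induction ha using Submodule.iSup_induction' with
    | zero => rw [zero_mul]; exact zero_mem _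
    | add a a' _ _ ha ha' => rw [add_mul]; exact add_mem ha ha'
    | mem i a ha =>
      induction hb using Submodule.iSup_induction' with
      | zero => rw [mul_zero]; exact zero_mem _
      | add b b' _ _ hb hb' => rw [mul_add]; exact add_mem hb hb'
      | mem j b hb => exact Submodule.mem_iSup_of_mem _ (mul_mem_polyDeg ha hb)

/-- The algebra homomorphism `a ↦ ∑ a_q X^q` that separates the homogeneous components. -/
def weight (σ : Δ.Cone) : Poly σ →ₐ[ℝ] Polynomial (Poly σ) :=
  SymmetricAlgebra.lift
    ((LinearMap.mulLeft ℝ (Polynomial.X ^ 2 : Polynomial (Poly σ))) ∘ₗ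
      (Algebra.linearMap (Poly σ) (Polynomial (Poly σ))).restrictScalars ℝ ∘ₗ
      SymmetricAlgebra.ι ℝ (Module.Dual ℝ (lin σ)))

theorem weight_ι (σ : Δ.Cone) (l : Module.Dual ℝ (lin σ)) :
    weight σ (SymmetricAlgebra.ι ℝ _ l) =
      Polynomial.X ^ 2 * Polynomial.C (SymmetricAlgebra.ι ℝ _ l) := by
  rw [weight, SymmetricAlgebra.lift_ι_apply]
  rfl

theorem weight_of_mem (σ : Δ.Cone) {k : ℕ} {a : Poly σ}
    (ha : a ∈ LinearMap.range (SymmetricAlgebra.ι ℝ (Module.Dual ℝ (lin σ))) ^ k) :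
    weight σ a = Polynomial.X ^ (2 * k) * Polynomial.C a := by
  induction ha using Submodule.pow_induction_on_left' with
  | algebraMap r => simp [AlgHom.commutes, Polynomial.algebraMap_apply]
  | add x y i hx hy ihx ihy => rw [map_add, ihx, ihy, map_add, mul_add]
  | mem_mul m hm i x hx ih =>
    obtain ⟨l, rfl⟩ := hm
    rw [map_mul, ih, weight_ι, map_mul, Nat.succ_eq_add_one]
    ring

theorem eval_weight (σ : Δ.Cone) (a : Poly σ) : Polynomial.eval 1 (weight σ a) = a := by
  induction a using SymmetricAlgebra.induction with
  | algebraMap r => simp [AlgHom.commutes, Polynomial.algebraMap_apply]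
  | ι l => simp [weight_ι]
  | mul a b ha hb => rw [map_mul, Polynomial.eval_mul, ha, hb]
  | add a b ha hb => rw [map_add, Polynomial.eval_add, ha, hb]

theorem isInternal_polyDeg (σ : Δ.Cone) : DirectSum.IsInternal (polyDeg σ) := by
  refine isInternal_of_separating
    (fun k : ℕ => (Polynomial.lcoeff (Poly σ) k).restrictScalars ℝ ∘ₗ (weight σ).toLinearMap)
    (fun k => (k : ℤ)) (fun k q a ha hq => ?_) (fun a ha => ?_) (mem_iSup_polyDeg σ)
  · induction ha using polyDeg_induction with
    | zero => exact map_zero _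
    | add a b _ _ ha hb => rw [map_add, ha, hb, add_zero]
    | pow l hl a ha =>
      change (weight σ a).coeff k = 0
      rw [weight_of_mem σ ha, Polynomial.coeff_mul_C, Polynomial.coeff_X_pow,
        if_neg (by omega), zero_mul]
  · have : weight σ a = 0 := Polynomial.ext fun k => ha k
    rw [← eval_weight σ a, this, Polynomial.eval_zero]

theorem isGradedModule_poly (σ : Δ.Cone) : IsGradedModule (polyDeg σ) (polyDeg σ) where
  alg := isInternal_polyDeg σ
  isInternal := isInternal_polyDeg σ
  smul_mem := mul_mem_polyDeg

theorem Sheaf.isGradedModule (F : Sheaf Δ) (σ : Δ.Cone) :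
    IsGradedModule (polyDeg σ) (F.deg σ) where
  alg := isInternal_polyDeg σ
  isInternal := F.isInternal σ
  smul_mem := F.smul_mem

theorem resPoly_mem {τ σ : Δ.Cone} (h : τ ≤ σ) {q : ℤ} {a : Poly σ} (ha : a ∈ polyDeg σ q) :
    resPoly h a ∈ polyDeg τ q := by
  induction ha using polyDeg_induction with
  | zero => rw [map_zero]; exact zero_mem _
  | add a b _ _ ha hb => rw [map_add]; exact add_mem ha hb
  | pow k hk a ha =>
    subst hk
    refine mem_polyDeg_of_mem_pow ?_
    have h1 : resPoly h a ∈
        (LinearMap.range (SymmetricAlgebra.ι ℝ (Module.Dual ℝ (lin σ))) ^ k).map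
          (resPoly h).toLinearMap := Submodule.mem_map_of_mem ha
    rw [Submodule.map_pow] at h1
    have h2 : (LinearMap.range (SymmetricAlgebra.ι ℝ (Module.Dual ℝ (lin σ)))).map
        (resPoly h).toLinearMap ≤
          LinearMap.range (SymmetricAlgebra.ι ℝ (Module.Dual ℝ (lin τ))) := by
      rintro _ ⟨_, ⟨l, rfl⟩, rfl⟩
      exact ⟨resForm h l, (resPoly_ι h l).symm⟩
    exact pow_le_pow_left' h2 k h1

/-- Every polynomial is the sum of its constant term and an element of `𝔪`. -/
theorem exists_sub_algebraMap_mem (σ : Δ.Cone) (a : Poly σ) :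
    ∃ r : ℝ, a - algebraMap ℝ _ r ∈ polyIdeal σ := by
  induction a using SymmetricAlgebra.induction with
  | algebraMap r => exact ⟨r, by rw [sub_self]; exact zero_mem _⟩
  | ι l => exact ⟨0, by
      rw [map_zero, sub_zero]
      exact Ideal.subset_span ⟨2, by norm_num, ι_mem_polyDeg σ l⟩⟩
  | add a b ha hb =>
    obtain ⟨r, hr⟩ := ha
    obtain ⟨s, hs⟩ := hb
    refine ⟨r + s, ?_⟩
    rw [map_add, add_sub_add_comm]
    exact add_mem hr hs
  | mul a b ha hb =>
    obtain ⟨r, hr⟩ := ha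
    obtain ⟨s, hs⟩ := hb
    refine ⟨r * s, ?_⟩
    rw [map_mul]
    have : a * b - algebraMap ℝ _ r * algebraMap ℝ _ s =
      b * (a - algebraMap ℝ _ r) + algebraMap ℝ _ r * (b - algebraMap ℝ _ s) := by ring
    rw [this]
    exact add_mem (Ideal.mul_mem_left _ _ hr) (Ideal.mul_mem_left _ _ hs)

/-- A polynomial that vanishes on a hyperplane is divisible by the equation of the hyperplane. -/
theorem dvd_of_resPoly_eq_zero {τ σ : Δ.Cone} {hτ : IsFacet τ σ} {h : Module.Dual ℝ (lin σ)}
    (hh : HasKernel hτ h) {a : Poly σ} (ha : resPoly hτ.1 a = 0) :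
    SymmetricAlgebra.ι ℝ _ h ∣ a := by
  obtain ⟨v, hv⟩ := hh.exists_eq_one
  -- the projection of `V_σ` onto `V_τ` along `v`
  let p : lin σ →ₗ[ℝ] lin τ :=
    ((lin σ).subtype ∘ₗ (LinearMap.id - h.smulRight v)).codRestrict (lin τ) fun x => by
      refine (hh ((LinearMap.id - h.smulRight v : lin σ →ₗ[ℝ] lin σ) x)).1 ?_
      simp [hv]
  have hp : ∀ x, (Submodule.inclusion (lin_mono hτ.1) (p x)) = x - h x • v := fun x => rfl
  let j : Poly τ →ₐ[ℝ] Poly σ := SymmetricAlgebra.lift (SymmetricAlgebra.ι ℝ _ ∘ₗ p.dualMap)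
  let I : Ideal (Poly σ) := Ideal.span {SymmetricAlgebra.ι ℝ _ h}
  -- modulo `h`, pulling a polynomial back along `p` inverts the restriction to `V_τ`
  have key : (Ideal.Quotient.mkₐ ℝ I).comp (j.comp (resPoly hτ.1)) = Ideal.Quotient.mkₐ ℝ I := by
    refine SymmetricAlgebra.algHom_ext (LinearMap.ext fun l => ?_)
    change Ideal.Quotient.mk I (j (resPoly hτ.1 (SymmetricAlgebra.ι ℝ _ l))) =
      Ideal.Quotient.mk I (SymmetricAlgebra.ι ℝ _ l)
    rw [resPoly_ι]
    have h1 : j (SymmetricAlgebra.ι ℝ _ (resForm hτ.1 l)) =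
        SymmetricAlgebra.ι ℝ _ (l - l v • h) := by
      change SymmetricAlgebra.lift _ _ = _
      rw [SymmetricAlgebra.lift_ι_apply]
      change SymmetricAlgebra.ι ℝ _ (p.dualMap (resForm hτ.1 l)) = _
      congr 1
      ext x
      change l (Submodule.inclusion (lin_mono hτ.1) (p x)) = l x - l v * h x
      rw [hp, map_sub, map_smul, smul_eq_mul, mul_comm]
    rw [h1, Ideal.Quotient.mk_eq_mk_iff_sub_mem, ← map_sub, sub_sub_cancel_left, map_neg, map_smul]
    refine neg_mem (Submodule.smul_of_tower_mem I (l v) ?_)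
    exact Ideal.mem_span_singleton_self _
  have h2 := AlgHom.congr_fun key a
  change Ideal.Quotient.mk I (j (resPoly hτ.1 a)) = Ideal.Quotient.mk I a at h2
  rw [ha, map_zero, map_zero, eq_comm, Ideal.Quotient.eq_zero_iff_mem,
    Ideal.mem_span_singleton] at h2
  exact h2

end Fan

/-! ### Facets and supporting forms -/

namespace Fan

variable {V : Type u} [AddCommGroup V] [Module ℝ V] {Δ : Fan V}

instance : Finite Δ.Cone := Δ.finite.to_subtype

open Classical in
/-- A supporting form of the proper face `τ` of `σ`: it is nonnegative on `σ` and vanishes exactly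
on `τ`. (It is `0` if `τ` is not a proper face of `σ`.) -/
def supportForm (τ σ : Δ.Cone) : Module.Dual ℝ V :=
  if h : τ < σ then (exists_support h).choose else 0

theorem supportForm_spec {τ σ : Δ.Cone} (h : τ < σ) :
    (∀ x ∈ σ.1, 0 ≤ supportForm τ σ x) ∧ (∀ x, x ∈ τ.1 ↔ x ∈ σ.1 ∧ supportForm τ σ x = 0) ∧
      lin τ ≤ LinearMap.ker (supportForm τ σ) ∧ ∃ x ∈ σ.1, supportForm τ σ x ≠ 0 := by
  rw [supportForm, dif_pos h]
  exact (exists_support h).choose_spec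

theorem supportForm_nonneg {τ σ : Δ.Cone} (h : τ < σ) {x : V} (hx : x ∈ σ.1) :
    0 ≤ supportForm τ σ x :=
  (supportForm_spec h).1 x hx

theorem supportForm_pos {τ σ : Δ.Cone} (h : τ < σ) {x : V} (hx : x ∈ σ.1) (hxτ : x ∉ τ.1) :
    0 < supportForm τ σ x :=
  lt_of_le_of_ne (supportForm_nonneg h hx) fun e =>
    hxτ (((supportForm_spec h).2.1 x).2 ⟨hx, e.symm⟩)

theorem supportForm_lin {τ σ : Δ.Cone} (h : τ < σ) {x : V} (hx : x ∈ lin τ) :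
    supportForm τ σ x = 0 :=
  (supportForm_spec h).2.2.1 hx

theorem exists_mem_notMem {τ σ : Δ.Cone} (h : ¬ σ ≤ τ) : ∃ x ∈ σ.1, x ∉ τ.1 := by
  by_contra! hc
  exact h hc

/-- For two facets `δ` and `δ'` of a cone: if a facet of `δ` is contained in `δ'`,
it is a facet of `δ'`. -/
theorem isFacet_right {ζ δ δ' σ : Δ.Cone} (hδ : IsFacet δ σ) (hδ' : IsFacet δ' σ)
    (hζ : IsFacet ζ δ) (hζ' : ζ ≤ δ') : IsFacet ζ δ' :=
  ⟨hζ', by have := hδ.2; have := hδ'.2; have := hζ.2; omega⟩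

/-- A point in the relative interior of `σ`: the sum of points of `σ` outside the facets. -/
theorem exists_interior (σ : Δ.Cone) :
    ∃ z ∈ lin σ, ∀ γ : Δ.Cone, IsFacet γ σ → 0 < supportForm γ σ z := by
  classical
  have := Fintype.ofFinite Δ.Cone
  have h : ∀ γ : Δ.Cone, ∃ y ∈ σ.1, IsFacet γ σ → 0 < supportForm γ σ y := by
    intro γ
    by_cases hγ : IsFacet γ σ
    · obtain ⟨y, hy, hyγ⟩ := exists_mem_notMem hγ.lt.not_ge
      exact ⟨y, hy, fun _ => supportForm_pos hγ.lt hy hyγ⟩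
    · exact ⟨0, zero_mem _, fun h => absurd h hγ⟩
  choose y hy hpos using h
  refine ⟨∑ γ, y γ, Submodule.sum_mem _ fun γ _ => Submodule.subset_span (hy γ), fun γ hγ => ?_⟩
  rw [map_sum]
  exact Finset.sum_pos' (fun δ _ => supportForm_nonneg hγ.lt (hy δ))
    ⟨γ, Finset.mem_univ _, hpos γ hγ⟩

variable [FiniteDimensional ℝ V]

theorem mem_lin_of_supportForm_eq_zero {τ σ : Δ.Cone} (hτ : IsFacet τ σ) {x : V} (hx : x ∈ lin σ)
    (h : supportForm τ σ x = 0) : x ∈ lin τ := by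
  obtain ⟨-, -, hk, y, hy, hly⟩ := supportForm_spec hτ.lt
  have hle : lin τ ≤ lin σ ⊓ LinearMap.ker (supportForm τ σ) := le_inf (lin_mono hτ.1) hk
  have hlt : lin σ ⊓ LinearMap.ker (supportForm τ σ) < lin σ :=
    lt_of_le_of_ne inf_le_left fun e => by
      have h1 : y ∈ lin σ := Submodule.subset_span hy
      rw [← e] at h1
      exact hly h1.2
  have h1 := Submodule.finrank_lt_finrank_of_lt hlt
  have h2 := hτ.2
  unfold dim at h2
  have e : lin τ = lin σ ⊓ LinearMap.ker (supportForm τ σ) :=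
    Submodule.eq_of_le_of_finrank_le hle (by omega)
  rw [e]
  exact ⟨hx, h⟩

/-- The supporting form of a facet is unique up to a positive factor. -/
theorem exists_eq_mul_supportForm {τ σ : Δ.Cone} (hτ : IsFacet τ σ) (l : Module.Dual ℝ V)
    (hl : ∀ x ∈ σ.1, 0 ≤ l x) (hlτ : ∀ x ∈ τ.1, l x = 0) (hne : ∃ x ∈ σ.1, l x ≠ 0) :
    ∃ c : ℝ, 0 < c ∧ ∀ x ∈ lin σ, l x = c * supportForm τ σ x := by
  obtain ⟨y, hy, hyτ⟩ := exists_mem_notMem hτ.lt.not_ge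
  have hpos := supportForm_pos hτ.lt hy hyτ
  have hlτ' : ∀ x ∈ lin τ, l x = 0 := fun x hx =>
    (Submodule.span_le (p := LinearMap.ker l)).2 hlτ hx
  have key : ∀ x ∈ lin σ, l x = l y / supportForm τ σ y * supportForm τ σ x := by
    intro x hx
    have h1 : x - (supportForm τ σ x / supportForm τ σ y) • y ∈ lin τ := by
      refine mem_lin_of_supportForm_eq_zero hτ
        (sub_mem hx (Submodule.smul_mem _ _ (Submodule.subset_span hy))) ?_
      rw [map_sub, map_smul, smul_eq_mul, div_mul_cancel₀ _ hpos.ne', sub_self]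
    have h2 := hlτ' _ h1
    rw [map_sub, map_smul, smul_eq_mul, sub_eq_zero] at h2
    rw [h2]
    ring
  refine ⟨_, ?_, key⟩
  obtain ⟨x, hx, hlx⟩ := hne
  refine lt_of_le_of_ne (div_nonneg (hl y hy) hpos.le) fun e => hlx ?_
  rw [key x (Submodule.subset_span hx), ← e, zero_mul]

/-- A supporting hyperplane of `σ` whose face is not a facet can be tilted to a larger face, while
its value at a given point is kept. -/
theorem exists_tilt {γ σ : Δ.Cone} {l : Module.Dual ℝ V} (l0 : ∀ x ∈ σ.1, 0 ≤ l x)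
    (hl : ∀ x, x ∈ γ.1 ↔ x ∈ σ.1 ∧ l x = 0) (hd : dim γ + 1 < dim σ) {y : V} (hly : l y ≠ 0) :
    ∃ l' : Module.Dual ℝ V, (∀ x ∈ σ.1, 0 ≤ l' x) ∧ (∀ x ∈ γ.1, l' x = 0) ∧ l' y = l y ∧
      ∃ w ∈ σ.1, w ∉ γ.1 ∧ l' w = 0 := by
  classical
  obtain ⟨S, hS⟩ := Δ.polyhedral σ.1 σ.2
  have hSσ : ∀ v ∈ S, v ∈ σ.1 := fun v hv => hS ▸ Submodule.subset_span hv
  obtain ⟨m, hmγ, hmy, z, hz, hmz⟩ : ∃ m : Module.Dual ℝ V, (∀ x ∈ lin γ, m x = 0) ∧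
      m y = 0 ∧ ∃ z ∈ S, m z ≠ 0 := by
    have hlt : ¬ lin σ ≤ lin γ ⊔ Submodule.span ℝ {y} := by
      intro hle
      have h1 := Submodule.finrank_mono hle
      have h2 := Submodule.finrank_add_le_finrank_add_finrank (lin γ) (Submodule.span ℝ {y})
      have h3 : Module.finrank ℝ (Submodule.span ℝ {y}) = 1 :=
        finrank_span_singleton fun e => hly (by rw [e, map_zero])
      unfold dim at hd
      omega
    have hne : ∃ z ∈ S, z ∉ lin γ ⊔ Submodule.span ℝ {y} := by
      by_contra! hc
      apply hlt
      refine Submodule.span_le.2 fun x hx => ?_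
      have hx' : x ∈ PointedCone.hull ℝ (S : Set V) := by rw [← hS] at hx; exact hx
      exact (Submodule.span_le
        (p := PointedCone.ofSubmodule (lin γ ⊔ Submodule.span ℝ {y}))).2
        (fun v hv => hc v hv) hx'
    obtain ⟨z, hz, hzn⟩ := hne
    obtain ⟨m, hm, hmz⟩ := Submodule.exists_le_ker_of_notMem hzn
    exact ⟨m, fun x hx => hmz (Submodule.mem_sup_left hx),
      hmz (Submodule.mem_sup_right (Submodule.mem_span_singleton_self y)), z, hz, hm⟩
  -- move from `l` in the direction of `m`, or of `-m`, until a further generator of `σ` is hit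
  wlog hneg : m z < 0 generalizing m
  · exact this (-m) (fun x hx => by simp [hmγ x hx]) (by simp [hmy]) (by simpa using hmz)
      (by have := lt_of_le_of_ne (not_lt.1 hneg) (Ne.symm hmz); simpa using this)
  obtain ⟨w, hw, hmin⟩ := (S.filter fun v => m v < 0).exists_min_image (fun v => l v / (-m v))
    ⟨z, by simp [hz, hneg]⟩
  simp only [Finset.mem_filter] at hw hmin
  set t := l w / (-m w) with ht
  have ht0 : 0 ≤ t := div_nonneg (l0 w (hSσ w hw.1)) (by linarith [hw.2])
  have hgen : ∀ v ∈ S, 0 ≤ (l + t • m) v := by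
    intro v hv
    simp only [LinearMap.add_apply, LinearMap.smul_apply, smul_eq_mul]
    rcases lt_or_ge (m v) 0 with hv0 | hv0
    · have := hmin v ⟨hv, hv0⟩
      rw [le_div_iff₀ (by linarith)] at this
      linarith
    · have := l0 v (hSσ v hv)
      positivity
  have hpos : ∀ x ∈ σ.1, 0 ≤ (l + t • m) x := by
    intro x hx
    rw [← hS] at hx
    induction hx using Submodule.span_induction with
    | mem v hv => exact hgen v hv
    | zero => simp
    | add a b _ _ ha hb => rw [map_add]; exact add_nonneg ha hb
    | smul c a _ ha =>
      have : (l + t • m) (c • a) = (c : ℝ) * (l + t • m) a := by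
        rw [← smul_eq_mul, ← map_smul]; rfl
      rw [this]; exact mul_nonneg c.2 ha
  have hw0 : (l + t • m) w = 0 := by
    have : m w ≠ 0 := ne_of_lt hw.2
    simp only [LinearMap.add_apply, LinearMap.smul_apply, smul_eq_mul, ht]
    field_simp
    ring
  refine ⟨l + t • m, hpos, fun x hx => ?_, by simp [hmy], w, hSσ w hw.1, fun hc => ?_, hw0⟩
  · simp [((hl x).1 hx).2, hmγ x (Submodule.subset_span hx)]
  · have := hmγ w (Submodule.subset_span hc)
    linarith [hw.2]

/-- Among the facets that contain the face cut out by a form `l`, nonnegative on `σ`, there is one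
whose supporting form has the same sign as `l` at a given point. -/
theorem exists_facet_sign {σ : Δ.Cone} (l : Module.Dual ℝ V) (l0 : ∀ x ∈ σ.1, 0 ≤ l x) {y : V}
    (hy : y ∈ lin σ) (hly : l y ≠ 0) :
    ∃ δ : Δ.Cone, IsFacet δ σ ∧ (∀ x ∈ σ.1, l x = 0 → x ∈ δ.1) ∧
      ∃ c : ℝ, 0 < c ∧ l y = c * supportForm δ σ y := by
  have face : ∀ l : Module.Dual ℝ V, (∀ x ∈ σ.1, 0 ≤ l x) →
      ∃ γ : Δ.Cone, ∀ x, x ∈ γ.1 ↔ x ∈ σ.1 ∧ l x = 0 := by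
    intro l l0
    let γ : PointedCone ℝ V := σ.1 ⊓ PointedCone.ofSubmodule (LinearMap.ker l)
    have hγ : ∀ x, x ∈ γ ↔ x ∈ σ.1 ∧ l x = 0 := fun x => by simp [γ, Submodule.mem_inf]
    exact ⟨⟨γ, Δ.face_mem _ σ.2 _ ⟨l, l0, hγ⟩⟩, hγ⟩
  obtain ⟨γ, hγ⟩ := face l l0
  -- tilt `l` until the face that it cuts out is a facet
  induction hn : dim σ - dim γ using Nat.strong_induction_on generalizing l γ with
  | _ n ih =>
    have hne : ∃ x ∈ σ.1, l x ≠ 0 := by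
      by_contra! hc
      exact hly ((Submodule.span_le (p := LinearMap.ker l)).2 hc hy)
    have hlt : γ < σ := lt_of_le_of_ne (fun x hx => ((hγ x).1 hx).1) fun e => by
      obtain ⟨x, hx, hlx⟩ := hne
      exact hlx ((hγ x).1 (e ▸ hx)).2
    by_cases hd : dim γ + 1 < dim σ
    · obtain ⟨l', l0', hl'γ, hl'y, w, hw, hwγ, hl'w⟩ := exists_tilt l0 hγ hd hly
      obtain ⟨γ', hγ'⟩ := face l' l0'
      have hlt' : γ < γ' := lt_of_le_of_ne
        (fun x hx => (hγ' x).2 ⟨hlt.le hx, hl'γ x hx⟩) fun e => hwγ (by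
          rw [e]; exact (hγ' w).2 ⟨hw, hl'w⟩)
      have hle' : γ' ≤ σ := fun x hx => ((hγ' x).1 hx).1
      have h1 := dim_lt hlt'
      obtain ⟨δ, hδ, hx, c, hc, h⟩ := ih (dim σ - dim γ') (by omega) l' l0'
        (by rwa [hl'y]) γ' hγ' rfl
      exact ⟨δ, hδ, fun x hxσ hlx => hx x hxσ (hl'γ x ((hγ x).2 ⟨hxσ, hlx⟩)), c, hc,
        by rw [← hl'y, h]⟩
    · have hF : IsFacet γ σ := ⟨hlt.le, by have := dim_lt hlt; omega⟩
      obtain ⟨c, hc, h⟩ := exists_eq_mul_supportForm hF l l0 (fun x hx => ((hγ x).1 hx).2) hne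
      exact ⟨γ, hF, fun x hx hlx => (hγ x).2 ⟨hx, hlx⟩, c, hc, h y hy⟩

/-- A proper face is the intersection of the facets that contain it. -/
theorem exists_facet_notMem {α σ : Δ.Cone} (h : α < σ) {y : V} (hy : y ∈ σ.1) (hyα : y ∉ α.1) :
    ∃ δ : Δ.Cone, IsFacet δ σ ∧ α ≤ δ ∧ y ∉ δ.1 := by
  have hpos := supportForm_pos h hy hyα
  obtain ⟨δ, hδ, hx, c, hc, e⟩ := exists_facet_sign (supportForm α σ)
    (fun x hx => supportForm_nonneg h hx) (Submodule.subset_span hy : y ∈ lin σ) hpos.ne'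
  refine ⟨δ, hδ, fun x hxα => hx x (h.le hxα) (supportForm_lin h (Submodule.subset_span hxα)),
    fun hyδ => ?_⟩
  rw [supportForm_lin hδ.lt (Submodule.subset_span hyδ), mul_zero] at e
  exact hpos.ne' e

theorem exists_facet_ne {α δ σ : Δ.Cone} (hδ : IsFacet δ σ) (h : α < δ) :
    ∃ δ' : Δ.Cone, IsFacet δ' σ ∧ α ≤ δ' ∧ δ' ≠ δ := by
  obtain ⟨y, hy, hyα⟩ := exists_mem_notMem h.not_ge
  obtain ⟨δ', h1, h2, h3⟩ := exists_facet_notMem (h.trans hδ.lt) (hδ.1 hy) hyα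
  exact ⟨δ', h1, h2, fun e => h3 (e ▸ hy)⟩

theorem IsFacet.not_le {δ δ' σ : Δ.Cone} (hδ : IsFacet δ σ) (hδ' : IsFacet δ' σ) (hne : δ ≠ δ') :
    ¬ δ ≤ δ' := fun h => hne (hδ.eq_of_le h hδ'.lt).symm

/-- Two facets with a common face of codimension two meet in this face only. -/
theorem mem_of_mem_facets {ζ δ δ' σ : Δ.Cone} (hδ : IsFacet δ σ) (hδ' : IsFacet δ' σ)
    (hne : δ ≠ δ') (hζ : IsFacet ζ δ) (hζ' : ζ ≤ δ') {x : V} (hx : x ∈ δ.1) (hx' : x ∈ δ'.1) :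
    x ∈ ζ.1 := by
  let γ : Δ.Cone := ⟨δ'.1 ⊓ δ.1, Δ.face_mem _ δ.2 _ (Δ.inter_face _ δ.2 _ δ'.2)⟩
  have h1 : ζ ≤ γ := fun y hy => ⟨hζ' hy, hζ.1 hy⟩
  have h2 : γ < δ := lt_of_le_of_ne (fun y hy => hy.2) fun e =>
    hδ.not_le hδ' hne fun y hy => by
      have : y ∈ γ.1 := e ▸ hy
      exact this.1
  have h3 := hζ.eq_of_le h1 h2
  rw [← h3]
  exact ⟨hx', hx⟩

/-- Let the facets `δ` and `δ'` of `σ` meet in `ζ`, of codimension two. Then the supporting form of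
`δ'` restricts on `V_δ` to a positive multiple of the supporting form of `ζ`. Therefore `ζ` is
visible from a point of `V_δ` if and only if `δ'` is. -/
theorem exists_supportForm_restrict {ζ δ δ' σ : Δ.Cone} (hδ : IsFacet δ σ) (hδ' : IsFacet δ' σ)
    (hne : δ ≠ δ') (hζ : IsFacet ζ δ) (hζ' : ζ ≤ δ') :
    ∃ c : ℝ, 0 < c ∧ ∀ x ∈ lin δ, supportForm δ' σ x = c * supportForm ζ δ x := by
  refine exists_eq_mul_supportForm hζ _ (fun x hx => supportForm_nonneg hδ'.lt (hδ.1 hx))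
    (fun x hx => supportForm_lin hδ'.lt (Submodule.subset_span (hζ' hx))) ?_
  obtain ⟨x, hx, hx'⟩ := exists_mem_notMem (hδ.not_le hδ' hne)
  exact ⟨x, hx, (supportForm_pos hδ'.lt (hδ.1 hx) hx').ne'⟩

/-- A face of codimension two lies in at most two facets. -/
theorem eq_or_eq_of_codim_two {ζ δ₁ δ₂ δ₃ σ : Δ.Cone} (h₁ : IsFacet δ₁ σ) (h₂ : IsFacet δ₂ σ)
    (hne : δ₁ ≠ δ₂) (hζ : IsFacet ζ δ₁) (hζ₂ : ζ ≤ δ₂) (h₃ : IsFacet δ₃ σ) (hζ₃ : ζ ≤ δ₃) :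
    δ₃ = δ₁ ∨ δ₃ = δ₂ := by
  by_contra! hc
  obtain ⟨hc₁, hc₂⟩ := hc
  have hζ' : IsFacet ζ δ₂ := isFacet_right h₁ h₂ hζ hζ₂
  have hζ'' : IsFacet ζ δ₃ := isFacet_right h₁ h₃ hζ hζ₃
  obtain ⟨y₁, hy₁, hyζ₁⟩ := exists_mem_notMem hζ.lt.not_ge
  obtain ⟨y₂, hy₂, hyζ₂⟩ := exists_mem_notMem hζ'.lt.not_ge
  obtain ⟨y₃, hy₃, hyζ₃⟩ := exists_mem_notMem hζ''.lt.not_ge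
  -- the three supporting forms vanish on `ζ`, so that they are linearly dependent; compare values
  have pos : ∀ {α β : Δ.Cone} {y : V}, IsFacet α σ → IsFacet β σ → α ≠ β → IsFacet ζ β → ζ ≤ α →
      y ∈ β.1 → y ∉ ζ.1 → 0 < supportForm α σ y := by
    intro α β y hα hβ hαβ hζβ hζα hyβ hyζ
    refine supportForm_pos hα.lt (hβ.1 hyβ) fun hyα => hyζ ?_
    exact mem_of_mem_facets hβ hα hαβ.symm hζβ hζα hyβ hyα
  have p12 := pos h₁ h₂ hne hζ' hζ.1 hy₂ hyζ₂
  have p21 := pos h₂ h₁ hne.symm hζ hζ₂ hy₁ hyζ₁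
  have p31 := pos h₃ h₁ hc₁ hζ hζ₃ hy₁ hyζ₁
  have p32 := pos h₃ h₂ hc₂ hζ' hζ₃ hy₂ hyζ₂
  have p13 := pos h₁ h₃ hc₁.symm hζ'' hζ.1 hy₃ hyζ₃
  have p23 := pos h₂ h₃ hc₂.symm hζ'' hζ₂ hy₃ hyζ₃
  set l₁ := supportForm δ₁ σ
  set l₂ := supportForm δ₂ σ
  set l₃ := supportForm δ₃ σ
  have z11 : l₁ y₁ = 0 := supportForm_lin h₁.lt (Submodule.subset_span hy₁)
  have z22 : l₂ y₂ = 0 := supportForm_lin h₂.lt (Submodule.subset_span hy₂)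
  have z33 : l₃ y₃ = 0 := supportForm_lin h₃.lt (Submodule.subset_span hy₃)
  -- `y₃` is congruent to a combination of `y₁` and `y₂` modulo `V_ζ`
  have hw₁ : y₃ - (l₁ y₃ / l₁ y₂) • y₂ ∈ lin δ₁ := by
    refine mem_lin_of_supportForm_eq_zero h₁ (sub_mem (Submodule.subset_span (h₃.1 hy₃))
      (Submodule.smul_mem _ _ (Submodule.subset_span (h₂.1 hy₂)))) ?_
    change l₁ _ = 0
    rw [map_sub, map_smul, smul_eq_mul, div_mul_cancel₀ _ p12.ne', sub_self]
  obtain ⟨c, hc0, hc⟩ := exists_supportForm_restrict h₁ h₂ hne hζ hζ₂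
  have hw₂ : y₃ - (l₁ y₃ / l₁ y₂) • y₂ - (l₂ y₃ / l₂ y₁) • y₁ ∈ lin ζ := by
    have hmem := sub_mem hw₁ (Submodule.smul_mem (lin δ₁) (l₂ y₃ / l₂ y₁)
      (Submodule.subset_span hy₁))
    refine mem_lin_of_supportForm_eq_zero hζ hmem ?_
    have := hc _ hmem
    change l₂ _ = _ at this
    rw [map_sub, map_sub, map_smul, map_smul, smul_eq_mul, smul_eq_mul, z22,
      div_mul_cancel₀ _ p21.ne', mul_zero, sub_zero, sub_self, eq_comm] at this
    exact (mul_eq_zero.1 this).resolve_left hc0.ne'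
  -- apply `l₃` to this relation: it vanishes on `y₃`, and the other terms have the same sign
  have h3 : l₃ (y₃ - (l₁ y₃ / l₁ y₂) • y₂ - (l₂ y₃ / l₂ y₁) • y₁) = 0 :=
    supportForm_lin h₃.lt (lin_mono hζ₃ hw₂)
  rw [map_sub, map_sub, map_smul, map_smul, smul_eq_mul, smul_eq_mul, z33] at h3
  have q1 : 0 < l₁ y₃ / l₁ y₂ * l₃ y₂ := by positivity
  have q2 : 0 < l₂ y₃ / l₂ y₁ * l₃ y₁ := by positivity
  linarith

/-- If a face of the facet `δ` also lies in a facet which is visible from the point `p` of `V_δ`,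
then it lies in a facet of `δ` which is visible from `p`. -/
theorem exists_visible_facet {ε δ δ' σ : Δ.Cone} (hδ : IsFacet δ σ) (hδ' : IsFacet δ' σ) {p : V}
    (hp : p ∈ lin δ) (hneg : supportForm δ' σ p < 0) (hε : ε ≤ δ) (hε' : ε ≤ δ') :
    ∃ ζ : Δ.Cone, IsFacet ζ δ ∧ ε ≤ ζ ∧ supportForm ζ δ p < 0 := by
  obtain ⟨ζ, h1, h2, c, hc, h3⟩ := exists_facet_sign (supportForm δ' σ)
    (fun x hx => supportForm_nonneg hδ'.lt (hδ.1 hx)) hp hneg.ne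
  refine ⟨ζ, h1, fun x hx => h2 x (hε hx) (supportForm_lin hδ'.lt
    (Submodule.subset_span (hε' hx))), ?_⟩
  rw [h3] at hneg
  exact neg_of_mul_neg_right hneg hc.le

/-- A sweep of the cone `σ`: a point moves along a line in `V_σ` and crosses the hyperplanes
spanned by the facets of `σ` one at a time. The facet `δ` becomes visible at the time `time δ`,
when the moving point is at `point δ`. A facet counts as visible from `p` if its supporting form is
negative at `p`. By `level_gt` the facets that are not yet crossed at a given time are those visible
from a point of `V_σ`, namely from the antipode of the moving point. -/
structure Sweep (σ : Δ.Cone) where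
  time : Δ.Cone → ℝ
  point : Δ.Cone → V
  point_mem : ∀ {δ}, IsFacet δ σ → point δ ∈ lin δ
  neg_iff : ∀ {γ δ}, IsFacet γ σ → IsFacet δ σ →
    (supportForm γ σ (point δ) < 0 ↔ time γ < time δ)
  injective : ∀ {γ δ}, IsFacet γ σ → IsFacet δ σ → time γ = time δ → γ = δ
  level_gt : ∀ c, ∃ p ∈ lin σ, ∀ γ, IsFacet γ σ → (supportForm γ σ p < 0 ↔ c < time γ)

/-- The sweep of a cone along the line through the point `p` in the direction of the interior
point `z`. -/
def Sweep.ofLine {σ : Δ.Cone} (p z : V) (hp : p ∈ lin σ) (hz : z ∈ lin σ)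
    (hpos : ∀ γ, IsFacet γ σ → 0 < supportForm γ σ z)
    (hinj : ∀ γ δ, IsFacet γ σ → IsFacet δ σ →
      supportForm γ σ p / supportForm γ σ z = supportForm δ σ p / supportForm δ σ z → γ = δ) :
    Sweep σ :=
  have key : ∀ γ, IsFacet γ σ → ∀ c : ℝ, supportForm γ σ (p - c • z) =
      supportForm γ σ z * (supportForm γ σ p / supportForm γ σ z - c) := fun γ hγ c => by
    have := (hpos γ hγ).ne'
    rw [map_sub, map_smul, smul_eq_mul]
    field_simp
  { time := fun γ => supportForm γ σ p / supportForm γ σ z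
    point := fun δ => p - (supportForm δ σ p / supportForm δ σ z) • z
    point_mem := fun {δ} hδ => mem_lin_of_supportForm_eq_zero hδ
      (sub_mem hp (Submodule.smul_mem _ _ hz)) (by rw [key δ hδ, sub_self, mul_zero])
    neg_iff := fun hγ _ => by
      rw [key _ hγ, ← smul_eq_mul, smul_neg_iff_of_pos_left (hpos _ hγ), sub_neg]
    injective := fun hγ hδ h => hinj _ _ hγ hδ h
    level_gt := fun c => ⟨-(p - c • z), neg_mem (sub_mem hp (Submodule.smul_mem _ _ hz)),
      fun γ hγ => by
        rw [map_neg, key _ hγ, neg_lt_zero, mul_pos_iff_of_pos_left (hpos _ hγ), sub_pos]⟩ }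

/-- For every point `p` of `V_σ` there is a sweep of `σ` in which the facets visible from `p` come
first. -/
theorem exists_sweep (σ : Δ.Cone) {p : V} (hp : p ∈ lin σ) :
    ∃ S : Sweep σ, ∀ γ, IsFacet γ σ → (supportForm γ σ p < 0 ↔ S.time γ < 0) := by
  classical
  obtain ⟨z, hz, hpos⟩ := exists_interior σ
  -- a vector `u` of `V_σ` whose sweep meets the hyperplanes at distinct times
  obtain ⟨u, hu, hune⟩ : ∃ u ∈ lin σ, ∀ k : {k : Δ.Cone × Δ.Cone // IsFacet k.1 σ ∧
      IsFacet k.2 σ ∧ k.1 ≠ k.2},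
      (supportForm k.1.2 σ z • supportForm k.1.1 σ - supportForm k.1.1 σ z • supportForm k.1.2 σ) u
        ≠ 0 := by
    refine Module.Dual.exists_forall_mem_ne_zero_of_forall_exists (lin σ) _ ?_
    rintro ⟨⟨γ, δ⟩, hγ, hδ, hne⟩
    obtain ⟨y, hy, hyδ⟩ := exists_mem_notMem (hγ.not_le hδ hne)
    refine ⟨y, Submodule.subset_span (hγ.1 hy), ?_⟩
    have h1 := supportForm_pos hδ.lt (hγ.1 hy) hyδ
    have h2 := hpos γ hγ
    simp only [LinearMap.sub_apply, LinearMap.smul_apply, smul_eq_mul,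
      supportForm_lin hγ.lt (Submodule.subset_span hy), mul_zero, zero_sub]
    exact neg_ne_zero.2 (mul_pos h2 h1).ne'
  have hune' : ∀ γ δ, IsFacet γ σ → IsFacet δ σ → γ ≠ δ →
      supportForm γ σ u / supportForm γ σ z ≠ supportForm δ σ u / supportForm δ σ z := by
    intro γ δ hγ hδ hne e
    have h1 := (hpos γ hγ).ne'
    have h2 := (hpos δ hδ).ne'
    refine hune ⟨(γ, δ), hγ, hδ, hne⟩ ?_
    rw [div_eq_div_iff h1 h2] at e
    simp only [LinearMap.sub_apply, LinearMap.smul_apply, smul_eq_mul]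
    linarith
  -- it may be taken in the interior of `σ`
  obtain ⟨M, hM⟩ : ∃ M : ℝ, ∀ γ, IsFacet γ σ → 0 < supportForm γ σ (u + M • z) := by
    obtain ⟨M, hM⟩ := (Set.finite_range fun γ : Δ.Cone =>
      -(supportForm γ σ u / supportForm γ σ z)).bddAbove
    refine ⟨M + 1, fun γ hγ => ?_⟩
    have h1 := hpos γ hγ
    have h2 : -(supportForm γ σ u / supportForm γ σ z) ≤ M := hM ⟨γ, rfl⟩
    have h3 : supportForm γ σ (u + (M + 1) • z) =
        supportForm γ σ z * (supportForm γ σ u / supportForm γ σ z + M + 1) := by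
      rw [map_add, map_smul, smul_eq_mul]
      field_simp
      ring
    rw [h3]
    exact mul_pos h1 (by linarith)
  set u' := u + M • z with hu'
  have hu'mem : u' ∈ lin σ := add_mem hu (Submodule.smul_mem _ _ hz)
  -- a small perturbation of `p` in the direction `u'`
  have hev : ∀ᶠ s : ℝ in nhdsWithin 0 (Set.Ioi 0), (∀ γ, IsFacet γ σ →
      (supportForm γ σ p < 0 ↔ supportForm γ σ (p + s • u') < 0)) ∧
      ∀ γ δ, IsFacet γ σ → IsFacet δ σ → γ ≠ δ →
        supportForm γ σ (p + s • u') / supportForm γ σ z ≠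
          supportForm δ σ (p + s • u') / supportForm δ σ z := by
    refine Filter.Eventually.and (Filter.eventually_all.2 fun γ => ?_)
      (Filter.eventually_all.2 fun γ => Filter.eventually_all.2 fun δ => ?_)
    · by_cases hγ : IsFacet γ σ
      swap
      · exact Filter.Eventually.of_forall fun s h => absurd h hγ
      have hc : Filter.Tendsto (fun s : ℝ => supportForm γ σ (p + s • u'))
          (nhdsWithin 0 (Set.Ioi 0)) (nhds (supportForm γ σ p)) := by
        have : Continuous fun s : ℝ => supportForm γ σ (p + s • u') := by
          simp only [map_add, map_smul, smul_eq_mul]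
          fun_prop
        have h := (this.tendsto 0).mono_left (nhdsWithin_le_nhds (s := Set.Ioi 0))
        simpa using h
      rcases lt_or_ge (supportForm γ σ p) 0 with h | h
      · filter_upwards [hc.eventually_lt_const h] with s hs _
        exact ⟨fun _ => hs, fun _ => h⟩
      · filter_upwards [self_mem_nhdsWithin] with s hs _
        have h1 := hM γ hγ
        have h2 : 0 ≤ supportForm γ σ (p + s • u') := by
          rw [map_add, map_smul, smul_eq_mul]
          exact add_nonneg h (mul_nonneg (le_of_lt hs) h1.le)
        exact ⟨fun h' => absurd h h'.not_ge, fun h' => absurd h2 h'.not_ge⟩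
    · by_cases hγ : IsFacet γ σ ∧ IsFacet δ σ ∧ γ ≠ δ
      swap
      · exact Filter.Eventually.of_forall fun s h1 h2 h3 => absurd ⟨h1, h2, h3⟩ hγ
      obtain ⟨h1, h2, h3⟩ := hγ
      have n1 := (hpos γ h1).ne'
      have n2 := (hpos δ h2).ne'
      have hne := hune' γ δ h1 h2 h3
      set α := supportForm γ σ p / supportForm γ σ z - supportForm δ σ p / supportForm δ σ z
      set β := supportForm γ σ u / supportForm γ σ z - supportForm δ σ u / supportForm δ σ z
      have hβ : β ≠ 0 := sub_ne_zero.2 hne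
      have hs0 : ∀ᶠ s : ℝ in nhdsWithin 0 (Set.Ioi 0), s ≠ -α / β := by
        rcases eq_or_ne (-α / β) 0 with h | h
        · filter_upwards [self_mem_nhdsWithin] with s hs
          rw [h]
          exact ne_of_gt hs
        · exact nhdsWithin_le_nhds (eventually_ne_nhds h.symm)
      filter_upwards [hs0] with s hs _ _ _ e
      apply hs
      rw [eq_div_iff hβ]
      have e1 : supportForm γ σ (p + s • u') / supportForm γ σ z -
          supportForm δ σ (p + s • u') / supportForm δ σ z = α + s * β := by
        simp only [hu', map_add, map_smul, smul_eq_mul, α, β]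
        field_simp
        ring
      rw [e, sub_self] at e1
      linarith
  obtain ⟨s, h1, h2⟩ := hev.exists
  refine ⟨Sweep.ofLine (p + s • u') z (add_mem hp (Submodule.smul_mem _ _ hu'mem)) hz hpos
    fun γ δ hγ hδ e => by_contra fun hne => h2 γ δ hγ hδ hne e, fun γ hγ => ?_⟩
  rw [h1 γ hγ]
  change _ ↔ supportForm γ σ (p + s • u') / supportForm γ σ z < 0
  rw [div_lt_iff₀ (hpos γ hγ), zero_mul]

end Fan

/-! ### Projectivity and division -/

/-- Division of a linear form by a nonzero element that divides all its values. -/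
theorem exists_linearMap_div {A M : Type*} [CommRing A] [IsDomain A] [AddCommGroup M] [Module A M]
    {t : A} (ht : t ≠ 0) (f : M →ₗ[A] A) (hf : ∀ x, t ∣ f x) :
    ∃ g : M →ₗ[A] A, ∀ x, f x = t * g x := by
  choose g hg using hf
  refine ⟨{ toFun := g, map_add' := fun x y => ?_, map_smul' := fun a x => ?_ }, hg⟩
  · refine mul_left_cancel₀ ht ?_
    rw [← hg, map_add, mul_add, hg x, hg y]
  · refine mul_left_cancel₀ ht ?_
    rw [← hg, map_smul, RingHom.id_apply, smul_eq_mul, smul_eq_mul, hg x, mul_left_comm]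

/-- A finitely generated projective module has a finite dual basis. -/
theorem exists_dual_basis (A M : Type*) [CommRing A] [AddCommGroup M] [Module A M]
    [Module.Finite A M] [Module.Projective A M] :
    ∃ (n : ℕ) (q : Fin n → M) (c : M →ₗ[A] (Fin n → A)), ∀ x, ∑ i, c x i • q i = x := by
  obtain ⟨n, f, hf⟩ := Module.Finite.exists_fin' A M
  obtain ⟨c, hc⟩ := Module.projective_lifting_property f LinearMap.id hf
  refine ⟨n, fun i => f (Pi.single i 1), c, fun x => ?_⟩
  have h := LinearMap.congr_fun hc x
  rw [LinearMap.comp_apply, LinearMap.pi_apply_eq_sum_univ f] at h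
  refine (Finset.sum_congr rfl fun i _ => ?_).trans h
  congr 1
  refine congrArg f (funext fun j => ?_)
  simp [Pi.single_apply, eq_comm]

/-- The kernel of a surjection from a projective `A`-module onto a finitely generated projective
module over `B = A / (t)`, where `t` is a nonzero element of the domain `A`, is projective. It is
in fact a direct summand of the sum of the given `A`-module and a free one. -/
theorem projective_ker_of_quotient {A B M Q : Type*} [CommRing A] [IsDomain A] [CommRing B]
    [AddCommGroup M] [Module A M] [AddCommGroup Q] [Module B Q] [Module.Projective A M]
    [Module.Finite B Q] [Module.Projective B Q] (f : A →+* B) (hf : Function.Surjective f)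
    {t : A} (ht : t ≠ 0) (hft : f t = 0) (hker : ∀ a, f a = 0 → t ∣ a) (π : M →+ Q)
    (hπ : ∀ (a : A) (m : M), π (a • m) = f a • π m) (hsurj : Function.Surjective π)
    (K : Submodule A M) (hK : ∀ x, x ∈ K ↔ π x = 0) : Module.Projective A K := by
  obtain ⟨n, q, c, hc⟩ := exists_dual_basis B Q
  choose m hm using fun i => hsurj (q i)
  -- the coordinates on `Q`, lifted to `M`
  obtain ⟨l, hl⟩ := exists_lift_of_projective (A := A) (M := M) (N := Fin n → A)
    { carrier := {z | ∀ i, f (z.2 i) = c (π z.1) i}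
      add_mem' := fun hx hy i => by simp [hx i, hy i]
      zero_mem' := fun i => by simp
      smul_mem' := fun a x hx i => by simp [hπ, hx i] } fun x => by
        choose v hv using fun i => hf (c (π x) i)
        exact ⟨v, hv⟩
  replace hl : ∀ x i, f (l x i) = c (π x) i := hl
  -- on the kernel of `π` these coordinates are divisible by `t`
  choose g hg using fun i => exists_linearMap_div ht (LinearMap.proj i ∘ₗ l ∘ₗ K.subtype)
    fun x => hker _ (by
      change f (l x.1 i) = 0
      rw [hl, (hK _).1 x.2, map_zero, Pi.zero_apply])
  let ρ : (Fin n → A) →ₗ[A] M := Fintype.linearCombination A m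
  have hρ : ∀ v, π (ρ v) = ∑ i, f (v i) • q i := fun v => by
    simp only [ρ, Fintype.linearCombination_apply, map_sum, hπ, hm]
  -- the inclusion `i` of `K` is split by `s`, which corrects an element of `M` by a lift of its
  -- image in `Q`
  let i : K →ₗ[A] M × (Fin n → A) := K.subtype.prod (LinearMap.pi g)
  let s : M × (Fin n → A) →ₗ[A] M :=
    (LinearMap.id - ρ ∘ₗ l) ∘ₗ LinearMap.fst A M _ + (t • ρ) ∘ₗ LinearMap.snd A M _
  have hs : ∀ z, s z ∈ K := fun z => by
    rw [hK]
    change π (z.1 - ρ (l z.1) + t • ρ z.2) = 0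
    rw [map_add, map_sub, hπ, hft, zero_smul, add_zero, hρ]
    simp only [hl]
    rw [hc, sub_self]
  refine Module.Projective.of_split i (s.codRestrict K hs) (LinearMap.ext fun x => Subtype.ext ?_)
  change x.1 - ρ (l x.1) + t • ρ (fun j => g j x) = x.1
  have : l x.1 = t • fun j => g j x := funext fun j => hg j x
  rw [this, map_smul, sub_add_cancel]

/-! ### Sections of perverse sheaves with support conditions -/

namespace Fan

variable {V : Type u} [AddCommGroup V] [Module ℝ V] {Δ : Fan V}

/-- The sections over `σ` that vanish on the facets in `T`. -/
def Sheaf.relOn (F : Sheaf Δ) (σ : Δ.Cone) (T : Δ.Cone → Prop) :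
    Submodule (Poly σ) (F.obj σ) where
  carrier := {x | ∀ γ, ∀ h : IsFacet γ σ, T γ → F.res h.1 x = 0}
  add_mem' hx hy γ h hT := by rw [map_add, hx γ h hT, hy γ h hT, add_zero]
  zero_mem' γ h _ := map_zero _
  smul_mem' a x hx γ h hT := by rw [F.res_smul, hx γ h hT, smul_zero]

/-- A compatible family of sections on a subfan `Φ` of the boundary of `σ` extends to `σ`. (The
values of `x` outside `Φ` are irrelevant.) -/
theorem Sheaf.IsPerverse.exists_extend {F : Sheaf Δ} (hF : F.IsPerverse) (σ : Δ.Cone)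
    (Φ : Set Δ.Cone) (hΦσ : ∀ γ ∈ Φ, γ < σ) (hΦ : ∀ γ ∈ Φ, ∀ δ ≤ γ, δ ∈ Φ)
    (x : ∀ γ, F.obj γ) (hx : ∀ γ ∈ Φ, ∀ δ, ∀ h : δ ≤ γ, F.res h (x γ) = x δ) :
    ∃ y : F.obj σ, ∀ γ ∈ Φ, ∀ h : γ ≤ σ, F.res h y = x γ := by
  classical
  induction hn : ({γ | γ < σ} \ Φ).ncard using Nat.strong_induction_on generalizing Φ x with
  | _ n ih =>
    by_cases hne : ({γ | γ < σ} \ Φ).Nonempty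
    · -- extend the family to a minimal missing cone
      obtain ⟨α, hα, hmin⟩ := (Set.toFinite ({γ | γ < σ} \ Φ)).exists_minimal hne
      have hlt : ∀ β, β < α → β ∈ Φ := fun β hβ => by
        by_contra hc
        exact hβ.not_ge (hmin ⟨hβ.trans hα.1, hc⟩ hβ.le)
      obtain ⟨w, hw⟩ := hF.flabby α ⟨fun γ => x γ.1, fun γ δ h => hx γ.1 (hlt _ γ.2) δ.1 h⟩
      replace hw : ∀ γ, ∀ h : γ < α, F.res h.le w = x γ := fun γ h =>
        congrFun (congrArg Subtype.val hw) ⟨γ, h⟩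
      obtain ⟨y, hy⟩ := ih _ (by
          rw [← hn]
          refine Set.ncard_lt_ncard ⟨fun γ hγ => ⟨hγ.1, fun h => hγ.2 (Set.mem_insert_of_mem _ h)⟩,
            fun h => (h hα).2 (Set.mem_insert _ _)⟩ (Set.toFinite _)) (insert α Φ)
        (by rintro γ (rfl | hγ); exacts [hα.1, hΦσ γ hγ])
        (by
          rintro γ (rfl | hγ) δ hδ
          · rcases hδ.eq_or_lt with rfl | h
            exacts [Set.mem_insert _ _, Set.mem_insert_of_mem _ (hlt δ h)]
          · exact Set.mem_insert_of_mem _ (hΦ γ hγ δ hδ))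
        (Function.update x α w) (by
          rintro γ (rfl | hγ) δ hδ
          · rcases hδ.eq_or_lt with rfl | h
            · simp [F.res_refl]
            · rw [Function.update_self, Function.update_of_ne h.ne, hw δ h]
          · rw [Function.update_of_ne (fun e : γ = α => hα.2 (e ▸ hγ)),
              Function.update_of_ne (fun e : δ = α => hα.2 (e ▸ hΦ γ hγ δ hδ)), hx γ hγ]) rfl
      refine ⟨y, fun γ hγ h => ?_⟩
      rw [hy γ (Set.mem_insert_of_mem _ hγ), Function.update_of_ne (fun e : γ = α => hα.2 (e ▸ hγ))]
    · have hall : ∀ γ, γ < σ → γ ∈ Φ := fun γ hγ => by_contra fun hc => hne ⟨γ, hγ, hc⟩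
      obtain ⟨y, hy⟩ := hF.flabby σ ⟨fun γ => x γ.1, fun γ δ h => hx γ.1 (hall _ γ.2) δ.1 h⟩
      exact ⟨y, fun γ hγ h => congrFun (congrArg Subtype.val hy) ⟨γ, hΦσ γ hγ⟩⟩

theorem HasKernel.ι_ne_zero {τ σ : Δ.Cone} {hτ : IsFacet τ σ} {h : Module.Dual ℝ (lin σ)}
    (hh : HasKernel hτ h) : SymmetricAlgebra.ι ℝ _ h ≠ 0 := by
  obtain ⟨v, hv⟩ := hh.exists_eq_one
  rw [Ne, ← map_zero (SymmetricAlgebra.ι ℝ (Module.Dual ℝ (lin σ))),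
    SymmetricAlgebra.ι_injective.eq_iff]
  rintro rfl
  simp at hv

theorem Sheaf.relOn_congr (F : Sheaf Δ) {σ : Δ.Cone} {T T' : Δ.Cone → Prop}
    (h : ∀ γ, IsFacet γ σ → (T γ ↔ T' γ)) : F.relOn σ T = F.relOn σ T' := by
  ext x
  exact ⟨fun hx γ hγ hT => hx γ hγ ((h γ hγ).2 hT), fun hx γ hγ hT => hx γ hγ ((h γ hγ).1 hT)⟩

/-- An induction principle along a sweep: to prove a property of all sets of facets visible before
a given time, add the facets one at a time. -/
theorem Sweep.induction {σ : Δ.Cone} (S : Sweep σ) {motive : (Δ.Cone → Prop) → Prop}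
    (congr : ∀ T T' : Δ.Cone → Prop, (∀ γ, IsFacet γ σ → (T γ ↔ T' γ)) → motive T → motive T')
    (empty : motive fun _ => False)
    (step : ∀ δ, IsFacet δ σ → motive (fun γ => S.time γ < S.time δ) →
      motive fun γ => S.time γ ≤ S.time δ) (c : ℝ) : motive fun γ => S.time γ < c := by
  classical
  induction hn : {γ | IsFacet γ σ ∧ S.time γ < c}.ncard using Nat.strong_induction_on
    generalizing c with
  | _ n ih =>
    by_cases hne : {γ | IsFacet γ σ ∧ S.time γ < c}.Nonempty
    · obtain ⟨δ, hδ, hmax⟩ := Set.exists_max_image _ S.time (Set.toFinite _) hne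
      refine congr _ _ (fun γ hγ => ⟨fun h => lt_of_le_of_lt h hδ.2, fun h => hmax γ ⟨hγ, h⟩⟩)
        (step δ hδ.1 (ih _ ?_ _ rfl))
      rw [← hn]
      exact Set.ncard_lt_ncard ⟨fun γ hγ => ⟨hγ.1, hγ.2.trans hδ.2⟩,
        fun h => lt_irrefl _ (h hδ).2⟩ (Set.toFinite _)
    · exact congr _ _ (fun γ hγ => ⟨False.elim, fun h => hne ⟨γ, hγ, h⟩⟩) empty

variable [FiniteDimensional ℝ V]

theorem Sheaf.relOn_true (F : Sheaf Δ) (σ : Δ.Cone) :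
    F.relOn σ (fun _ => True) = F.relative σ := by
  ext x
  rw [F.mem_relative]
  refine ⟨fun hx γ hγ => ?_, fun hx γ h _ => hx γ h.lt⟩
  obtain ⟨δ, h1, h2⟩ := exists_facet hγ
  rw [← F.res_res h1 h2.1, hx δ h2 trivial, map_zero]

/-- A section that vanishes on all facets but one extends its restriction to that facet. -/
theorem Sheaf.isExtension_of_res_eq_zero (F : Sheaf Δ) {τ σ : Δ.Cone} (hτ : IsFacet τ σ)
    {x : F.obj σ} (hx : ∀ γ, ∀ h : IsFacet γ σ, γ ≠ τ → F.res h.1 x = 0) :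
    F.res hτ.1 x ∈ F.relative τ ∧ F.IsExtension hτ (F.res hτ.1 x) x := by
  have key : ∀ α, ∀ h : α < σ, α ≠ τ → F.res h.le x = 0 := by
    intro α hα hne
    by_cases hle : α ≤ τ
    · obtain ⟨δ, h1, h2, h3⟩ := exists_facet_ne hτ (lt_of_le_of_ne hle hne)
      rw [← F.res_res h2 h1.1, hx δ h1 h3, map_zero]
    · obtain ⟨δ, h1, h2⟩ := exists_facet hα
      rw [← F.res_res h1 h2.1, hx δ h2 (fun e => hle (e ▸ h1)), map_zero]
  refine ⟨F.mem_relative.2 fun α hα => ?_, rfl, key⟩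
  rw [F.res_res, key α (hα.trans hτ.lt) hα.ne]

/-- The equation of the facet `γ` of `σ`, as a linear form on `V_σ`. -/
def facetForm (γ σ : Δ.Cone) : Module.Dual ℝ (lin σ) := supportForm γ σ ∘ₗ (lin σ).subtype

theorem hasKernel_facetForm {γ σ : Δ.Cone} (hγ : IsFacet γ σ) : HasKernel hγ (facetForm γ σ) :=
  fun v => ⟨fun h => mem_lin_of_supportForm_eq_zero hγ v.2 h, fun h => supportForm_lin hγ.lt h⟩

theorem resPoly_facetForm_ne_zero {γ δ σ : Δ.Cone} (hγ : IsFacet γ σ) (hδ : IsFacet δ σ)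
    (hne : γ ≠ δ) : resPoly hδ.1 (SymmetricAlgebra.ι ℝ _ (facetForm γ σ)) ≠ 0 := by
  obtain ⟨x, hx, hx'⟩ := exists_mem_notMem (hδ.not_le hγ hne.symm)
  rw [resPoly_ι, Ne, ← map_zero (SymmetricAlgebra.ι ℝ (Module.Dual ℝ (lin δ))),
    SymmetricAlgebra.ι_injective.eq_iff]
  intro e
  exact (supportForm_pos hγ.lt (hδ.1 hx) hx').ne'
    (LinearMap.congr_fun e ⟨x, Submodule.subset_span hx⟩)

/-- The equations of distinct facets are pairwise coprime. -/
theorem prod_facetForm_dvd {σ : Δ.Cone} (s : Finset Δ.Cone) (hs : ∀ γ ∈ s, IsFacet γ σ)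
    {a : Poly σ} (ha : ∀ γ ∈ s, SymmetricAlgebra.ι ℝ _ (facetForm γ σ) ∣ a) :
    ∏ γ ∈ s, SymmetricAlgebra.ι ℝ _ (facetForm γ σ) ∣ a := by
  classical
  induction s using Finset.induction_on with
  | empty => simp
  | insert γ s hγ ih =>
    obtain ⟨b, hb⟩ := ih (fun δ hδ => hs δ (Finset.mem_insert_of_mem hδ))
      fun δ hδ => ha δ (Finset.mem_insert_of_mem hδ)
    have hγ' := hs γ (Finset.mem_insert_self _ _)
    obtain ⟨c, hc⟩ := ha γ (Finset.mem_insert_self _ _)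
    have h0 : resPoly hγ'.1 a = 0 := by
      rw [hc, map_mul, resPoly_ι, resForm_eq_zero (hasKernel_facetForm hγ'), map_zero, zero_mul]
    rw [hb, map_mul, map_prod, mul_eq_zero, Finset.prod_eq_zero_iff] at h0
    have h1 : resPoly hγ'.1 b = 0 := h0.resolve_left fun ⟨δ, hδ, e⟩ =>
      resPoly_facetForm_ne_zero (hs δ (Finset.mem_insert_of_mem hδ)) hγ'
        (fun e => hγ (e ▸ hδ)) e
    obtain ⟨d, hd⟩ := dvd_of_resPoly_eq_zero (hasKernel_facetForm hγ') h1
    exact ⟨d, by rw [hb, hd, Finset.prod_insert hγ]; ring⟩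

/-- A homomorphism on the relative sections over `σ` whose images under `φ_h` vanish for the facets
in `T` extends to the sections that vanish on the other facets. -/
theorem Sheaf.IsPerverse.exists_extend_hom {F : Sheaf Δ} (hF : F.IsPerverse) {σ : Δ.Cone}
    (T : Δ.Cone → Prop) (f : F.relative σ →ₗ[Poly σ] Poly σ)
    (hf : ∀ γ, ∀ hγ : IsFacet γ σ, T γ → phi hF (hasKernel_facetForm hγ) f = 0) :
    ∃ f' : F.relOn σ (fun γ => ¬ T γ) →ₗ[Poly σ] Poly σ,
      ∀ x (h : x ∈ F.relative σ) (h' : x ∈ F.relOn σ fun γ => ¬ T γ), f' ⟨x, h'⟩ = f ⟨x, h⟩ := by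
  classical
  have := Fintype.ofFinite Δ.Cone
  let s : Finset Δ.Cone := Finset.univ.filter fun γ => IsFacet γ σ ∧ T γ
  have hs : ∀ γ, γ ∈ s ↔ IsFacet γ σ ∧ T γ := fun γ => by simp [s]
  let e : Δ.Cone → Poly σ := fun γ => SymmetricAlgebra.ι ℝ _ (facetForm γ σ)
  have he : ∀ γ, ∀ hγ : IsFacet γ σ, resPoly hγ.1 (e γ) = 0 := fun γ hγ => by
    rw [resPoly_ι, resForm_eq_zero (hasKernel_facetForm hγ), map_zero]
  -- the product of the equations of the facets in `T` takes sections that vanish on the other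
  -- facets to relative sections
  let P := ∏ γ ∈ s, e γ
  have hP : P ≠ 0 := Finset.prod_ne_zero_iff.2 fun γ hγ =>
    (hasKernel_facetForm ((hs γ).1 hγ).1).ι_ne_zero
  have hPx : ∀ x ∈ F.relOn σ (fun γ => ¬ T γ), P • x ∈ F.relative σ := by
    intro x hx
    rw [← F.relOn_true]
    intro γ hγ _
    rw [F.res_smul]
    by_cases hT : T γ
    · rw [map_prod, Finset.prod_eq_zero ((hs γ).2 ⟨hγ, hT⟩) (he γ hγ), zero_smul]
    · rw [hx γ hγ hT, smul_zero]
  let φ : F.relOn σ (fun γ => ¬ T γ) →ₗ[Poly σ] Poly σ :=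
    f ∘ₗ (P • (F.relOn σ fun γ => ¬ T γ).subtype).codRestrict (F.relative σ) fun x => hPx x.1 x.2
  -- that the image of `f` under `φ_h` vanishes for the facet `γ` means that `f (P • x)` is
  -- divisible by the equation of `γ`, as `(P / e γ) • x` extends its restriction to `γ` by zero
  have hdvd : ∀ x, P ∣ φ x := by
    intro x
    refine prod_facetForm_dvd s (fun γ hγ => ((hs γ).1 hγ).1) fun γ hγ => ?_
    obtain ⟨hγσ, hT⟩ := (hs γ).1 hγ
    have hP' : P = e γ * ∏ δ ∈ s.erase γ, e δ := (Finset.mul_prod_erase s e hγ).symm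
    set P' := ∏ δ ∈ s.erase γ, e δ
    obtain ⟨h1, h2⟩ := F.isExtension_of_res_eq_zero (x := P' • x.1) hγσ fun δ hδ hne => by
      rw [F.res_smul]
      by_cases hT' : T δ
      · rw [map_prod, Finset.prod_eq_zero
          (Finset.mem_erase.2 ⟨hne, (hs δ).2 ⟨hδ, hT'⟩⟩) (he δ hδ), zero_smul]
      · rw [x.2 δ hδ hT', smul_zero]
    have h3 := phiAux_apply hF (hasKernel_facetForm hγσ) f ⟨_, h1⟩ h2
    have h4 : phiAux hF (hasKernel_facetForm hγσ) f ⟨_, h1⟩ = 0 :=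
      LinearMap.congr_fun (hf γ hγσ hT) _
    rw [h4] at h3
    have h5 : φ x = f ⟨_, h2.smul_mem (hasKernel_facetForm hγσ)⟩ := by
      change f _ = f _
      congr 1
      refine Subtype.ext ?_
      change P • x.1 = e γ • P' • x.1
      rw [hP', mul_smul]
    rw [h5]
    exact dvd_of_resPoly_eq_zero (hasKernel_facetForm hγσ) h3.symm
  obtain ⟨f', hf'⟩ := exists_linearMap_div hP φ hdvd
  refine ⟨f', fun x h h' => mul_left_cancel₀ hP ?_⟩
  rw [← hf', ← smul_eq_mul, ← map_smul]
  rfl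

/-- Each facet `ζ` of the facet `δ` lies in one other facet of `σ`, and this facet is crossed before
`δ` if and only if `ζ` is visible from the point where the line of the sweep meets `V_δ`. -/
theorem Sweep.exists_other {σ δ ζ : Δ.Cone} (S : Sweep σ) (hδ : IsFacet δ σ) (hζ : IsFacet ζ δ) :
    ∃ δ' : Δ.Cone, IsFacet δ' σ ∧ ζ ≤ δ' ∧ δ' ≠ δ ∧
      (supportForm ζ δ (S.point δ) < 0 ↔ S.time δ' < S.time δ) ∧
      (¬ supportForm ζ δ (S.point δ) < 0 ↔ S.time δ < S.time δ') := by
  obtain ⟨δ', h1, h2, h3⟩ := exists_facet_ne hδ hζ.lt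
  obtain ⟨c, hc, h⟩ := exists_supportForm_restrict hδ h1 h3.symm hζ h2
  have key : supportForm ζ δ (S.point δ) < 0 ↔ S.time δ' < S.time δ := by
    rw [← S.neg_iff h1 hδ, h _ (S.point_mem hδ), ← smul_eq_mul, smul_neg_iff_of_pos_left hc]
  refine ⟨δ', h1, h2, h3, key, ?_⟩
  rw [key, not_lt]
  exact ⟨fun h => lt_of_le_of_ne h fun e => h3 (S.injective h1 hδ e.symm), le_of_lt⟩

/-- Sections over the next facet `δ` of a sweep that vanish on the facets of `δ` visible so far
extend to sections over `σ` that vanish on the earlier facets. -/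
theorem Sheaf.IsPerverse.exists_sweep_extend {F : Sheaf Δ} (hF : F.IsPerverse) {σ δ : Δ.Cone}
    (S : Sweep σ) (hδ : IsFacet δ σ) (y : F.obj δ)
    (hy : y ∈ F.relOn δ fun ζ => supportForm ζ δ (S.point δ) < 0) :
    ∃ z ∈ F.relOn σ (fun γ => S.time γ < S.time δ), F.res hδ.1 z = y := by
  classical
  -- extend `y` by zero to the earlier facets
  obtain ⟨z, hz⟩ := hF.exists_extend σ
    {γ | γ ≤ δ ∨ ∃ δ', IsFacet δ' σ ∧ S.time δ' < S.time δ ∧ γ ≤ δ'}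
    (by
      rintro γ (h | ⟨δ', h1, -, h2⟩)
      exacts [h.trans_lt hδ.lt, h2.trans_lt h1.lt])
    (by
      rintro γ (h | ⟨δ', h1, h2, h3⟩) ε hε
      exacts [Or.inl (hε.trans h), Or.inr ⟨δ', h1, h2, hε.trans h3⟩])
    (fun γ => if h : γ ≤ δ then F.res h y else 0)
    (by
      intro γ hγ ε hε
      by_cases h : γ ≤ δ
      · rw [dif_pos h, dif_pos (hε.trans h), F.res_res]
      · rw [dif_neg h, map_zero]
        split_ifs with h'
        · obtain ⟨δ', h1, h2, h3⟩ := hγ.resolve_left h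
          obtain ⟨ζ, hζ, hεζ, hneg⟩ := exists_visible_facet hδ h1 (S.point_mem hδ)
            ((S.neg_iff h1 hδ).2 h2) h' (hε.trans h3)
          rw [← F.res_res hεζ hζ.1, hy ζ hζ hneg, map_zero]
        · rfl)
  refine ⟨z, fun γ hγ ht => ?_, ?_⟩
  · rw [hz γ (Or.inr ⟨γ, hγ, ht, le_rfl⟩), dif_neg]
    exact hγ.not_le hδ fun e => by rw [e] at ht; exact lt_irrefl _ ht
  · rw [hz δ (Or.inl le_rfl), dif_pos le_rfl, F.res_refl]

/-- A section that vanishes on the facets before `δ` restricts on `δ` to a section that vanishes on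
the visible facets of `δ`. -/
theorem Sheaf.res_mem_relOn (F : Sheaf Δ) {σ δ : Δ.Cone} (S : Sweep σ) (hδ : IsFacet δ σ)
    {x : F.obj σ} (hx : x ∈ F.relOn σ fun γ => S.time γ < S.time δ) :
    F.res hδ.1 x ∈ F.relOn δ fun ζ => supportForm ζ δ (S.point δ) < 0 := by
  intro ζ hζ hneg
  obtain ⟨δ', h1, h2, -, h3, -⟩ := S.exists_other hδ hζ
  rw [F.res_res, ← F.res_res h2 h1.1, hx δ' h1 (h3.1 hneg), map_zero]

/-- A section that vanishes on the facets after `δ` restricts on `δ` to a section that vanishes on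
the invisible facets of `δ`. -/
theorem Sheaf.res_mem_relOn' (F : Sheaf Δ) {σ δ : Δ.Cone} (S : Sweep σ) (hδ : IsFacet δ σ)
    {x : F.obj σ} (hx : x ∈ F.relOn σ fun γ => S.time δ < S.time γ) :
    F.res hδ.1 x ∈ F.relOn δ fun ζ => ¬ supportForm ζ δ (S.point δ) < 0 := by
  intro ζ hζ hneg
  obtain ⟨δ', h1, h2, -, -, h3⟩ := S.exists_other hδ hζ
  rw [F.res_res, ← F.res_res h2 h1.1, hx δ' h1 (h3.1 hneg), map_zero]

/-- The sections over `σ` that vanish on the facets visible from a point of `V_σ` form a projective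
module. -/
theorem Sheaf.IsPerverse.projective_relOn {F : Sheaf Δ} (hF : F.IsPerverse) (σ : Δ.Cone) {p : V}
    (hp : p ∈ lin σ) :
    Module.Projective (Poly σ) (F.relOn σ fun γ => supportForm γ σ p < 0) := by
  induction hn : dim σ using Nat.strong_induction_on generalizing σ p with
  | _ n ih =>
    have := hF.finite
    have := hF.free
    obtain ⟨S, hS⟩ := exists_sweep σ hp
    have key := S.induction (motive := fun T => Module.Projective (Poly σ) (F.relOn σ T))
      (fun T T' h hT => by rwa [← F.relOn_congr h]) ?_ ?_ 0
    · rwa [F.relOn_congr hS]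
    · have : F.relOn σ (fun _ => False) = ⊤ := eq_top_iff.2 fun x _ γ hγ h => h.elim
      rw [this]
      exact Module.Projective.of_equiv Submodule.topEquiv.symm
    · intro δ hδ hM
      -- the sections that vanish on `δ` as well are the kernel of the restriction to `δ`, whose
      -- image is projective by induction on the dimension
      have hQ := ih (dim δ) (hn ▸ dim_lt hδ.lt) δ (S.point_mem hδ) rfl
      set M := F.relOn σ fun γ => S.time γ < S.time δ
      set Q := F.relOn δ fun ζ => supportForm ζ δ (S.point δ) < 0
      have hle : F.relOn σ (fun γ => S.time γ ≤ S.time δ) ≤ M :=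
        fun x hx γ hγ ht => hx γ hγ (le_of_lt ht)
      let π : M →+ Q :=
        { toFun := fun x => ⟨F.res hδ.1 x.1, F.res_mem_relOn S hδ x.2⟩
          map_zero' := Subtype.ext (map_zero _)
          map_add' := fun x y => Subtype.ext (map_add _ _ _) }
      have hK := projective_ker_of_quotient (resPoly hδ.1).toRingHom (resPoly_surjective hδ.1)
        (hasKernel_facetForm hδ).ι_ne_zero
        (by
          change resPoly hδ.1 _ = 0
          rw [resPoly_ι, resForm_eq_zero (hasKernel_facetForm hδ), map_zero])
        (fun a ha => dvd_of_resPoly_eq_zero (hasKernel_facetForm hδ) ha) π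
        (fun a m => Subtype.ext (F.res_smul _ _ _))
        (fun y => by
          obtain ⟨z, hz, h⟩ := hF.exists_sweep_extend S hδ y.1 y.2
          exact ⟨⟨z, hz⟩, Subtype.ext h⟩)
        ((F.relOn σ fun γ => S.time γ ≤ S.time δ).submoduleOf M)
        (fun x => by
          refine ⟨fun hx => Subtype.ext (hx δ hδ le_rfl), fun hx γ hγ ht => ?_⟩
          rcases ht.lt_or_eq with ht | ht
          · exact x.2 γ hγ ht
          · obtain rfl := S.injective hγ hδ ht
            exact congrArg Subtype.val hx)
      exact Module.Projective.of_equiv (Submodule.submoduleOfEquivOfLe hle)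

end Fan

/-! ### The maps between the dual modules -/

/-- A linear form on a finitely generated projective module that takes values in the ideal `I` is a
combination of linear forms with coefficients in `I`. -/
theorem mem_smul_top_of_forall_mem {A M : Type*} [CommRing A] [AddCommGroup M] [Module A M]
    [Module.Finite A M] [Module.Projective A M] (I : Ideal A) (f : M →ₗ[A] A)
    (hf : ∀ x, f x ∈ I) : f ∈ I • (⊤ : Submodule A (M →ₗ[A] A)) := by
  obtain ⟨n, q, c, hc⟩ := exists_dual_basis A M
  have : f = ∑ i, f (q i) • (LinearMap.proj i ∘ₗ c : M →ₗ[A] A) := by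
    ext x
    conv_lhs => rw [← hc x, map_sum]
    rw [LinearMap.sum_apply]
    refine Finset.sum_congr rfl fun i _ => ?_
    rw [map_smul, smul_eq_mul, mul_comm]
    rfl
  rw [this]
  exact Submodule.sum_mem _ fun i _ => Submodule.smul_mem_smul (hf _) trivial

namespace Fan

variable {V : Type u} [AddCommGroup V] [Module ℝ V] {Δ : Fan V}

/-- Equations `h^σ_τ` of the facets `τ` of the cones `σ`, normalized in such a way that the maps
`φ_h` commute. -/
structure FormSystem (Δ : Fan V) where
  form : ∀ {τ σ : Δ.Cone}, IsFacet τ σ → Module.Dual ℝ (lin σ)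
  hasKernel : ∀ {τ σ : Δ.Cone} (h : IsFacet τ σ), HasKernel h (form h)
  diamond : ∀ {ζ δ₁ δ₂ σ : Δ.Cone} (h₁ : IsFacet δ₁ σ) (h₂ : IsFacet δ₂ σ) (k₁ : IsFacet ζ δ₁)
    (k₂ : IsFacet ζ δ₂), δ₁ ≠ δ₂ →
      ∃ c : ℝ, form k₁ = c • resForm h₁.1 (form h₂) ∧ form k₂ = c • resForm h₂.1 (form h₁)

theorem Sweep.exists_bound {σ : Δ.Cone} (S : Sweep σ) : ∃ c, ∀ γ, S.time γ < c := by
  obtain ⟨c, hc⟩ := (Set.finite_range S.time).bddAbove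
  exact ⟨c + 1, fun γ => lt_of_le_of_lt (hc ⟨γ, rfl⟩) (lt_add_one c)⟩

variable [FiniteDimensional ℝ V] {F : Sheaf Δ}

/-- A compatible family of sections over the facets of `σ` extends to a section over `σ`, even if
compatibility is only known on the faces of codimension two. -/
theorem Sheaf.IsPerverse.exists_res_eq (hF : F.IsPerverse) {σ : Δ.Cone} (x : ∀ γ, F.obj γ)
    (hx : ∀ {ζ δ₁ δ₂ : Δ.Cone}, IsFacet δ₁ σ → IsFacet δ₂ σ → ∀ (k₁ : IsFacet ζ δ₁)
      (k₂ : IsFacet ζ δ₂), δ₁ ≠ δ₂ → F.res k₁.1 (x δ₁) = F.res k₂.1 (x δ₂)) :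
    ∃ y : F.obj σ, ∀ γ, ∀ h : IsFacet γ σ, F.res h.1 y = x γ := by
  obtain ⟨S, -⟩ := exists_sweep σ (zero_mem (lin σ))
  obtain ⟨c, hc⟩ := S.exists_bound
  obtain ⟨y, hy⟩ := S.induction
    (motive := fun T => ∃ y : F.obj σ, ∀ γ, ∀ h : IsFacet γ σ, T γ → F.res h.1 y = x γ)
    (fun T T' h ⟨y, hy⟩ => ⟨y, fun γ hγ hT => hy γ hγ ((h γ hγ).2 hT)⟩)
    ⟨0, fun _ _ h => h.elim⟩
    (fun δ hδ ⟨y, hy⟩ => by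
      obtain ⟨z, hz, hzδ⟩ := hF.exists_sweep_extend S hδ (x δ - F.res hδ.1 y) (by
        intro ζ hζ hneg
        obtain ⟨δ', h1, h2, hne, h3, -⟩ := S.exists_other hδ hζ
        have hζ' := isFacet_right hδ h1 hζ h2
        rw [map_sub, hx hδ h1 hζ hζ' hne.symm, ← hy δ' h1 (h3.1 hneg), F.res_res, F.res_res,
          sub_self])
      refine ⟨y + z, fun γ hγ ht => ?_⟩
      rw [map_add]
      rcases ht.lt_or_eq with ht | ht
      · rw [hy γ hγ ht, hz γ hγ ht, add_zero]
      · obtain rfl := S.injective hγ hδ ht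
        rw [hzδ, add_sub_cancel]) c
  exact ⟨y, fun γ hγ => hy γ hγ (hc γ)⟩

/-- All facets of `σ` are visible from the antipode of an interior point. -/
theorem Sheaf.IsPerverse.projective_relative (hF : F.IsPerverse) (σ : Δ.Cone) :
    Module.Projective (Poly σ) (F.relative σ) := by
  obtain ⟨z, hz, hpos⟩ := exists_interior σ
  have h := hF.projective_relOn σ (neg_mem hz)
  rw [F.relOn_congr (T' := fun _ => True), F.relOn_true] at h
  · exact h
  · intro γ hγ
    rw [map_neg, neg_lt_zero, iff_true]
    exact hpos γ hγ

theorem Sheaf.IsPerverse.finite_relative (hF : F.IsPerverse) (σ : Δ.Cone) :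
    Module.Finite (Poly σ) (F.relative σ) := by
  have := hF.finite σ
  infer_instance

theorem phi_eq_zero (hF : F.IsPerverse) {τ σ : Δ.Cone} {hτ : IsFacet τ σ}
    {h h' : Module.Dual ℝ (lin σ)} (hh : HasKernel hτ h) (hh' : HasKernel hτ h')
    {f : F.relative σ →ₗ[Poly σ] Poly σ} (hf : phi hF hh f = 0) : phi hF hh' f = 0 := by
  obtain ⟨c, rfl⟩ := hh.exists_smul hh'
  rw [phi_smul hF hh hh', LinearMap.smul_apply, hf, smul_zero]

theorem phi_apply (hF : F.IsPerverse) {τ σ : Δ.Cone} {hτ : IsFacet τ σ}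
    {h : Module.Dual ℝ (lin σ)} (hh : HasKernel hτ h) (f : F.relative σ →ₗ[Poly σ] Poly σ)
    (g : F.relative τ) {g' : F.obj σ} (hg : F.IsExtension hτ g.1 g') :
    phi hF hh f g = resPoly hτ.1 (f ⟨_, hg.smul_mem hh⟩) :=
  phiAux_apply hF hh f g hg

theorem phi_mul_smul (hF : F.IsPerverse) {τ σ : Δ.Cone} {hτ : IsFacet τ σ}
    {h : Module.Dual ℝ (lin σ)} (hh : HasKernel hτ h) (a : Poly σ)
    (f : F.relative σ →ₗ[Poly σ] Poly σ) :
    phi hF hh (a • f) = resPoly hτ.1 a • phi hF hh f := by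
  ext g
  obtain ⟨g', hg'⟩ := hF.exists_isExtension hτ g
  change _ = resPoly hτ.1 a * phi hF hh f g
  rw [phi_apply hF hh (a • f) g hg', phi_apply hF hh f g hg', LinearMap.smul_apply, smul_eq_mul,
    map_mul]

/-- The value of the composition of two maps `φ`, in terms of a section over the big cone. -/
theorem phi_phi_apply (hF : F.IsPerverse) {ζ δ₁ δ₂ σ : Δ.Cone} {h₁ : IsFacet δ₁ σ}
    {h₂ : IsFacet δ₂ σ} {k₁ : IsFacet ζ δ₁} {l₁ l₂ : Module.Dual ℝ (lin σ)}
    {m₁ : Module.Dual ℝ (lin δ₁)} (hl₁ : HasKernel h₁ l₁) (hl₂ : HasKernel h₂ l₂)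
    (hm₁ : HasKernel k₁ m₁) {c : ℝ} (hc : m₁ = c • resForm h₁.1 l₂)
    (f : F.relative σ →ₗ[Poly σ] Poly σ) (g : F.relative ζ) {z : F.obj σ}
    (hz : ∀ γ, ∀ h : IsFacet γ σ, γ ≠ δ₁ → γ ≠ δ₂ → F.res h.1 z = 0)
    (hz₁ : F.IsExtension k₁ g.1 (F.res h₁.1 z)) :
    ∃ hmem : c • SymmetricAlgebra.ι ℝ _ l₁ • SymmetricAlgebra.ι ℝ _ l₂ • z ∈ F.relative σ,
      phi hF hm₁ (phi hF hl₁ f) g = resPoly (k₁.1.trans h₁.1) (f ⟨_, hmem⟩) := by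
  obtain ⟨-, hx2⟩ := F.isExtension_of_res_eq_zero (x := c • SymmetricAlgebra.ι ℝ _ l₂ • z) h₁
    fun γ hγ hne => by
      rw [map_smul, F.res_smul]
      by_cases e : γ = δ₂
      · subst e
        rw [resPoly_ι, resForm_eq_zero hl₂, map_zero, zero_smul, smul_zero]
      · rw [hz γ hγ hne e, smul_zero, smul_zero]
  have e1 : F.res h₁.1 (c • SymmetricAlgebra.ι ℝ _ l₂ • z) =
      SymmetricAlgebra.ι ℝ _ m₁ • F.res h₁.1 z := by
    rw [map_smul, F.res_smul, resPoly_ι, hc, map_smul, smul_assoc]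
  rw [e1] at hx2
  have e2 : SymmetricAlgebra.ι ℝ _ l₁ • c • SymmetricAlgebra.ι ℝ _ l₂ • z =
      c • SymmetricAlgebra.ι ℝ _ l₁ • SymmetricAlgebra.ι ℝ _ l₂ • z := smul_comm _ _ _
  have hmem := hx2.smul_mem hl₁
  rw [e2] at hmem
  refine ⟨hmem, ?_⟩
  rw [phi_apply hF hm₁ _ g hz₁, phi_apply hF hl₁ f ⟨_, hz₁.smul_mem hm₁⟩ hx2, resPoly_comp]
  congr 3

/-- The maps `φ` along the two ways down a codimension two face agree. -/
theorem FormSystem.phi_comm (N : FormSystem Δ) (hF : F.IsPerverse) {ζ δ₁ δ₂ σ : Δ.Cone}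
    (h₁ : IsFacet δ₁ σ) (h₂ : IsFacet δ₂ σ) (k₁ : IsFacet ζ δ₁) (k₂ : IsFacet ζ δ₂) (hne : δ₁ ≠ δ₂)
    (f : F.relative σ →ₗ[Poly σ] Poly σ) :
    phi hF (N.hasKernel k₁) (phi hF (N.hasKernel h₁) f) =
      phi hF (N.hasKernel k₂) (phi hF (N.hasKernel h₂) f) := by
  classical
  ext g
  obtain ⟨c, hc₁, hc₂⟩ := N.diamond h₁ h₂ k₁ k₂ hne
  -- a section over `σ` that extends `g` and vanishes on the faces that do not contain `ζ`
  obtain ⟨g₁, hg₁⟩ := hF.exists_isExtension k₁ g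
  obtain ⟨z, hz⟩ := hF.exists_extend σ
    {γ | γ ≤ δ₁ ∨ ∃ δ', IsFacet δ' σ ∧ δ' ≠ δ₁ ∧ δ' ≠ δ₂ ∧ γ ≤ δ'}
    (by
      rintro γ (h | ⟨δ', h3, -, -, h4⟩)
      exacts [h.trans_lt h₁.lt, h4.trans_lt h3.lt])
    (by
      rintro γ (h | ⟨δ', h3, h4, h5, h6⟩) ε hε
      exacts [Or.inl (hε.trans h), Or.inr ⟨δ', h3, h4, h5, hε.trans h6⟩])
    (fun γ => if h : γ ≤ δ₁ then F.res h g₁ else 0)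
    (by
      intro γ hγ ε hε
      by_cases h : γ ≤ δ₁
      · rw [dif_pos h, dif_pos (hε.trans h), F.res_res]
      · rw [dif_neg h, map_zero]
        split_ifs with h'
        · obtain ⟨δ', h3, h4, h5, h6⟩ := hγ.resolve_left h
          have n1 : ε ≠ δ₁ := fun e => h₁.not_le h3 h4.symm (e ▸ hε.trans h6)
          refine (hg₁.2 ε (lt_of_le_of_ne h' n1) fun e => ?_).symm
          have := eq_or_eq_of_codim_two h₁ h₂ hne k₁ k₂.1 h3 (e ▸ hε.trans h6)
          exact this.elim h4 h5
        · rfl)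
  have hz1 : F.res h₁.1 z = g₁ := by
    rw [hz δ₁ (Or.inl le_rfl), dif_pos le_rfl, F.res_refl]
  have hz0 : ∀ γ, ∀ h : IsFacet γ σ, γ ≠ δ₁ → γ ≠ δ₂ → F.res h.1 z = 0 := fun γ h h3 h4 => by
    rw [hz γ (Or.inr ⟨γ, h, h3, h4, le_rfl⟩), dif_neg (h.not_le h₁ h3)]
  have hz2 : F.IsExtension k₂ g.1 (F.res h₂.1 z) := by
    refine ⟨?_, fun α hα hαζ => ?_⟩
    · rw [F.res_res, ← F.res_res k₁.1 h₁.1, hz1, hg₁.1]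
    · rw [F.res_res]
      obtain ⟨δ', h3, h4, h5⟩ := exists_facet_ne h₂ hα
      by_cases e : δ' = δ₁
      · subst e
        rw [← F.res_res h4 h₁.1, hz1]
        exact hg₁.2 α (lt_of_le_of_ne h4 fun e => h₁.not_le h₂ hne (e ▸ hα.le)) hαζ
      · rw [← F.res_res h4 h3.1, hz0 δ' h3 e h5, map_zero]
  obtain ⟨m1, e1⟩ := phi_phi_apply hF (N.hasKernel h₁) (N.hasKernel h₂) (N.hasKernel k₁) hc₁ f g
    hz0 (hz1 ▸ hg₁)
  obtain ⟨m2, e2⟩ := phi_phi_apply hF (N.hasKernel h₂) (N.hasKernel h₁) (N.hasKernel k₂) hc₂ f g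
    (fun γ h h3 h4 => hz0 γ h h4 h3) hz2
  rw [e1, e2]
  congr 3
  exact congrArg (c • ·) (smul_comm _ _ _)

/-- A single step along a sweep in the construction of a homomorphism with prescribed images
under the maps `φ`. -/
theorem exists_phi_step (N : FormSystem Δ) (hF : F.IsPerverse) {σ δ : Δ.Cone} (S : Sweep σ)
    (hδ : IsFacet δ σ) (u : F.relative δ →ₗ[Poly δ] Poly δ)
    (hu : ∀ ζ, ∀ hζ : IsFacet ζ δ, supportForm ζ δ (S.point δ) < 0 →
      phi hF (N.hasKernel hζ) u = 0) :
    ∃ f : F.relative σ →ₗ[Poly σ] Poly σ, phi hF (N.hasKernel hδ) f = u ∧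
      ∀ γ, ∀ h : IsFacet γ σ, S.time γ < S.time δ → phi hF (N.hasKernel h) f = 0 := by
  obtain ⟨u', hu'⟩ := hF.exists_extend_hom (fun ζ => supportForm ζ δ (S.point δ) < 0) u
    fun ζ hζ hneg => phi_eq_zero hF _ _ (hu ζ hζ hneg)
  -- lift `u'` to the projective module of sections that vanish on the later facets
  have hM : Module.Projective (Poly σ) (F.relOn σ fun γ => S.time δ < S.time γ) := by
    obtain ⟨p, hp, h⟩ := S.level_gt (S.time δ)
    rw [← F.relOn_congr h]
    exact hF.projective_relOn σ hp
  obtain ⟨φ, hφ⟩ := exists_lift_of_projective (A := Poly σ)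
    (M := F.relOn σ fun γ => S.time δ < S.time γ) (N := Poly σ)
    { carrier := {z | resPoly hδ.1 z.2 = u' ⟨_, F.res_mem_relOn' S hδ z.1.2⟩}
      add_mem' := fun {x y} hx hy => by
        change resPoly hδ.1 (x.2 + y.2) = _
        rw [map_add, show resPoly hδ.1 x.2 = _ from hx, show resPoly hδ.1 y.2 = _ from hy,
          ← map_add]
        exact congrArg u' (Subtype.ext (map_add (F.res hδ.1) x.1.1 y.1.1).symm)
      zero_mem' := by
        change resPoly hδ.1 0 = _
        rw [map_zero, eq_comm]
        convert map_zero u'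
        exact map_zero (F.res hδ.1)
      smul_mem' := fun a x hx => by
        change resPoly hδ.1 (a * x.2) = _
        rw [map_mul, show resPoly hδ.1 x.2 = _ from hx, ← smul_eq_mul, ← map_smul]
        exact congrArg u' (Subtype.ext (F.res_smul hδ.1 a x.1.1).symm) }
    fun x => by
      obtain ⟨y, hy⟩ := resPoly_surjective hδ.1 (u' ⟨_, F.res_mem_relOn' S hδ x.2⟩)
      exact ⟨y, hy⟩
  replace hφ : ∀ x, resPoly hδ.1 (φ x) = u' ⟨_, F.res_mem_relOn' S hδ x.2⟩ := hφ
  have hφ0 : ∀ x : F.relOn σ fun γ => S.time δ < S.time γ, F.res hδ.1 x.1 = 0 →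
      SymmetricAlgebra.ι ℝ _ (N.form hδ) ∣ φ x := fun x hx => by
    refine dvd_of_resPoly_eq_zero (N.hasKernel hδ) ?_
    rw [hφ]
    convert map_zero u'
    exact hx
  -- on the sections that vanish on `δ`, in particular on the relative sections, `φ` is divisible by
  -- the equation of `δ`; the quotient has the required images
  have hle : F.relative σ ≤ F.relOn σ fun γ => S.time δ < S.time γ := by
    rw [← F.relOn_true]
    exact fun x hx γ hγ _ => hx γ hγ trivial
  obtain ⟨f, hf⟩ := exists_linearMap_div (N.hasKernel hδ).ι_ne_zero (φ ∘ₗ Submodule.inclusion hle)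
    fun x => hφ0 _ (F.mem_relative.1 x.2 δ hδ.lt)
  have hf' : ∀ x (h : x ∈ F.relative σ), φ ⟨x, hle h⟩ =
      SymmetricAlgebra.ι ℝ _ (N.form hδ) * f ⟨x, h⟩ :=
    fun x h => hf ⟨x, h⟩
  refine ⟨f, ?_, fun γ hγ ht => ?_⟩
  · ext g
    obtain ⟨g', hg'⟩ := hF.exists_isExtension hδ g
    have hmem : g' ∈ F.relOn σ fun γ => S.time δ < S.time γ := fun γ hγ ht =>
      hg'.2 γ hγ.lt fun e => by rw [e] at ht; exact lt_irrefl _ ht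
    rw [phi_apply hF _ f g hg']
    have h1 := hf' _ (hg'.smul_mem (N.hasKernel hδ))
    have h2 : φ ⟨_, hle (hg'.smul_mem (N.hasKernel hδ))⟩ =
        SymmetricAlgebra.ι ℝ _ (N.form hδ) * φ ⟨g', hmem⟩ := by
      rw [← smul_eq_mul, ← map_smul]
      rfl
    rw [h2] at h1
    rw [← mul_left_cancel₀ (N.hasKernel hδ).ι_ne_zero h1, hφ]
    have h3 : F.res hδ.1 g' ∈ F.relative δ := by rw [hg'.1]; exact g.2
    rw [hu' _ h3]
    exact congrArg u (Subtype.ext hg'.1)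
  · have hne : γ ≠ δ := fun e => by rw [e] at ht; exact lt_irrefl _ ht
    ext g
    obtain ⟨g', hg'⟩ := hF.exists_isExtension hγ g
    have hmem : g' ∈ F.relOn σ fun γ => S.time δ < S.time γ := fun γ' hγ' ht' =>
      hg'.2 γ' hγ'.lt fun e => by rw [e] at ht'; exact lt_asymm ht ht'
    obtain ⟨b, hb⟩ := hφ0 ⟨g', hmem⟩ (hg'.2 δ hδ.lt hne.symm)
    rw [phi_apply hF _ f g hg', LinearMap.zero_apply]
    have h1 := hf' _ (hg'.smul_mem (N.hasKernel hγ))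
    have h2 : φ ⟨_, hle (hg'.smul_mem (N.hasKernel hγ))⟩ =
        SymmetricAlgebra.ι ℝ _ (N.form hδ) * (SymmetricAlgebra.ι ℝ _ (N.form hγ) * b) := by
      have : φ ⟨_, hle (hg'.smul_mem (N.hasKernel hγ))⟩ =
          SymmetricAlgebra.ι ℝ _ (N.form hγ) * φ ⟨g', hmem⟩ := by
        rw [← smul_eq_mul, ← map_smul]
        rfl
      rw [this, hb]
      ring
    rw [h2] at h1
    rw [← mul_left_cancel₀ (N.hasKernel hδ).ι_ne_zero h1, map_mul, resPoly_ι,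
      resForm_eq_zero (N.hasKernel hγ), map_zero, zero_mul]

/-- The dual of a perverse sheaf is flabby: compatible homomorphisms on the facets of `σ` are the
images of a homomorphism on `σ`. -/
theorem FormSystem.exists_phi_eq (N : FormSystem Δ) (hF : F.IsPerverse) {σ : Δ.Cone}
    (x : ∀ γ, F.relative γ →ₗ[Poly γ] Poly γ)
    (hx : ∀ {ζ δ₁ δ₂ : Δ.Cone}, IsFacet δ₁ σ → IsFacet δ₂ σ → ∀ (k₁ : IsFacet ζ δ₁)
      (k₂ : IsFacet ζ δ₂), δ₁ ≠ δ₂ →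
        phi hF (N.hasKernel k₁) (x δ₁) = phi hF (N.hasKernel k₂) (x δ₂)) :
    ∃ f : F.relative σ →ₗ[Poly σ] Poly σ,
      ∀ γ, ∀ h : IsFacet γ σ, phi hF (N.hasKernel h) f = x γ := by
  obtain ⟨S, -⟩ := exists_sweep σ (zero_mem (lin σ))
  obtain ⟨c, hc⟩ := S.exists_bound
  obtain ⟨f, hf⟩ := S.induction
    (motive := fun T => ∃ f : F.relative σ →ₗ[Poly σ] Poly σ,
      ∀ γ, ∀ h : IsFacet γ σ, T γ → phi hF (N.hasKernel h) f = x γ)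
    (fun T T' h ⟨y, hy⟩ => ⟨y, fun γ hγ hT => hy γ hγ ((h γ hγ).2 hT)⟩)
    ⟨0, fun _ _ h => h.elim⟩
    (fun δ hδ ⟨f, hf⟩ => by
      obtain ⟨f', hf'δ, hf'⟩ := exists_phi_step N hF S hδ (x δ - phi hF (N.hasKernel hδ) f) (by
        intro ζ hζ hneg
        obtain ⟨δ', h1, h2, hne, h3, -⟩ := S.exists_other hδ hζ
        have hζ' := isFacet_right hδ h1 hζ h2
        rw [map_sub, hx hδ h1 hζ hζ' hne.symm, ← hf δ' h1 (h3.1 hneg),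
          N.phi_comm hF hδ h1 hζ hζ' hne.symm, sub_self])
      refine ⟨f + f', fun γ hγ ht => ?_⟩
      rw [map_add]
      rcases ht.lt_or_eq with ht | ht
      · rw [hf γ hγ ht, hf' γ hγ ht, add_zero]
      · obtain rfl := S.injective hγ hδ ht
        rw [hf'δ, add_sub_cancel]) c
  exact ⟨f, fun γ hγ => hf γ hγ (hc γ)⟩

/-- The dual of a minimal sheaf is minimal: a homomorphism that vanishes on the boundary extends to
all sections, hence takes the relative sections to polynomials without constant term. -/
theorem FormSystem.mem_smul_top (N : FormSystem Δ) (hF : F.IsPerverse) {σ : Δ.Cone}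
    (hmin : F.relative σ ≤ polyIdeal σ • ⊤) (f : F.relative σ →ₗ[Poly σ] Poly σ)
    (hf : ∀ γ, ∀ h : IsFacet γ σ, phi hF (N.hasKernel h) f = 0) :
    f ∈ polyIdeal σ • (⊤ : Submodule (Poly σ) (F.relative σ →ₗ[Poly σ] Poly σ)) := by
  have := hF.projective_relative σ
  have := hF.finite_relative σ
  refine mem_smul_top_of_forall_mem _ f fun x => ?_
  obtain ⟨f', hf'⟩ := hF.exists_extend_hom (fun _ => True) f
    fun γ hγ _ => phi_eq_zero hF (N.hasKernel hγ) _ (hf γ hγ)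
  have hall : ∀ x : F.obj σ, x ∈ F.relOn σ fun _ => ¬ True := fun x γ hγ h => absurd trivial h
  rw [← hf' x.1 x.2 (hall _)]
  let f'' : F.obj σ →ₗ[Poly σ] Poly σ := f' ∘ₗ LinearMap.id.codRestrict _ hall
  have h1 : f'' x.1 ∈ (polyIdeal σ • (⊤ : Submodule (Poly σ) (F.obj σ))).map f'' :=
    Submodule.mem_map_of_mem (hmin x.2)
  rw [Submodule.map_smul''] at h1
  have h2 : (polyIdeal σ • (⊤ : Submodule (Poly σ) (F.obj σ)).map f'') ≤ polyIdeal σ :=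
    Submodule.smul_le.2 fun r hr n _ => Ideal.mul_mem_right _ _ hr
  exact h2 h1

end Fan

/-! ### Determinants and normalized equations of the facets -/

namespace Fan

variable {V : Type u} [AddCommGroup V] [Module ℝ V] {Δ : Fan V}

theorem contract_apply {τ σ : Δ.Cone} (hτ : IsFacet τ σ) (v : lin σ) (ω : Det σ)
    (x : Fin (dim τ) → lin τ) :
    contract hτ v ω x = ω ((Matrix.vecCons v fun i => Submodule.inclusion (lin_mono hτ.1) (x i)) ∘
      finCongr hτ.2) := rfl

theorem contract_smul_left {τ σ : Δ.Cone} (hτ : IsFacet τ σ) (c : ℝ) (v : lin σ) :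
    contract hτ (c • v) = c • contract hτ v := by
  ext ω x
  change ((ω.domDomCongr (finCongr hτ.2)).curryLeft (c • v)) _ =
    c • ((ω.domDomCongr (finCongr hτ.2)).curryLeft v) _
  rw [map_smul]
  rfl

/-- The two contractions of a volume form down to a face of codimension two differ by a sign. -/
theorem contract_contract {ζ δ₁ δ₂ σ : Δ.Cone} (h₁ : IsFacet δ₁ σ) (h₂ : IsFacet δ₂ σ)
    (k₁ : IsFacet ζ δ₁) (k₂ : IsFacet ζ δ₂) (e₁ : lin δ₁) (e₂ : lin δ₂) (ω : Det σ) :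
    contract k₁ e₁ (contract h₁ (Submodule.inclusion (lin_mono h₂.1) e₂) ω) =
      -contract k₂ e₂ (contract h₂ (Submodule.inclusion (lin_mono h₁.1) e₁) ω) := by
  ext x
  have hd : dim σ = dim ζ + 2 := by rw [h₁.2, k₁.2]
  rw [AlternatingMap.neg_apply, contract_apply, contract_apply, contract_apply, contract_apply]
  have hij : Fin.cast hd.symm 0 ≠ Fin.cast hd.symm 1 := by
    intro e
    have := congrArg Fin.val e
    simp at this
  rw [← ω.map_swap _ hij]
  congr 1
  funext i
  obtain ⟨i, rfl⟩ : ∃ j : Fin (dim ζ + 2), i = Fin.cast hd.symm j := ⟨Fin.cast hd i, rfl⟩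
  have c1 : ∀ j : Fin (dim ζ + 1), (finCongr h₁.2) (Fin.cast hd.symm j.succ) =
      (Fin.cast k₁.2.symm j).succ := fun j => rfl
  have c2 : ∀ j : Fin (dim ζ + 1), (finCongr h₂.2) (Fin.cast hd.symm j.succ) =
      (Fin.cast k₂.2.symm j).succ := fun j => rfl
  refine Fin.cases ?_ (fun i => Fin.cases ?_ (fun i => ?_) i) i
  · rw [Function.comp_apply, Function.comp_apply, Equiv.swap_apply_left]
    rfl
  · rw [Function.comp_apply, Function.comp_apply]
    change _ = (_ ∘ _) (Equiv.swap (Fin.cast hd.symm 0) (Fin.cast hd.symm 1) (Fin.cast hd.symm 1))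
    rw [Equiv.swap_apply_right]
    rfl
  · rw [Function.comp_apply, Function.comp_apply, Equiv.swap_apply_of_ne_of_ne]
    · rfl
    · intro e
      have := congrArg Fin.val e
      simp at this
    · intro e
      have := congrArg Fin.val e
      simp at this

/-- A volume form that represents the orientation of `σ`. -/
def volumeForm (o : Orientations Δ) (σ : Δ.Cone) : Det σ := (o σ).someVector

theorem volumeForm_ne_zero (o : Orientations Δ) (σ : Δ.Cone) : volumeForm o σ ≠ 0 :=
  (o σ).someVector_ne_zero

theorem represents_iff (o : Orientations Δ) {σ : Δ.Cone} (ω : Det σ) :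
    Represents ω (o σ) ↔ ω ≠ 0 ∧ SameRay ℝ ω (volumeForm o σ) := by
  have h : rayOfNeZero ℝ (volumeForm o σ) (volumeForm_ne_zero o σ) = o σ := (o σ).someVector_ray
  constructor
  · rintro ⟨h0, hr⟩
    rw [← h, ray_eq_iff] at hr
    exact ⟨h0, hr⟩
  · rintro ⟨h0, hr⟩
    exact ⟨h0, by rw [← h, ray_eq_iff]; exact hr⟩

theorem HasKernel.smul {τ σ : Δ.Cone} {hτ : IsFacet τ σ} {h : Module.Dual ℝ (lin σ)}
    (hh : HasKernel hτ h) {c : ℝ} (hc : c ≠ 0) : HasKernel hτ (c • h) := fun v => by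
  rw [LinearMap.smul_apply, smul_eq_zero, or_iff_right hc, hh v]

theorem HasKernel.exists_pos_smul {τ σ : Δ.Cone} {hτ : IsFacet τ σ} {h h' : Module.Dual ℝ (lin σ)}
    (hh : HasKernel hτ h) (hh' : HasKernel hτ h') (hn : ∀ v : lin σ, (v : V) ∈ σ.1 → h v ≤ 0)
    (hn' : ∀ v : lin σ, (v : V) ∈ σ.1 → h' v ≤ 0) : ∃ c : ℝ, 0 < c ∧ h' = c • h := by
  obtain ⟨c, rfl⟩ := hh.exists_smul hh'
  refine ⟨c, ?_, rfl⟩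
  obtain ⟨y, hy, hyτ⟩ := exists_mem_notMem hτ.lt.not_ge
  let v : lin σ := ⟨y, Submodule.subset_span hy⟩
  have hpos := supportForm_pos hτ.lt hy hyτ
  have hv : (v : V) ∉ lin τ := fun hc => hpos.ne' (supportForm_lin hτ.lt hc)
  have h1 : h v < 0 := lt_of_le_of_ne (hn v hy) fun e => hv ((hh v).1 e)
  have h2 : c * h v < 0 := lt_of_le_of_ne (hn' v hy) fun e => hv ((hh' v).1 e)
  by_contra hc
  exact h2.not_ge (mul_nonneg_of_nonpos_of_nonpos (not_lt.1 hc) h1.le)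

variable [FiniteDimensional ℝ V]

theorem exists_eq_smul_volumeForm (o : Orientations Δ) {σ : Δ.Cone} (ω : Det σ) :
    ∃ c : ℝ, ω = c • volumeForm o σ := by
  let b := Module.finBasisOfFinrankEq ℝ (lin σ) (rfl : _ = dim σ)
  have h0 : volumeForm o σ b ≠ 0 := by
    intro h
    apply volumeForm_ne_zero o σ
    rw [AlternatingMap.eq_smul_basis_det b (volumeForm o σ), h, zero_smul]
  refine ⟨ω b / volumeForm o σ b, ?_⟩
  have h1 := AlternatingMap.eq_smul_basis_det b (volumeForm o σ)
  have h2 := AlternatingMap.eq_smul_basis_det b ω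
  set r := volumeForm o σ b
  rw [h1, smul_smul, div_mul_cancel₀ _ h0, ← h2]

/-- Contraction with a vector outside `V_τ` is injective on volume forms. -/
theorem psi_ne_zero {τ σ : Δ.Cone} {hτ : IsFacet τ σ} {h : Module.Dual ℝ (lin σ)}
    (hh : HasKernel hτ h) {ω : Det σ} (hω : ω ≠ 0) : psi hh ω ≠ 0 := by
  obtain ⟨v, hv⟩ := hh.exists_eq_one
  rw [psi_eq_contract hh hv]
  intro h0
  let b := Module.finBasisOfFinrankEq ℝ (lin τ) (rfl : _ = dim τ)
  let u : Fin (dim τ + 1) → lin σ :=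
    Matrix.vecCons v fun i => Submodule.inclusion (lin_mono hτ.1) (b i)
  have hu : LinearIndependent ℝ u := by
    refine LinearIndependent.finCons (b.linearIndependent.map' _
      (Submodule.ker_inclusion _ _ (lin_mono hτ.1))) fun hc => ?_
    have : Submodule.span ℝ (Set.range fun i => Submodule.inclusion (lin_mono hτ.1) (b i)) ≤
        LinearMap.ker h := by
      rw [Submodule.span_le]
      rintro _ ⟨i, rfl⟩
      exact (hh _).2 (b i).2
    have h1 : h v = 0 := this hc
    rw [hv] at h1
    exact one_ne_zero h1
  have hu' : LinearIndependent ℝ (u ∘ finCongr hτ.2) :=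
    hu.comp _ (finCongr hτ.2).injective
  have : Nonempty (Fin (dim σ)) := ⟨⟨0, by have := hτ.2; omega⟩⟩
  let e := basisOfLinearIndependentOfCardEqFinrank hu' (by rw [Fintype.card_fin]; rfl)
  apply hω
  have h1 : ω e = 0 := by
    rw [coe_basisOfLinearIndependentOfCardEqFinrank]
    exact (contract_apply hτ v ω b).symm.trans (by rw [h0]; rfl)
  rw [AlternatingMap.eq_smul_basis_det e ω, h1, zero_smul]

theorem exists_psi_outward (o : Orientations Δ) {τ σ : Δ.Cone} (hτ : IsFacet τ σ) :
    ∃ c : ℝ, psi (hasKernel_outward hτ) (volumeForm o σ) = c • volumeForm o τ :=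
  exists_eq_smul_volumeForm o _

/-- The ratio of the chosen volume forms on `σ` and on its facet `τ`. -/
def volumeRatio (o : Orientations Δ) {τ σ : Δ.Cone} (hτ : IsFacet τ σ) : ℝ :=
  (exists_psi_outward o hτ).choose

theorem psi_volumeForm (o : Orientations Δ) {τ σ : Δ.Cone} (hτ : IsFacet τ σ) :
    psi (hasKernel_outward hτ) (volumeForm o σ) = volumeRatio o hτ • volumeForm o τ :=
  (exists_psi_outward o hτ).choose_spec

theorem volumeRatio_ne_zero (o : Orientations Δ) {τ σ : Δ.Cone} (hτ : IsFacet τ σ) :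
    volumeRatio o hτ ≠ 0 := fun h => by
  have := psi_ne_zero (hasKernel_outward hτ) (volumeForm_ne_zero o σ)
  rw [psi_volumeForm, h, zero_smul] at this
  exact this rfl

/-- The transition coefficient is the sign of the ratio of the volume forms. -/
theorem transition_mul_volumeRatio (o : Orientations Δ) {τ σ : Δ.Cone} (hτ : IsFacet τ σ) :
    transition o hτ * volumeRatio o hτ = |volumeRatio o hτ| := by
  have h0 := volumeRatio_ne_zero o hτ
  unfold transition
  split_ifs with h
  · obtain ⟨ω, h1, h2⟩ := h
    rw [represents_iff] at h1 h2
    have h3 := h1.2.map (psi (hasKernel_outward hτ))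
    rw [psi_volumeForm] at h3
    have h4 : SameRay ℝ (volumeForm o τ) (volumeRatio o hτ • volumeForm o τ) :=
      h2.2.symm.trans h3 fun e => absurd e h2.1
    rw [sameRay_smul_right_iff_of_ne (volumeForm_ne_zero o τ) h0] at h4
    rw [one_mul, abs_of_pos h4]
  · have hneg : volumeRatio o hτ < 0 := by
      refine lt_of_le_of_ne (not_lt.1 fun hpos => h ⟨volumeForm o σ, ?_, ?_⟩) h0
      · exact (represents_iff o _).2 ⟨volumeForm_ne_zero o σ, SameRay.refl _⟩
      · rw [represents_iff, psi_volumeForm]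
        exact ⟨smul_ne_zero h0 (volumeForm_ne_zero o τ), SameRay.sameRay_pos_smul_left _ hpos⟩
    rw [abs_of_neg hneg, neg_one_mul]

/-- The restriction to a facet `δ₁` of an equation of another facet `δ₂` is an equation of their
intersection, if this has codimension two. -/
theorem hasKernel_resForm {ζ δ₁ δ₂ σ : Δ.Cone} (h₁ : IsFacet δ₁ σ) {h₂ : IsFacet δ₂ σ}
    (k₁ : IsFacet ζ δ₁) (hζ : ζ ≤ δ₂) (hne : δ₁ ≠ δ₂) {h : Module.Dual ℝ (lin σ)}
    (hh : HasKernel h₂ h) : HasKernel k₁ (resForm h₁.1 h) := fun v => by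
  obtain ⟨c, hc, e⟩ := exists_supportForm_restrict h₁ h₂ hne k₁ hζ
  have h1 : resForm h₁.1 h v = 0 ↔ (v : V) ∈ lin δ₂ := hh _
  have h2 : supportForm δ₂ σ v = 0 ↔ (v : V) ∈ lin δ₂ :=
    hasKernel_facetForm h₂ (Submodule.inclusion (lin_mono h₁.1) v)
  rw [h1, ← h2, e v v.2, mul_eq_zero, or_iff_right hc.ne']
  exact hasKernel_facetForm k₁ v

/-- The equation of the facet `τ` of `σ`, nonpositive on `σ`, for which the contraction of volume
forms preserves the chosen volume forms up to sign. -/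
def normalForm (o : Orientations Δ) {τ σ : Δ.Cone} (hτ : IsFacet τ σ) : Module.Dual ℝ (lin σ) :=
  |volumeRatio o hτ| • outward hτ

theorem hasKernel_normalForm (o : Orientations Δ) {τ σ : Δ.Cone} (hτ : IsFacet τ σ) :
    HasKernel hτ (normalForm o hτ) :=
  (hasKernel_outward hτ).smul (abs_ne_zero.2 (volumeRatio_ne_zero o hτ))

theorem normalForm_nonpos (o : Orientations Δ) {τ σ : Δ.Cone} (hτ : IsFacet τ σ) (v : lin σ)
    (hv : (v : V) ∈ σ.1) : normalForm o hτ v ≤ 0 :=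
  mul_nonpos_of_nonneg_of_nonpos (abs_nonneg _) ((exists_outward hτ).choose_spec.2 v hv)

theorem psi_normalForm (o : Orientations Δ) {τ σ : Δ.Cone} (hτ : IsFacet τ σ) :
    ∃ s : ℝ, |s| = 1 ∧ psi (hasKernel_normalForm o hτ) (volumeForm o σ) = s • volumeForm o τ := by
  have h0 := volumeRatio_ne_zero o hτ
  refine ⟨|volumeRatio o hτ|⁻¹ * volumeRatio o hτ, ?_, ?_⟩
  · rw [abs_mul, abs_inv, abs_abs, inv_mul_cancel₀ (abs_ne_zero.2 h0)]
  · have h := psi_smul (hasKernel_outward hτ) (hasKernel_normalForm o hτ)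
    change psi (hasKernel_normalForm o hτ) = _ at h
    rw [h, LinearMap.smul_apply, psi_volumeForm, smul_smul]

/-- The normalized equations of the facets. -/
def normalSystem (o : Orientations Δ) : FormSystem Δ where
  form := normalForm o
  hasKernel := hasKernel_normalForm o
  diamond := by
    intro ζ δ₁ δ₂ σ h₁ h₂ k₁ k₂ hne
    have r₁ : HasKernel k₁ (resForm h₁.1 (normalForm o h₂)) :=
      hasKernel_resForm h₁ k₁ k₂.1 hne (hasKernel_normalForm o h₂)
    have r₂ : HasKernel k₂ (resForm h₂.1 (normalForm o h₁)) :=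
      hasKernel_resForm h₂ k₂ k₁.1 hne.symm (hasKernel_normalForm o h₁)
    obtain ⟨a, ha, ea⟩ := r₁.exists_pos_smul (hasKernel_normalForm o k₁)
      (fun v hv => normalForm_nonpos o h₂ _ (h₁.1 hv)) (normalForm_nonpos o k₁)
    obtain ⟨b, hb, eb⟩ := r₂.exists_pos_smul (hasKernel_normalForm o k₂)
      (fun v hv => normalForm_nonpos o h₁ _ (h₂.1 hv)) (normalForm_nonpos o k₂)
    -- compare the two contractions of the volume form of `σ`
    obtain ⟨e₁, he₁⟩ := r₁.exists_eq_one
    obtain ⟨e₂, he₂⟩ := r₂.exists_eq_one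
    obtain ⟨s₁, hs₁, p₁⟩ := psi_normalForm o h₁
    obtain ⟨s₂, hs₂, p₂⟩ := psi_normalForm o h₂
    obtain ⟨t₁, ht₁, q₁⟩ := psi_normalForm o k₁
    obtain ⟨t₂, ht₂, q₂⟩ := psi_normalForm o k₂
    rw [psi_eq_contract (hasKernel_normalForm o h₁) he₂] at p₁
    rw [psi_eq_contract (hasKernel_normalForm o h₂) he₁] at p₂
    have n₁ : normalForm o k₁ (a⁻¹ • e₁) = 1 := by
      rw [ea, LinearMap.smul_apply, map_smul, he₁, smul_smul, mul_inv_cancel₀ ha.ne', one_smul]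
    have n₂ : normalForm o k₂ (b⁻¹ • e₂) = 1 := by
      rw [eb, LinearMap.smul_apply, map_smul, he₂, smul_smul, mul_inv_cancel₀ hb.ne', one_smul]
    rw [psi_eq_contract (hasKernel_normalForm o k₁) n₁, contract_smul_left,
      LinearMap.smul_apply, inv_smul_eq_iff₀ ha.ne'] at q₁
    rw [psi_eq_contract (hasKernel_normalForm o k₂) n₂, contract_smul_left,
      LinearMap.smul_apply, inv_smul_eq_iff₀ hb.ne'] at q₂
    have key := contract_contract h₁ h₂ k₁ k₂ e₁ e₂ (volumeForm o σ)
    rw [show contract h₁ _ (volumeForm o σ) = _ from p₁,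
      show contract h₂ _ (volumeForm o σ) = _ from p₂, map_smul, map_smul, q₁, q₂, smul_smul,
      smul_smul, smul_smul, smul_smul, ← neg_smul] at key
    have hab := smul_left_injective ℝ (volumeForm_ne_zero o ζ) key
    have hab' := congrArg abs hab
    simp only [abs_neg, abs_mul, hs₁, hs₂, ht₁, ht₂, abs_of_pos ha, abs_of_pos hb, mul_one,
      one_mul] at hab'
    exact ⟨a, ea, hab' ▸ eb⟩

/-- In terms of the chosen volume forms, the restriction maps of the dual sheaf are the maps `φ`
for the normalized equations. -/
theorem transition_smul_dualFacetMap {F : Sheaf Δ} (hF : F.IsPerverse) (o : Orientations Δ)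
    {τ σ : Δ.Cone} (hτ : IsFacet τ σ) (f : F.relative σ →ₗ[Poly σ] Poly σ) :
    (transition o hτ • dualFacetMap hF hτ) (f ⊗ₜ volumeForm o σ) =
      phi hF ((normalSystem o).hasKernel hτ) f ⊗ₜ volumeForm o τ := by
  have h : phi hF ((normalSystem o).hasKernel hτ) =
      |volumeRatio o hτ| • phi hF (hasKernel_outward hτ) :=
    phi_smul hF (hasKernel_outward hτ) (hasKernel_normalForm o hτ)
  rw [LinearMap.smul_apply, dualFacetMap, TensorProduct.map_tmul, psi_volumeForm,
    TensorProduct.tmul_smul, smul_smul, transition_mul_volumeRatio, h, LinearMap.smul_apply,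
    TensorProduct.smul_tmul']

end Fan

/-! ### Simple sheaves are perverse -/

namespace Fan

variable {V : Type u} [AddCommGroup V] [Module ℝ V] {Δ : Fan V}

theorem Sheaf.res_gradedComp (F : Sheaf Δ) {τ σ : Δ.Cone} (h : τ ≤ σ) (q : ℤ) (x : F.obj σ) :
    F.res h (gradedComp (F.isInternal σ) q x) = gradedComp (F.isInternal τ) q (F.res h x) := by
  have := map_gradedComp (F.isInternal σ) (F.isInternal τ) 0 (F.res h)
    (fun q x hx => by rw [add_zero]; exact F.res_mem h hx) q x
  rwa [add_zero] at this

/-- The homogeneous components of a compatible family. -/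
def Sheaf.boundaryComp (F : Sheaf Δ) (σ : Δ.Cone) (q : ℤ) (x : F.Boundary σ) : F.Boundary σ :=
  ⟨fun γ => gradedComp (F.isInternal γ.1) q (x.1 γ), fun γ δ h => by
    rw [F.res_gradedComp, x.2 γ δ h]⟩

theorem Sheaf.isInternal_boundaryDeg (F : Sheaf Δ) (σ : Δ.Cone) :
    DirectSum.IsInternal (F.boundaryDeg σ) := by
  classical
  refine isInternal_of_separating
    (fun k : {γ : Δ.Cone // γ < σ} × ℤ => gradedComp (F.isInternal k.1.1) k.2 ∘ₗ
      LinearMap.proj k.1 ∘ₗ (F.Boundary σ).subtype) (fun k => k.2)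
    (fun k q x hx hq => gradedComp_of_ne _ (hx k.1) hq.symm)
    (fun x hx => Subtype.ext (funext fun γ => eq_zero_of_gradedComp (F.isInternal γ.1)
      fun q => hx (γ, q))) fun x => ?_
  have := Fintype.ofFinite {γ : Δ.Cone // γ < σ}
  choose s hs using fun γ : {γ : Δ.Cone // γ < σ} =>
    exists_eq_sum_gradedComp (F.isInternal γ.1) (x.1 γ)
  have h : x = ∑ q ∈ Finset.univ.biUnion s, F.boundaryComp σ q x := by
    refine Subtype.ext (funext fun γ => ?_)
    rw [AddSubmonoidClass.coe_finsetSum, Finset.sum_apply]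
    exact hs γ _ (Finset.subset_biUnion_of_mem s (Finset.mem_univ γ))
  rw [h]
  exact Submodule.sum_mem _ fun q _ => Submodule.mem_iSup_of_mem q
    fun γ => gradedComp_mem (F.isInternal γ.1) q (x.1 γ)

theorem Sheaf.isGradedModule_boundary (F : Sheaf Δ) (σ : Δ.Cone) :
    IsGradedModule (polyDeg σ) (F.boundaryDeg σ) where
  alg := isInternal_polyDeg σ
  isInternal := F.isInternal_boundaryDeg σ
  smul_mem := fun hc hx γ => F.smul_mem (resPoly_mem _ hc) (hx γ)

theorem Sheaf.resBoundary_mem (F : Sheaf Δ) {σ : Δ.Cone} {q : ℤ} {x : F.obj σ}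
    (hx : x ∈ F.deg σ q) : F.resBoundary σ x ∈ F.boundaryDeg σ q :=
  fun γ => F.res_mem γ.2.le hx

theorem Sheaf.resBoundary_gradedComp (F : Sheaf Δ) (σ : Δ.Cone) (q : ℤ) (x : F.obj σ) :
    F.resBoundary σ (gradedComp (F.isInternal σ) q x) =
      gradedComp (F.isInternal_boundaryDeg σ) q (F.resBoundary σ x) := by
  have := map_gradedComp (F.isInternal σ) (F.isInternal_boundaryDeg σ) 0
    ((F.resBoundary σ).restrictScalars ℝ)
    (fun q x hx => by rw [add_zero]; exact F.resBoundary_mem hx) q x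
  rwa [add_zero] at this

theorem Sheaf.reduction_eq_zero_iff (F : Sheaf Δ) (σ : Δ.Cone) (x : F.Boundary σ) :
    F.reduction σ x = 0 ↔ x ∈ polyIdeal σ • (⊤ : Submodule (Poly σ) (F.Boundary σ)) :=
  Submodule.Quotient.mk_eq_zero _

theorem Sheaf.reduction_surjective (F : Sheaf Δ) (σ : Δ.Cone) :
    Function.Surjective (F.reduction σ) :=
  Submodule.mkQ_surjective (polyIdeal σ • (⊤ : Submodule (Poly σ) (F.Boundary σ)))

theorem Sheaf.reduction_smul (F : Sheaf Δ) (σ : Δ.Cone) (a : Poly σ) (x : F.Boundary σ) :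
    F.reduction σ (a • x) = a • F.reduction σ x :=
  map_smul (Submodule.mkQ (polyIdeal σ • (⊤ : Submodule (Poly σ) (F.Boundary σ)))) a x

/-- The polynomials act on `F_{∂σ} / 𝔪 F_{∂σ}` through their constant terms. -/
theorem Sheaf.exists_smul_eq_smul (F : Sheaf Δ) (σ : Δ.Cone) (a : Poly σ) :
    ∃ r : ℝ, a - algebraMap ℝ (Poly σ) r ∈ polyIdeal σ ∧
      ∀ w : F.ReducedBoundary σ, a • w = r • w := by
  obtain ⟨r, hr⟩ := exists_sub_algebraMap_mem σ a
  refine ⟨r, hr, fun w => ?_⟩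
  obtain ⟨b, rfl⟩ := F.reduction_surjective σ w
  have h1 : F.reduction σ ((a - algebraMap ℝ (Poly σ) r) • b) = 0 :=
    (F.reduction_eq_zero_iff σ _).2 (Submodule.smul_mem_smul hr trivial)
  have h2 : (a - algebraMap ℝ (Poly σ) r) • b = a • b - r • b := by
    have := sub_smul a (algebraMap ℝ (Poly σ) r) b
    rwa [algebraMap_smul] at this
  rw [h2, map_sub, F.reduction_smul, map_smul] at h1
  exact sub_eq_zero.1 h1

/-- Let the ring `A` be spanned by the ideal `I` and the constants. Then `A ⊗ W` is spanned by
`I (A ⊗ W)` and `W`. -/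
theorem exists_sub_one_tmul_mem {A W : Type*} [CommRing A] [Algebra ℝ A] [AddCommGroup W]
    [Module ℝ W] (I : Ideal A) (hI : ∀ a : A, ∃ r : ℝ, a - algebraMap ℝ A r ∈ I) (t : A ⊗[ℝ] W) :
    ∃ w : W, t - (1 : A) ⊗ₜ[ℝ] w ∈ I • (⊤ : Submodule A (A ⊗[ℝ] W)) := by
  induction t using TensorProduct.induction_on with
  | zero => exact ⟨0, by simp⟩
  | add x y hx hy =>
    obtain ⟨v, hv⟩ := hx
    obtain ⟨w, hw⟩ := hy
    refine ⟨v + w, ?_⟩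
    rw [TensorProduct.tmul_add, add_sub_add_comm]
    exact add_mem hv hw
  | tmul a w =>
    obtain ⟨r, hr⟩ := hI a
    refine ⟨r • w, ?_⟩
    have : (a - algebraMap ℝ A r) • ((1 : A) ⊗ₜ[ℝ] w) = a ⊗ₜ[ℝ] w - (1 : A) ⊗ₜ[ℝ] (r • w) := by
      rw [TensorProduct.smul_tmul', smul_eq_mul, mul_one, TensorProduct.sub_tmul,
        Algebra.algebraMap_eq_smul_one, TensorProduct.smul_tmul]
    rw [← this]
    exact Submodule.smul_mem_smul hr trivial

theorem Sheaf.finite_reducedBoundary (F : Sheaf Δ) (τ : Δ.Cone)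
    [Module.Finite (Poly τ) (F.Boundary τ)] : Module.Finite ℝ (F.ReducedBoundary τ) := by
  obtain ⟨G, hG⟩ := Module.Finite.fg_top (R := Poly τ) (M := F.ReducedBoundary τ)
  refine ⟨G, eq_top_iff.2 fun x _ => ?_⟩
  have hx : x ∈ Submodule.span (Poly τ) (G : Set (F.ReducedBoundary τ)) :=
    hG ▸ Submodule.mem_top
  induction hx using Submodule.span_induction with
  | mem x hx => exact Submodule.subset_span hx
  | zero => exact zero_mem _
  | add x y _ _ hx hy => exact add_mem (hx trivial) (hy trivial)
  | smul a x _ hx =>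
    obtain ⟨r, -, hr⟩ := F.exists_smul_eq_smul τ a
    rw [hr]
    exact Submodule.smul_mem _ r (hx trivial)

theorem map_mem_smul_top {A M N : Type*} [CommRing A] [AddCommGroup M] [AddCommGroup N] [Module A M]
    [Module A N] (I : Ideal A) (f : M →ₗ[A] N) {x : M} (hx : x ∈ I • (⊤ : Submodule A M)) :
    f x ∈ I • (⊤ : Submodule A N) := by
  have h := Submodule.mem_map_of_mem (f := f) hx
  rw [Submodule.map_smul''] at h
  exact Submodule.smul_mono le_rfl le_top h

section Restrict

variable {A B M : Type*} [CommRing A] [CommRing B] [AddCommGroup M] [Module B M]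

/-- Restriction of scalars along a surjection preserves finite generation. -/
theorem finite_compHom (f : A →+* B) (hf : Function.Surjective f) [Module.Finite B M] :
    @Module.Finite A M _ _ (Module.compHom M f) := by
  let _ := Module.compHom M f
  obtain ⟨G, hG⟩ := Module.Finite.fg_top (R := B) (M := M)
  refine ⟨G, eq_top_iff.2 fun x _ => ?_⟩
  have hx : x ∈ Submodule.span B (G : Set M) := hG ▸ Submodule.mem_top
  induction hx using Submodule.span_induction with
  | mem x hx => exact Submodule.subset_span hx
  | zero => exact zero_mem _
  | add x y _ _ hx hy => exact add_mem (hx trivial) (hy trivial)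
  | smul b x _ hx =>
    obtain ⟨a, rfl⟩ := hf b
    exact Submodule.smul_mem _ a (hx trivial)

end Restrict

/-- A simple sheaf is minimal: the relative sections lie in `𝔪 F_τ`. -/
theorem Sheaf.IsSimple.relative_le {F : Sheaf Δ} {σ : Δ.Cone} (hF : F.IsSimple σ)
    {τ : Δ.Cone} (hd : dim σ < dim τ) :
    F.relative τ ≤ polyIdeal τ • (⊤ : Submodule (Poly τ) (F.obj τ)) := by
  obtain ⟨s, hs, -, e, -, he⟩ := hF.extend τ hd
  intro x hx
  obtain ⟨w, hw⟩ := exists_sub_one_tmul_mem (polyIdeal τ) (exists_sub_algebraMap_mem τ) (e.symm x)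
  have h1 := map_mem_smul_top (polyIdeal τ) e.toLinearMap hw
  rw [LinearEquiv.coe_coe, map_sub, e.apply_symm_apply] at h1
  have h3 := map_mem_smul_top (polyIdeal τ) (F.resBoundary τ) h1
  rw [map_sub, he, one_smul, LinearMap.mem_ker.1 hx, zero_sub, Submodule.neg_mem_iff] at h3
  -- the constant part of `x` restricts to a representative of its own class in the reduction
  have h4 : w = 0 := by rw [← hs w, (F.reduction_eq_zero_iff τ _).2 h3]
  rwa [h4, TensorProduct.tmul_zero, map_zero, sub_zero] at h1

variable [FiniteDimensional ℝ V]

/-- Since `A_σ` is noetherian, the submodule of compatible families in the product of the `F_γ` is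
finitely generated. -/
theorem Sheaf.finite_boundary (F : Sheaf Δ) (σ : Δ.Cone)
    (h : ∀ γ < σ, Module.Finite (Poly γ) (F.obj γ)) : Module.Finite (Poly σ) (F.Boundary σ) := by
  let _ : ∀ γ : {γ : Δ.Cone // γ < σ}, Module (Poly σ) (F.obj γ.1) := fun γ =>
    Module.compHom _ (resPoly γ.2.le).toRingHom
  have hfin : ∀ γ : {γ : Δ.Cone // γ < σ}, Module.Finite (Poly σ) (F.obj γ.1) := fun γ => by
    have := h γ.1 γ.2
    exact finite_compHom (resPoly γ.2.le).toRingHom (resPoly_surjective γ.2.le)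
  let i : F.Boundary σ →ₗ[Poly σ] ∀ γ : {γ : Δ.Cone // γ < σ}, F.obj γ.1 :=
    { toFun := fun x => x.1
      map_add' := fun _ _ => rfl
      map_smul' := fun _ _ => rfl }
  exact Module.Finite.of_injective i fun x y hxy => Subtype.ext hxy

variable {F : Sheaf Δ} {σ : Δ.Cone}

theorem Sheaf.IsSimple.subsingleton_of_lt (hF : F.IsSimple σ) {γ τ : Δ.Cone} (h : γ < τ)
    (hd : dim τ ≤ dim σ) : Subsingleton (F.obj γ) :=
  hF.eq_zero γ ((dim_lt h).le.trans hd) fun e => by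
    subst e
    exact (dim_lt h).not_ge hd

theorem Sheaf.IsSimple.finite_free (hF : F.IsSimple σ) (τ : Δ.Cone) :
    Module.Finite (Poly τ) (F.obj τ) ∧ Module.Free (Poly τ) (F.obj τ) := by
  induction hn : dim τ using Nat.strong_induction_on generalizing τ with
  | _ n ih =>
    rcases le_or_gt (dim τ) (dim σ) with hd | hd
    · by_cases e : τ = σ
      · subst e
        obtain ⟨e, -⟩ := hF.self
        exact ⟨Module.Finite.equiv e, Module.Free.of_equiv e⟩
      · have := hF.eq_zero τ hd e
        exact ⟨inferInstance, inferInstance⟩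
    · have hB := F.finite_boundary τ fun γ hγ => (ih (dim γ) (hn ▸ dim_lt hγ) γ rfl).1
      have hW := F.finite_reducedBoundary τ
      obtain ⟨s, -, -, e, -, -⟩ := hF.extend τ hd
      exact ⟨Module.Finite.equiv e, Module.Free.of_equiv e⟩

/-- The image of `L_τ` generates `L_{∂τ}` modulo `𝔪`, so that the restriction map is surjective by
graded Nakayama. -/
theorem Sheaf.IsSimple.isPerverse (hF : F.IsSimple σ) : F.IsPerverse where
  finite τ := (hF.finite_free τ).1
  free τ := (hF.finite_free τ).2
  flabby τ := by
    rcases le_or_gt (dim τ) (dim σ) with hd | hd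
    · intro x
      refine ⟨0, Subtype.ext (funext fun γ => ?_)⟩
      have := hF.subsingleton_of_lt γ.2 hd
      exact Subsingleton.elim _ _
    · obtain ⟨s, hs, -, e, -, he⟩ := hF.extend τ hd
      have := F.finite_boundary τ fun γ _ => (hF.finite_free γ).1
      rw [← LinearMap.range_eq_top]
      refine graded_nakayama (F.isGradedModule_boundary τ) (polyDeg_of_neg τ) _ ?_ ?_
      · rintro q _ ⟨y, rfl⟩
        exact ⟨gradedComp (F.isInternal τ) q y, F.resBoundary_gradedComp τ q y⟩
      · refine eq_top_iff.2 fun b _ => ?_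
        have h1 : b - s (F.reduction τ b) ∈
            polyIdeal τ • (⊤ : Submodule (Poly τ) (F.Boundary τ)) := by
          rw [← F.reduction_eq_zero_iff, map_sub, hs, sub_self]
        have h2 : s (F.reduction τ b) ∈ LinearMap.range (F.resBoundary τ) :=
          ⟨e (1 ⊗ₜ F.reduction τ b), by rw [he, one_smul]⟩
        rw [← sub_add_cancel b (s (F.reduction τ b)), add_comm]
        exact Submodule.add_mem_sup h2 h1

end Fan

/-! ### Duality on the level of homomorphisms -/

section Nakayama

variable {A M N : Type*} [CommRing A] [Algebra ℝ A] [AddCommGroup M] [Module ℝ M] [Module A M]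
  [IsScalarTower ℝ A M] [AddCommGroup N] [Module ℝ N] [Module A N] [IsScalarTower ℝ A N]
  {a : ℤ → Submodule ℝ A} {d : ℤ → Submodule ℝ M} {e : ℤ → Submodule ℝ N}

theorem surjective_of_graded_nakayama [Module.Finite A N] (hd : IsGradedModule a d)
    (he : IsGradedModule a e) (ha : ∀ q < 0, a q = ⊥) (s : ℤ) (f : M →ₗ[A] N)
    (hf : ∀ q, ∀ x ∈ d q, f x ∈ e (q + s))
    (h : ∀ y, ∃ x, f x - y ∈ Ideal.span {c | ∃ q : ℤ, 0 < q ∧ c ∈ a q} • (⊤ : Submodule A N)) :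
    Function.Surjective f := by
  rw [← LinearMap.range_eq_top]
  refine graded_nakayama he ha _ ?_ (eq_top_iff.2 fun y _ => ?_)
  · rintro q _ ⟨x, rfl⟩
    refine ⟨gradedComp hd.isInternal (q - s) x, ?_⟩
    have := map_gradedComp hd.isInternal he.isInternal s (f.restrictScalars ℝ) hf (q - s) x
    rwa [sub_add_cancel] at this
  · obtain ⟨x, hx⟩ := h y
    have := Submodule.sub_mem_sup (LinearMap.mem_range_self f x) hx
    rwa [sub_sub_cancel] at this

/-- Homogeneous maps that are inverse to each other modulo `𝔪` are bijective. -/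
theorem bijective_of_graded_nakayama [Module.Finite A M] [Module.Finite A N]
    (hd : IsGradedModule a d) (he : IsGradedModule a e) (ha : ∀ q < 0, a q = ⊥) (s : ℤ)
    (f : M →ₗ[A] N) (hf : ∀ q, ∀ x ∈ d q, f x ∈ e (q + s))
    (g : N →ₗ[A] M) (hg : ∀ q, ∀ y ∈ e q, g y ∈ d (q + -s))
    (hfg : ∀ y, f (g y) - y ∈
      Ideal.span {c | ∃ q : ℤ, 0 < q ∧ c ∈ a q} • (⊤ : Submodule A N))
    (hgf : ∀ x, g (f x) - x ∈
      Ideal.span {c | ∃ q : ℤ, 0 < q ∧ c ∈ a q} • (⊤ : Submodule A M)) :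
    Function.Bijective f := by
  have h1 := surjective_of_graded_nakayama hd he ha s f hf fun y => ⟨g y, hfg y⟩
  have h2 := surjective_of_graded_nakayama he hd ha (-s) g hg fun x => ⟨f x, hgf x⟩
  have h3 : Function.Injective (g ∘ₗ f) :=
    OrzechProperty.injective_of_surjective_endomorphism (g ∘ₗ f) (h2.comp h1)
  exact ⟨Function.Injective.of_comp h3, h1⟩

end Nakayama

namespace Fan

variable {V : Type u} [AddCommGroup V] [Module ℝ V] {Δ : Fan V}

instance (F : Sheaf Δ) (σ : Δ.Cone) : IsScalarTower ℝ (Poly σ) (F.relative σ) :=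
  ⟨fun r a x => Subtype.ext (smul_assoc r a x.1)⟩

theorem Sheaf.isGradedModule_relative (F : Sheaf Δ) (σ : Δ.Cone) :
    IsGradedModule (M := F.relative σ) (polyDeg σ)
      (fun q => (F.deg σ q).comap ((F.relative σ).subtype.restrictScalars ℝ)) where
  alg := isInternal_polyDeg σ
  isInternal := isInternal_comap (F.isInternal σ) ((F.relative σ).restrictScalars ℝ)
    fun q x hx => by
      rw [Submodule.restrictScalars_mem, F.mem_relative] at hx ⊢
      intro γ hγ
      rw [F.res_gradedComp, hx γ hγ, map_zero]
  smul_mem := fun hc hx => F.smul_mem hc hx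

variable [FiniteDimensional ℝ V]

theorem Sheaf.IsPerverse.isGradedModule_hom {F : Sheaf Δ} (hF : F.IsPerverse) (σ : Δ.Cone) :
    IsGradedModule (polyDeg σ) (homDeg F σ) where
  alg := isInternal_polyDeg σ
  isInternal := by
    have := hF.finite_relative σ
    exact isInternal_hom (F.isGradedModule_relative σ) (isGradedModule_poly σ) _
      fun q f => ⟨fun h i x hx => h i x hx, fun h i x hx => h i x hx⟩
  smul_mem := fun {i j c f} hc hf k x hx => by
    have := mul_mem_polyDeg hc (hf k x hx)
    rwa [add_left_comm] at this

/-- The map `φ_h` raises degrees by two, the degree of `h`. -/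
theorem phi_mem_homDeg {F : Sheaf Δ} (hF : F.IsPerverse) {τ σ : Δ.Cone} {hτ : IsFacet τ σ}
    {h : Module.Dual ℝ (lin σ)} (hh : HasKernel hτ h) {q : ℤ}
    {f : F.relative σ →ₗ[Poly σ] Poly σ} (hf : f ∈ homDeg F σ q) :
    phi hF hh f ∈ homDeg F τ (q + 2) := by
  intro i g hg
  obtain ⟨g', hg'⟩ := hF.exists_isExtension hτ g
  -- the component of degree `i` of an extension is an extension
  have hext : F.IsExtension hτ g.1 (gradedComp (F.isInternal σ) i g') :=
    ⟨by rw [F.res_gradedComp, hg'.1, gradedComp_of_mem _ hg], fun γ hγ hne => by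
      rw [F.res_gradedComp, hg'.2 γ hγ hne, map_zero]⟩
  rw [phi_apply hF hh f g hext]
  have h1 := hf (2 + i) ⟨_, hext.smul_mem hh⟩
    (F.smul_mem (ι_mem_polyDeg σ h) (gradedComp_mem (F.isInternal σ) i g'))
  have h2 := resPoly_mem hτ.1 h1
  rwa [show 2 + i + q = i + (q + 2) by ring] at h2

theorem phi_gradedComp {F : Sheaf Δ} (hF : F.IsPerverse) {τ σ : Δ.Cone} {hτ : IsFacet τ σ}
    {h : Module.Dual ℝ (lin σ)} (hh : HasKernel hτ h) (q : ℤ)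
    (f : F.relative σ →ₗ[Poly σ] Poly σ) :
    phi hF hh (gradedComp (hF.isGradedModule_hom σ).isInternal q f) =
      gradedComp (hF.isGradedModule_hom τ).isInternal (q + 2) (phi hF hh f) :=
  map_gradedComp _ _ 2 (phi hF hh) (fun _ _ hf => phi_mem_homDeg hF hh hf) q f

variable {L : Sheaf Δ} {σ : Δ.Cone}

/-- `t` is a homogeneous isomorphism of the dual at `τ`, without the determinant, with `L_τ`, up to
a shift of the degree, and its restrictions to the facets of `τ` are given by `θ`. -/
structure FormSystem.IsDuality (N : FormSystem Δ) (hL : L.IsPerverse) (σ : Δ.Cone)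
    (θ : ∀ γ, (L.relative γ →ₗ[Poly γ] Poly γ) →ₗ[Poly γ] L.obj γ) (τ : Δ.Cone)
    (t : (L.relative τ →ₗ[Poly τ] Poly τ) →ₗ[Poly τ] L.obj τ) : Prop where
  bijective : Function.Bijective t
  mem_deg : ∀ q, ∀ f ∈ homDeg L τ q, t f ∈ L.deg τ (q + (2 * dim τ - 2 * dim σ))
  res : ∀ γ, ∀ h : IsFacet γ τ, ∀ f, L.res h.1 (t f) = θ γ (phi hL (N.hasKernel h) f)

/-- The isomorphisms `θ` on the cones of smaller dimension extend to `τ`: lift them and their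
inverses to maps `t` and `t'` at `τ`. By minimality these are inverse to each other modulo `𝔪`. -/
theorem FormSystem.exists_isDuality_step (N : FormSystem Δ) (hs : L.IsSimple σ)
    (hL : L.IsPerverse) (θ : ∀ γ, (L.relative γ →ₗ[Poly γ] Poly γ) →ₗ[Poly γ] L.obj γ)
    (τ : Δ.Cone) (hd : dim σ < dim τ) (hθ : ∀ γ, dim γ < dim τ → N.IsDuality hL σ θ γ (θ γ)) :
    ∃ t, N.IsDuality hL σ θ τ t := by
  have := hL.projective_relative τ
  have := hL.finite_relative τ
  have := hL.free τ
  have := hL.finite τ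
  have hH := hL.isGradedModule_hom τ
  have hM := L.isGradedModule τ
  have hmin := hs.relative_le hd
  -- the pairs with the same boundary values
  let C : Submodule (Poly τ) ((L.relative τ →ₗ[Poly τ] Poly τ) × L.obj τ) :=
    { carrier := {z | ∀ γ, ∀ h : IsFacet γ τ, L.res h.1 z.2 = θ γ (phi hL (N.hasKernel h) z.1)}
      add_mem' := fun hx hy γ h => by
        rw [Prod.snd_add, map_add, hx γ h, hy γ h, ← map_add, ← map_add]; rfl
      zero_mem' := fun γ h => by simp
      smul_mem' := fun c z hz γ h => by
        rw [Prod.smul_snd, L.res_smul, hz γ h, ← map_smul, Prod.smul_fst, phi_mul_smul] }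
  have hcomp : ∀ z ∈ C, ∀ j q : ℤ, q = j + (2 * dim τ - 2 * dim σ) →
      (gradedComp hH.isInternal j z.1, gradedComp hM.isInternal q z.2) ∈ C := by
    rintro z hz j _ rfl γ h
    have h1 := map_gradedComp (hL.isGradedModule_hom γ).isInternal (L.isInternal γ) _
      ((θ γ).restrictScalars ℝ) (hθ γ (dim_lt h.lt)).mem_deg (j + 2) (phi hL (N.hasKernel h) z.1)
    rw [L.res_gradedComp, hz γ h, phi_gradedComp]
    refine Eq.trans ?_ h1.symm
    congr 2
    have := h.2
    push_cast [this]
    ring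
  -- `L` is flabby, and so is its dual
  have hC₁ : ∀ f, ∃ y, (f, y) ∈ C := by
    intro f
    classical
    obtain ⟨y, hy⟩ := hL.exists_res_eq (σ := τ)
      (fun γ => if h : IsFacet γ τ then θ γ (phi hL (N.hasKernel h) f) else 0) (by
        intro ζ δ₁ δ₂ h₁ h₂ k₁ k₂ hne
        simp only [h₁, h₂, dif_pos]
        rw [(hθ δ₁ (dim_lt h₁.lt)).res, (hθ δ₂ (dim_lt h₂.lt)).res,
          N.phi_comm hL h₁ h₂ k₁ k₂ hne]
        exact k₁)
    exact ⟨y, fun γ h => by have := hy γ h; rwa [dif_pos h] at this⟩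
  have hC₂ : ∀ y, ∃ f, (f, y) ∈ C := by
    intro y
    classical
    have hinv : ∀ γ, ∀ h : IsFacet γ τ, ∃ g, θ γ g = L.res h.1 y := fun γ h =>
      (hθ γ (dim_lt h.lt)).bijective.2 _
    choose g hg using hinv
    obtain ⟨f, hf⟩ := N.exists_phi_eq hL (σ := τ)
      (fun γ => if h : IsFacet γ τ then g γ h else 0) (by
        intro ζ δ₁ δ₂ h₁ h₂ k₁ k₂ hne
        simp only [h₁, h₂, dif_pos]
        apply (hθ ζ ((dim_lt k₁.lt).trans (dim_lt h₁.lt))).bijective.1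
        rw [← (hθ δ₁ (dim_lt h₁.lt)).res, ← (hθ δ₂ (dim_lt h₂.lt)).res, hg, hg, L.res_res,
          L.res_res])
    refine ⟨f, fun γ h => ?_⟩
    have := hf γ h
    rw [dif_pos h] at this
    rw [this, hg]
  obtain ⟨t, ht, ht'⟩ := exists_graded_lift hH hM (2 * dim τ - 2 * dim σ) C
    (fun q z hz => hcomp z hz q _ rfl) hC₁
  let C' : Submodule (Poly τ) (L.obj τ × (L.relative τ →ₗ[Poly τ] Poly τ)) :=
    C.comap (LinearEquiv.prodComm (Poly τ) _ _).toLinearMap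
  obtain ⟨t', hu, hdeg⟩ := exists_graded_lift hM hH (-(2 * dim τ - 2 * dim σ)) C'
    (fun q z hz => hcomp (z.2, z.1) hz _ _ (by ring)) hC₂
  have hu' : ∀ y γ, ∀ h : IsFacet γ τ, L.res h.1 y = θ γ (phi hL (N.hasKernel h) (t' y)) :=
    fun y γ h => hu y γ h
  refine ⟨t, bijective_of_graded_nakayama hH hM (polyDeg_of_neg τ) _ t ht' t' hdeg (fun y => ?_)
    fun f => ?_, ht', fun γ h f => ht f γ h⟩
  · have h1 : t (t' y) - y ∈ L.relOn τ fun _ => True := fun γ h _ => by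
      rw [map_sub, ht (t' y) γ h, hu' y γ h, sub_self]
    rw [L.relOn_true] at h1
    exact hmin h1
  · apply N.mem_smul_top hL hmin
    intro γ h
    apply (hθ γ (dim_lt h.lt)).bijective.1
    rw [map_sub, map_sub, map_zero, ← hu' (t f) γ h, ← ht f γ h, sub_self]

/-- In dimension at most `dim σ` the only nonzero module is `L_σ = A_σ`, and it has no boundary
values. -/
theorem FormSystem.exists_isDuality_of_dim_le (N : FormSystem Δ) (hs : L.IsSimple σ)
    (hL : L.IsPerverse) (θ : ∀ γ, (L.relative γ →ₗ[Poly γ] Poly γ) →ₗ[Poly γ] L.obj γ)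
    (τ : Δ.Cone) (hd : dim τ ≤ dim σ) : ∃ t, N.IsDuality hL σ θ τ t := by
  have hsub : ∀ γ, IsFacet γ τ → Subsingleton (L.obj γ) := fun γ h => hs.subsingleton_of_lt h.lt hd
  have hres : ∀ (t : (L.relative τ →ₗ[Poly τ] Poly τ) →ₗ[Poly τ] L.obj τ) γ, ∀ h : IsFacet γ τ,
      ∀ f, L.res h.1 (t f) = θ γ (phi hL (N.hasKernel h) f) := fun t γ h f => by
    have := hsub γ h
    exact Subsingleton.elim _ _
  by_cases hτ : τ = σ
  · subst hτ
    obtain ⟨e, he⟩ := hs.self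
    have hrel : ∀ x, x ∈ L.relative τ := fun x => by
      rw [← L.relOn_true]
      intro γ h _
      have := hsub γ h
      exact Subsingleton.elim _ _
    let t : (L.relative τ →ₗ[Poly τ] Poly τ) →ₗ[Poly τ] L.obj τ :=
      { toFun := fun f => e (f ⟨e 1, hrel _⟩)
        map_add' := fun f g => by rw [LinearMap.add_apply, map_add]
        map_smul' := fun c f => by rw [LinearMap.smul_apply, map_smul, RingHom.id_apply] }
    have hgen : ∀ x : L.relative τ, x = e.symm x.1 • ⟨e 1, hrel _⟩ := fun x => by
      apply Subtype.ext
      rw [Submodule.coe_smul, ← map_smul, smul_eq_mul, mul_one, e.apply_symm_apply]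
    refine ⟨t, ⟨fun f g hfg => ?_, fun y => ?_⟩, fun q f hf => ?_, hres t⟩
    · ext x
      rw [hgen x, map_smul, map_smul]
      exact congrArg (_ • ·) (e.injective hfg)
    · refine ⟨LinearMap.toSpanSingleton _ _ (e.symm y) ∘ₗ e.symm.toLinearMap ∘ₗ
        (L.relative τ).subtype, ?_⟩
      change e (LinearMap.toSpanSingleton _ _ (e.symm y) (e.symm (e 1))) = y
      rw [e.symm_apply_apply, LinearMap.toSpanSingleton_apply, one_smul, e.apply_symm_apply]
    · have h1 : e 1 ∈ L.deg τ 0 := (he 0 1).2 (by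
        rw [← map_one (algebraMap ℝ (Poly τ))]
        exact algebraMap_mem_polyDeg τ 1)
      have h2 := hf 0 ⟨e 1, hrel _⟩ h1
      rw [sub_self, add_zero]
      rw [zero_add] at h2
      exact (he q _).2 h2
  · have := hs.eq_zero τ hd hτ
    refine ⟨0, ⟨fun f g _ => ?_, fun y => ⟨0, Subsingleton.elim _ _⟩⟩, fun q f _ => zero_mem _,
      hres 0⟩
    ext x
    rw [Subsingleton.elim x 0, map_zero, map_zero]

/-- The maps to a simple sheaf from its dual, without the determinants, can be chosen one dimension
after the other. -/
theorem FormSystem.exists_isDuality (N : FormSystem Δ) (hs : L.IsSimple σ) (hL : L.IsPerverse) :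
    ∃ θ : ∀ γ, (L.relative γ →ₗ[Poly γ] Poly γ) →ₗ[Poly γ] L.obj γ,
      ∀ τ, N.IsDuality hL σ θ τ (θ τ) := by
  have key : ∀ k : ℕ, ∃ θ : ∀ γ, (L.relative γ →ₗ[Poly γ] Poly γ) →ₗ[Poly γ] L.obj γ,
      ∀ τ, dim τ < k → N.IsDuality hL σ θ τ (θ τ) := by
    intro k
    induction k with
    | zero => exact ⟨fun _ => 0, fun _ h => absurd h (Nat.not_lt_zero _)⟩
    | succ k ih =>
      obtain ⟨θ, hθ⟩ := ih
      have hstep : ∀ τ, dim τ = k → ∃ t, N.IsDuality hL σ θ τ t := fun τ hk => by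
        rcases le_or_gt (dim τ) (dim σ) with hd | hd
        · exact N.exists_isDuality_of_dim_le hs hL θ τ hd
        · exact N.exists_isDuality_step hs hL θ τ hd fun γ hγ => hθ γ (hk ▸ hγ)
      choose t ht using hstep
      let θ' : ∀ γ, (L.relative γ →ₗ[Poly γ] Poly γ) →ₗ[Poly γ] L.obj γ := fun γ =>
        if h : dim γ = k then t γ h else θ γ
      have hlow : ∀ γ, dim γ ≠ k → θ' γ = θ γ := fun γ h => dif_neg h
      refine ⟨θ', fun τ hτ => ?_⟩
      have h1 : N.IsDuality hL σ θ τ (θ' τ) := by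
        by_cases h : dim τ = k
        · simp only [θ', dif_pos h]
          exact ht τ h
        · rw [hlow τ h]
          exact hθ τ (by omega)
      exact ⟨h1.bijective, h1.mem_deg, fun γ h f => by
        rw [h1.res γ h, hlow γ (by have := h.2; omega)]⟩
  obtain ⟨θ, hθ⟩ := key (Module.finrank ℝ V + 1)
  exact ⟨θ, fun τ => hθ τ (Nat.lt_succ_of_le (Submodule.finrank_le _))⟩

end Fan

/-! ### The dual of a simple sheaf -/

section Line

variable {D : Type*} [AddCommGroup D] [Module ℝ D]

/-- The isomorphism `M → M ⊗ D`, `m ↦ m ⊗ ω`, for a generator `ω` of a line `D`. -/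
def lineEquiv (A M : Type*) [CommRing A] [Algebra ℝ A] [AddCommGroup M] [Module ℝ M] [Module A M]
    [IsScalarTower ℝ A M] {ω : D} (hω : ω ≠ 0) (h : ∀ η : D, ∃ c : ℝ, η = c • ω) :
    M ≃ₗ[A] M ⊗[ℝ] D :=
  LinearEquiv.ofBijective
    { toFun := fun m => m ⊗ₜ ω
      map_add' := fun m n => TensorProduct.add_tmul m n ω
      map_smul' := fun a m => (TensorProduct.smul_tmul' a m ω).symm }
    ⟨fun m n hmn => by
      obtain ⟨l, hl⟩ := Module.Projective.exists_dual_ne_zero ℝ hω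
      have h1 := congrArg (TensorProduct.rid ℝ M ∘ l.lTensor M) hmn
      simp only [LinearMap.coe_mk, AddHom.coe_mk, Function.comp_apply, LinearMap.lTensor_tmul,
        TensorProduct.rid_tmul] at h1
      exact smul_right_injective M hl h1,
    fun t => by
      induction t using TensorProduct.induction_on with
      | zero => exact ⟨0, map_zero _⟩
      | tmul m η =>
        obtain ⟨c, rfl⟩ := h η
        exact ⟨c • m, TensorProduct.smul_tmul c m ω⟩
      | add x y hx hy =>
        obtain ⟨x', rfl⟩ := hx
        obtain ⟨y', rfl⟩ := hy
        exact ⟨x' + y', map_add _ _ _⟩⟩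

end Line

namespace Fan

variable {V : Type u} [AddCommGroup V] [Module ℝ V] {Δ : Fan V}

theorem mem_detDeg {σ : Δ.Cone} (ω : Det σ) : ω ∈ detDeg σ (2 * dim σ) := by
  rw [detDeg, iSup_pos rfl]
  trivial

theorem isInternal_detDeg (σ : Δ.Cone) : DirectSum.IsInternal (detDeg σ) := by
  refine isInternal_of_separating (fun _ : Unit => LinearMap.id) (fun _ => 2 * (dim σ : ℤ))
    (fun _ q x hx hq => ?_) (fun x hx => hx ()) fun x => Submodule.mem_iSup_of_mem _ (mem_detDeg x)
  rw [detDeg, iSup_neg hq] at hx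
  exact hx

theorem tmul_mem_tensorDeg_iff {M : Type u} [AddCommGroup M] [Module ℝ M]
    {d : ℤ → Submodule ℝ M} (hd : DirectSum.IsInternal d) {σ : Δ.Cone} {ω : Det σ} (hω : ω ≠ 0)
    (h : ∀ η : Det σ, ∃ c : ℝ, η = c • ω) (q : ℤ) (m : M) :
    m ⊗ₜ[ℝ] ω ∈ tensorDeg d (detDeg σ) q ↔ m ∈ d (q - 2 * dim σ) := by
  have hmap : ∀ q, ∀ x ∈ d q, (TensorProduct.mk ℝ M (Det σ)).flip ω x ∈
      tensorDeg d (detDeg σ) (q + 2 * dim σ) := fun q x hx => by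
    refine Submodule.mem_iSup_of_mem q (Submodule.apply_mem_map₂ _ hx ?_)
    rw [add_sub_cancel_left]
    exact mem_detDeg ω
  have := mem_iff_of_injective hd (isInternal_tensor hd (isInternal_detDeg σ))
    ((TensorProduct.mk ℝ M (Det σ)).flip ω) (2 * dim σ) hmap
    (fun x y hxy => (lineEquiv ℝ M hω h).injective hxy) (q - 2 * dim σ) m
  rwa [sub_add_cancel] at this

theorem FacetChain.le {τ σ : Δ.Cone} (c : FacetChain τ σ) : τ ≤ σ := by
  induction c with
  | refl => exact le_rfl
  | step c h ih => exact ih.trans h.1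

variable [FiniteDimensional ℝ V] {L : Sheaf Δ} {σ : Δ.Cone}

/-- The isomorphism of `M` with `M ⊗ det V_ρ^*` given by the volume form of `ρ`. -/
def volumeEquiv (o : Orientations Δ) (τ : Δ.Cone) (M : Type u) [AddCommGroup M] [Module ℝ M]
    [Module (Poly τ) M] [IsScalarTower ℝ (Poly τ) M] (ρ : Δ.Cone) :
    M ≃ₗ[Poly τ] M ⊗[ℝ] Det ρ :=
  lineEquiv (Poly τ) M (volumeForm_ne_zero o ρ) (exists_eq_smul_volumeForm o)

@[simp]
theorem volumeEquiv_apply (o : Orientations Δ) (τ : Δ.Cone) (M : Type u) [AddCommGroup M]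
    [Module ℝ M] [Module (Poly τ) M] [IsScalarTower ℝ (Poly τ) M] (ρ : Δ.Cone) (m : M) :
    volumeEquiv o τ M ρ m = m ⊗ₜ volumeForm o ρ := rfl

/-- The dual of a simple sheaf is the sheaf itself, up to a shift of the degrees. -/
theorem Sheaf.IsSimple.exists_dual_equiv (hs : L.IsSimple σ) (hL : L.IsPerverse)
    (o : Orientations Δ) :
    ∃ e : ∀ τ, DualObj L τ ≃ₗ[Poly τ] L.obj τ,
      (∀ τ q x, e τ x ∈ L.deg τ (q - 2 * dim σ) ↔ x ∈ tensorDeg (homDeg L τ) (detDeg τ) q) ∧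
      ∀ {τ ρ : Δ.Cone} (c : FacetChain τ ρ) (h : τ ≤ ρ) (x : DualObj L ρ),
        L.res h (e ρ x) = e τ (dualChainMap hL o c x) := by
  obtain ⟨θ, hθ⟩ := (normalSystem o).exists_isDuality hs hL
  let e : ∀ τ, DualObj L τ ≃ₗ[Poly τ] L.obj τ := fun τ =>
    (volumeEquiv o τ _ τ).symm ≪≫ₗ LinearEquiv.ofBijective (θ τ) (hθ τ).bijective
  have he : ∀ τ f, e τ (f ⊗ₜ volumeForm o τ) = θ τ f := fun τ f => by
    change θ τ ((volumeEquiv o τ _ τ).symm (volumeEquiv o τ _ τ f)) = _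
    rw [LinearEquiv.symm_apply_apply]
  refine ⟨e, fun τ q x => ?_, fun {τ ρ} c h x => ?_⟩
  · obtain ⟨f, rfl⟩ := (volumeEquiv o τ _ τ).surjective x
    have h1 := mem_iff_of_injective (hL.isGradedModule_hom τ).isInternal (L.isInternal τ)
      ((θ τ).restrictScalars ℝ) _ (hθ τ).mem_deg (hθ τ).bijective.1 (q - 2 * dim τ) f
    rw [volumeEquiv_apply, he, tmul_mem_tensorDeg_iff (hL.isGradedModule_hom τ).isInternal
      (volumeForm_ne_zero o τ) (exists_eq_smul_volumeForm o), ← h1]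
    rw [show q - 2 * (dim τ : ℤ) + (2 * dim τ - 2 * dim σ) = q - 2 * dim σ by ring]
    rfl
  · induction c with
    | refl =>
      rw [dualChainMap]
      exact L.res_refl τ _
    | step c hτ ih =>
      rename_i ρ' ρ
      obtain ⟨f, rfl⟩ := (volumeEquiv o ρ _ ρ).surjective x
      rw [volumeEquiv_apply, he, dualChainMap, LinearMap.comp_apply, transition_smul_dualFacetMap,
        ← ih c.le, he, ← (hθ _).res, L.res_res]

theorem Sheaf.IsSimple.nonempty_dual_iso (hs : L.IsSimple σ) (hL : L.IsPerverse)
    (o : Orientations Δ) : Nonempty ((L.dual hL o).Iso (L.tensorDet σ)) := by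
  obtain ⟨e, hdeg, hres⟩ := hs.exists_dual_equiv hL o
  exact ⟨{
    equiv := fun τ => e τ ≪≫ₗ volumeEquiv o τ (L.obj τ) σ
    mem_deg_iff := fun τ q x =>
      (tmul_mem_tensorDeg_iff (L.isInternal τ) (volumeForm_ne_zero o σ)
        (exists_eq_smul_volumeForm o) q (e τ x)).trans (hdeg τ q x)
    res_equiv := fun h x => congrArg (· ⊗ₜ volumeForm o σ) (hres _ h x) }⟩

/-- For the zero cone the determinant is one-dimensional of degree `0` and can be left out. -/
theorem Sheaf.IsSimple.nonempty_dual_iso_self (hs : L.IsSimple σ) (hL : L.IsPerverse)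
    (o : Orientations Δ) (hσ : σ.1 = ⊥) : Nonempty ((L.dual hL o).Iso L.toModuleSystem) := by
  obtain ⟨e, hdeg, hres⟩ := hs.exists_dual_equiv hL o
  have hd : dim σ = 0 := by
    have : lin σ = ⊥ := by simp [lin, hσ]
    rw [dim, this, finrank_bot]
  exact ⟨{
    equiv := e
    mem_deg_iff := fun τ q x => by
      have := hdeg τ q x
      rwa [hd, Nat.cast_zero, mul_zero, sub_zero] at this
    res_equiv := fun h x => hres _ h x }⟩

end Fan

/-! ### Gradings on products, quotients and real vector spaces -/

section Graded

variable {A M N : Type*} [AddCommGroup M] [Module ℝ M] [AddCommGroup N] [Module ℝ N]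
  {d : ℤ → Submodule ℝ M} {e : ℤ → Submodule ℝ N}

theorem isInternal_prod (hd : DirectSum.IsInternal d) (he : DirectSum.IsInternal e) :
    DirectSum.IsInternal fun q => (d q).prod (e q) := by
  refine isInternal_of_separating (fun q : ℤ => (gradedComp hd q).prodMap (gradedComp he q)) id
    (fun k q x hx hq => Prod.ext (gradedComp_of_ne hd hx.1 hq.symm)
      (gradedComp_of_ne he hx.2 hq.symm))
    (fun x hx => Prod.ext (eq_zero_of_gradedComp hd fun q => congrArg Prod.fst (hx q))
      (eq_zero_of_gradedComp he fun q => congrArg Prod.snd (hx q))) fun x => ?_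
  have h1 : ∀ m : M, (m, (0 : N)) ∈ ⨆ q, (d q).prod (e q) := fun m => by
    induction m using hd.induction with
    | mem q m hm => exact Submodule.mem_iSup_of_mem q ⟨hm, zero_mem _⟩
    | add x y hx hy => simpa using add_mem hx hy
  have h2 : ∀ n : N, ((0 : M), n) ∈ ⨆ q, (d q).prod (e q) := fun n => by
    induction n using he.induction with
    | mem q n hn => exact Submodule.mem_iSup_of_mem q ⟨zero_mem _, hn⟩
    | add x y hx hy => simpa using add_mem hx hy
  simpa using add_mem (h1 x.1) (h2 x.2)

/-- The quotient of a graded vector space by a subspace that contains the homogeneous components of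
its elements is graded. -/
theorem isInternal_map_of_surjective (hd : DirectSum.IsInternal d) (π : M →ₗ[ℝ] N)
    (hπ : Function.Surjective π) (hker : ∀ q x, π x = 0 → π (gradedComp hd q x) = 0) :
    DirectSum.IsInternal fun q => (d q).map π := by
  obtain ⟨r, hr⟩ := π.exists_rightInverse_of_surjective (LinearMap.range_eq_top.2 hπ)
  -- the component of degree `q` descends to the quotient
  have hr' : ∀ q x, π (gradedComp hd q (r (π x))) = π (gradedComp hd q x) := fun q x => by
    rw [← sub_eq_zero, ← map_sub, ← map_sub]
    apply hker
    rw [map_sub, sub_eq_zero]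
    exact LinearMap.congr_fun hr (π x)
  refine isInternal_of_separating (fun q : ℤ => π ∘ₗ gradedComp hd q ∘ₗ r) id ?_ ?_ ?_
  · rintro k q _ ⟨x, hx, rfl⟩ hq
    change π (gradedComp hd k (r (π x))) = 0
    rw [hr', gradedComp_of_ne hd hx (q := k) (Ne.symm hq), map_zero]
  · intro y hy
    obtain ⟨x, rfl⟩ := hπ y
    obtain ⟨s, hs⟩ := exists_eq_sum_gradedComp hd x
    rw [hs s subset_rfl, map_sum]
    exact Finset.sum_eq_zero fun q _ => (hr' q x).symm.trans (hy q)
  · intro y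
    obtain ⟨x, rfl⟩ := hπ y
    induction x using hd.induction with
    | mem q x hx => exact Submodule.mem_iSup_of_mem q ⟨x, hx, rfl⟩
    | add x y hx hy => rw [map_add]; exact add_mem hx hy

/-- A field is graded, concentrated in degree zero. -/
theorem isGradedModule_real (hd : DirectSum.IsInternal d) :
    IsGradedModule (A := ℝ) (fun q => ⨆ _ : q = 0, ⊤) d where
  alg := by
    refine isInternal_of_separating (fun _ : Unit => LinearMap.id) (fun _ => (0 : ℤ))
      (fun _ q x hx hq => ?_) (fun x hx => hx ()) fun x => Submodule.mem_iSup_of_mem 0 (by simp)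
    rw [iSup_neg hq] at hx
    exact hx
  isInternal := hd
  smul_mem := fun {i j c x} hc hx => by
    by_cases hi : i = 0
    · rw [hi, zero_add]
      exact Submodule.smul_mem _ c hx
    · rw [iSup_neg hi] at hc
      rw [(Submodule.mem_bot ℝ).1 hc, zero_smul]
      exact zero_mem _

/-- A surjection of graded vector spaces has a graded section. -/
theorem exists_graded_section (hd : DirectSum.IsInternal d) (he : DirectSum.IsInternal e)
    (π : M →ₗ[ℝ] N) (hπ : Function.Surjective π) (hmem : ∀ q, ∀ x ∈ d q, π x ∈ e q) :
    ∃ s : N →ₗ[ℝ] M, (∀ y, π (s y) = y) ∧ ∀ q, ∀ y ∈ e q, s y ∈ d q := by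
  obtain ⟨s, hs, hs'⟩ := exists_graded_lift (isGradedModule_real he) (isGradedModule_real hd) 0
    (LinearMap.ker (LinearMap.fst ℝ N M - π ∘ₗ LinearMap.snd ℝ N M)) (fun q z hz => by
      have h1 : z.1 = π z.2 := sub_eq_zero.1 hz
      have h2 := map_gradedComp hd he 0 π (fun q x hx => by rw [add_zero]; exact hmem q x hx) q z.2
      simp only [add_zero] at h2 ⊢
      exact sub_eq_zero.2 (by rw [h1]; exact h2.symm)) fun y => by
      obtain ⟨x, rfl⟩ := hπ y
      exact ⟨x, sub_self _⟩
  exact ⟨s, fun y => (sub_eq_zero.1 (hs y)).symm, fun q y hy => by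
    have := hs' q y hy
    rwa [add_zero] at this⟩

/-- The submodule `𝔪 M` contains the homogeneous components of its elements. -/
theorem gradedComp_mem_smul_top [CommRing A] [Algebra ℝ A] [Module A M] [IsScalarTower ℝ A M]
    {a : ℤ → Submodule ℝ A} (hd : IsGradedModule a d) (q : ℤ) (x : M)
    (hx : x ∈ Ideal.span {c | ∃ q : ℤ, 0 < q ∧ c ∈ a q} • (⊤ : Submodule A M)) :
    gradedComp hd.isInternal q x ∈
      Ideal.span {c | ∃ q : ℤ, 0 < q ∧ c ∈ a q} • (⊤ : Submodule A M) := by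
  induction hx using Submodule.smul_induction_on' with
  | add x _ y _ hx hy => rw [map_add]; exact add_mem hx hy
  | smul c hc x _ =>
    induction hc using Submodule.span_induction generalizing x with
    | mem c hc =>
      obtain ⟨i, hi, hc'⟩ := id hc
      have := hd.gradedComp_smul hc' (q - i) x
      rw [sub_add_cancel] at this
      rw [this]
      exact Submodule.smul_mem_smul (Ideal.subset_span hc) trivial
    | zero => rw [zero_smul, map_zero]; exact zero_mem _
    | add b c _ _ hb hc => rw [add_smul, map_add]; exact add_mem (hb x trivial) (hc x trivial)
    | smul b c _ hc =>
      rw [smul_eq_mul, mul_comm, mul_smul]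
      exact hc (b • x) trivial

end Graded

/-! ### Existence of simple sheaves -/

namespace Fan

variable {V : Type u} [AddCommGroup V] [Module ℝ V] {Δ : Fan V}

theorem Sheaf.isInternal_reducedDeg (F : Sheaf Δ) (τ : Δ.Cone) :
    DirectSum.IsInternal (F.reducedDeg τ) :=
  isInternal_map_of_surjective (F.isInternal_boundaryDeg τ) (F.reduction τ)
    (F.reduction_surjective τ) fun q x hx => by
      rw [F.reduction_eq_zero_iff] at hx ⊢
      exact gradedComp_mem_smul_top (F.isGradedModule_boundary τ) q x hx

theorem isGradedModule_tensor {W : Type u} [AddCommGroup W] [Module ℝ W] {e : ℤ → Submodule ℝ W}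
    (he : DirectSum.IsInternal e) (τ : Δ.Cone) :
    IsGradedModule (polyDeg τ) (tensorDeg (polyDeg τ) e) where
  alg := isInternal_polyDeg τ
  isInternal := isInternal_tensor (isInternal_polyDeg τ) he
  smul_mem := fun {i j c x} hc hx => by
    have h : tensorDeg (polyDeg τ) e j ≤ (tensorDeg (polyDeg τ) e (i + j)).comap
        (Module.toModuleEnd ℝ (S := Poly τ) (Poly τ ⊗[ℝ] W) c) := by
      refine iSup_le fun k => Submodule.map₂_le.2 fun b hb w hw => ?_
      change c • (b ⊗ₜ[ℝ] w) ∈ tensorDeg (polyDeg τ) e (i + j)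
      rw [TensorProduct.smul_tmul']
      refine Submodule.mem_iSup_of_mem (i + k)
        (Submodule.apply_mem_map₂ _ (mul_mem_polyDeg hc hb) ?_)
      rwa [add_sub_add_left_eq_sub]
    exact h hx

theorem resPoly_refl {σ : Δ.Cone} (h : σ ≤ σ) (a : Poly σ) : resPoly h a = a := by
  have : resPoly h = AlgHom.id ℝ (Poly σ) := by
    apply SymmetricAlgebra.algHom_ext
    ext l
    exact resPoly_ι h l
  rw [this, AlgHom.id_apply]

section Attach

variable (F : Sheaf Δ) (E : Δ.Cone → Type u) [∀ τ, AddCommGroup (E τ)] [∀ τ, Module ℝ (E τ)]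
  [∀ τ, Module (Poly τ) (E τ)] [∀ τ, IsScalarTower ℝ (Poly τ) (E τ)]
  (S : ∀ τ, E τ →ₗ[Poly τ] F.Boundary τ)

open Classical in
/-- The restriction maps of the modules `F_σ ⊕ E_σ`: a section in `E_σ` restricts to its image
under `S` on the proper faces. (In particular no component of the restriction to a proper face `τ`
lies in `E_τ`.) -/
def attachRes {τ σ : Δ.Cone} (h : τ ≤ σ) : (F.obj σ × E σ) →ₗ[ℝ] F.obj τ × E τ :=
  if e : τ = σ then e ▸ LinearMap.id else
    { toFun := fun x => (F.res h x.1 + (S σ x.2).1 ⟨τ, lt_of_le_of_ne h e⟩, 0)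
      map_add' := fun x y => by
        ext <;> simp [add_add_add_comm]
      map_smul' := fun c x => by
        have : S σ (c • x.2) = c • S σ x.2 := LinearMap.map_smul_of_tower (S σ) c x.2
        ext <;> simp [this] }

theorem attachRes_refl {σ : Δ.Cone} (h : σ ≤ σ) (x : F.obj σ × E σ) :
    attachRes F E S h x = x := by
  simp [attachRes]

theorem attachRes_of_lt {τ σ : Δ.Cone} (h : τ < σ) (x : F.obj σ × E σ) :
    attachRes F E S h.le x = (F.res h.le x.1 + (S σ x.2).1 ⟨τ, h⟩, 0) := by
  simp [attachRes, h.ne]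

theorem attachRes_inl {τ σ : Δ.Cone} (h : τ ≤ σ) (x : F.obj σ) :
    attachRes F E S h (x, 0) = (F.res h x, 0) := by
  rcases h.eq_or_lt with rfl | hlt
  · rw [attachRes_refl, F.res_refl]
  · rw [attachRes_of_lt F E S hlt, map_zero]
    exact Prod.ext (add_zero _) rfl

variable (e : ∀ τ, ℤ → Submodule ℝ (E τ)) (he : ∀ τ, IsGradedModule (polyDeg τ) (e τ))
  (hS : ∀ τ q, ∀ x ∈ e τ q, S τ x ∈ F.boundaryDeg τ q)

/-- The sheaf `F ⊕ E` obtained from `F` by adding sections `E_σ` over each cone `σ`, with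
prescribed restrictions to the boundary. -/
def Sheaf.attach : Sheaf Δ where
  obj τ := F.obj τ × E τ
  deg τ q := (F.deg τ q).prod (e τ q)
  res h := attachRes F E S h
  isInternal τ := isInternal_prod (F.isInternal τ) (he τ).isInternal
  smul_mem ha hx := ⟨F.smul_mem ha hx.1, (he _).smul_mem ha hx.2⟩
  res_mem {τ σ} h q x hx := by
    rcases h.eq_or_lt with rfl | hlt
    · rwa [attachRes_refl]
    · rw [attachRes_of_lt F E S hlt]
      exact ⟨add_mem (F.res_mem h hx.1) (hS σ q _ hx.2 ⟨τ, hlt⟩), zero_mem _⟩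
  res_smul {τ σ} h a x := by
    rcases h.eq_or_lt with rfl | hlt
    · rw [attachRes_refl, attachRes_refl, resPoly_refl]
    · rw [attachRes_of_lt F E S hlt, attachRes_of_lt F E S hlt, Prod.smul_fst, Prod.smul_snd,
        F.res_smul, map_smul, F.boundary_smul_apply, ← smul_add]
      exact Prod.ext rfl (smul_zero _).symm
  res_refl σ x := attachRes_refl F E S _ x
  res_res {γ τ σ} h₁ h₂ x := by
    rcases h₂.eq_or_lt with rfl | hlt
    · rw [attachRes_refl]
    · rw [attachRes_of_lt F E S hlt, attachRes_inl, attachRes_of_lt F E S (h₁.trans_lt hlt),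
        map_add, F.res_res, (S σ x.2).2 ⟨τ, hlt⟩ ⟨γ, h₁.trans_lt hlt⟩ h₁]

/-- Attaching sections over `τ` and over cones which are not proper faces of `τ` does not change the
sections over the boundary of `τ`. -/
def attachBoundary (τ : Δ.Cone) (hE : ∀ γ < τ, Subsingleton (E γ)) :
    F.Boundary τ ≃ₗ[Poly τ] (F.attach E S e he hS).Boundary τ where
  toFun x := ⟨fun γ => (x.1 γ, 0), fun γ δ h =>
    (attachRes_inl F E S h (x.1 γ)).trans (Prod.ext (x.2 γ δ h) rfl)⟩
  invFun y := ⟨fun γ => (y.1 γ).1, fun γ δ h => by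
    have := hE γ.1 γ.2
    have h1 : y.1 γ = ((y.1 γ).1, 0) := Prod.ext rfl (Subsingleton.elim _ _)
    have h2 := y.2 γ δ h
    rw [h1] at h2
    exact congrArg Prod.fst ((attachRes_inl F E S h (y.1 γ).1).symm.trans h2)⟩
  map_add' x y := Subtype.ext (funext fun γ => Prod.ext rfl (add_zero (0 : E γ.1)).symm)
  map_smul' a x := Subtype.ext (funext fun γ => Prod.ext rfl (smul_zero _).symm)
  left_inv x := rfl
  right_inv y := Subtype.ext (funext fun γ => by
    have := hE γ.1 γ.2
    exact Prod.ext rfl (Subsingleton.elim _ _))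

theorem attachBoundary_mem_iff (τ : Δ.Cone) (hE : ∀ γ < τ, Subsingleton (E γ)) (q : ℤ)
    (x : F.Boundary τ) : attachBoundary F E S e he hS τ hE x ∈
      (F.attach E S e he hS).boundaryDeg τ q ↔ x ∈ F.boundaryDeg τ q :=
  ⟨fun h γ => (h γ).1, fun h γ => ⟨h γ, zero_mem _⟩⟩

theorem attach_resBoundary (τ : Δ.Cone) (hE : ∀ γ < τ, Subsingleton (E γ)) (x : F.obj τ)
    (t : E τ) : (F.attach E S e he hS).resBoundary τ (x, t) =
      attachBoundary F E S e he hS τ hE (F.resBoundary τ x + S τ t) :=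
  Subtype.ext (funext fun γ => attachRes_of_lt F E S γ.2 (x, t))

end Attach

/-- The condition on `F_τ` in the inductive construction of a simple sheaf: `F_τ` is the free module
on the reduction of `F_{∂τ}`, with restriction map given by a graded section of the reduction. -/
def Sheaf.IsMinimalAt (F : Sheaf Δ) (τ : Δ.Cone) : Prop :=
  ∃ s : F.ReducedBoundary τ →ₗ[ℝ] F.Boundary τ,
    (∀ w, F.reduction τ (s w) = w) ∧
    (∀ q, ∀ w ∈ F.reducedDeg τ q, s w ∈ F.boundaryDeg τ q) ∧
    ∃ e : (Poly τ ⊗[ℝ] F.ReducedBoundary τ) ≃ₗ[Poly τ] F.obj τ,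
      (∀ q x, e x ∈ F.deg τ q ↔ x ∈ tensorDeg (polyDeg τ) (F.reducedDeg τ) q) ∧
      ∀ a w, F.resBoundary τ (e (a ⊗ₜ w)) = a • s w

theorem congr_mem_tensorDeg {τ : Δ.Cone} {W W' : Type u} [AddCommGroup W] [Module ℝ W]
    [AddCommGroup W'] [Module ℝ W'] {d : ℤ → Submodule ℝ W} {d' : ℤ → Submodule ℝ W'}
    (r : W ≃ₗ[ℝ] W') (hr : ∀ q, ∀ w ∈ d q, r w ∈ d' q) {q : ℤ} {x : Poly τ ⊗[ℝ] W}
    (hx : x ∈ tensorDeg (polyDeg τ) d q) :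
    TensorProduct.AlgebraTensorModule.congr (LinearEquiv.refl (Poly τ) (Poly τ)) r x ∈
      tensorDeg (polyDeg τ) d' q := by
  have h : tensorDeg (polyDeg τ) d q ≤ (tensorDeg (polyDeg τ) d' q).comap
      ((TensorProduct.AlgebraTensorModule.congr (LinearEquiv.refl (Poly τ) (Poly τ)) r).toLinearMap
        |>.restrictScalars ℝ) :=
    iSup_le fun k => Submodule.map₂_le.2 fun b hb w hw =>
      Submodule.mem_iSup_of_mem k (Submodule.apply_mem_map₂ _ hb (hr _ w hw))
  exact h hx

/-- The condition `Fan.Sheaf.IsMinimalAt` can be checked on an isomorphic copy of the boundary. -/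
theorem Sheaf.isMinimalAt_of_boundaryEquiv {F F' : Sheaf Δ} {τ : Δ.Cone}
    (b : F.Boundary τ ≃ₗ[Poly τ] F'.Boundary τ)
    (hb : ∀ q x, b x ∈ F'.boundaryDeg τ q ↔ x ∈ F.boundaryDeg τ q)
    (s : F.ReducedBoundary τ →ₗ[ℝ] F.Boundary τ) (hs : ∀ w, F.reduction τ (s w) = w)
    (hs' : ∀ q, ∀ w ∈ F.reducedDeg τ q, s w ∈ F.boundaryDeg τ q)
    (e : (Poly τ ⊗[ℝ] F.ReducedBoundary τ) ≃ₗ[Poly τ] F'.obj τ)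
    (he : ∀ q x, e x ∈ F'.deg τ q ↔ x ∈ tensorDeg (polyDeg τ) (F.reducedDeg τ) q)
    (hres : ∀ a w, F'.resBoundary τ (e (a ⊗ₜ w)) = b (a • s w)) : F'.IsMinimalAt τ := by
  let r' : F.ReducedBoundary τ ≃ₗ[Poly τ] F'.ReducedBoundary τ :=
    Submodule.Quotient.equiv _ _ b (by
      change Submodule.map b.toLinearMap _ = _
      rw [Submodule.map_smul'', Submodule.map_top, LinearMap.range_eq_top.2 b.surjective])
  let r : F.ReducedBoundary τ ≃ₗ[ℝ] F'.ReducedBoundary τ := r'.restrictScalars ℝ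
  have hr : ∀ x, r (F.reduction τ x) = F'.reduction τ (b x) := fun x => rfl
  have hr₁ : ∀ q, ∀ w ∈ F.reducedDeg τ q, r w ∈ F'.reducedDeg τ q := by
    rintro q _ ⟨x, hx, rfl⟩
    exact ⟨b x, (hb q x).2 hx, (hr x).symm⟩
  have hr₂ : ∀ q, ∀ w ∈ F'.reducedDeg τ q, r.symm w ∈ F.reducedDeg τ q := by
    rintro q _ ⟨y, hy, rfl⟩
    obtain ⟨x, rfl⟩ := b.surjective y
    rw [← hr, r.symm_apply_apply]
    exact ⟨x, (hb q x).1 hy, rfl⟩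
  let c := TensorProduct.AlgebraTensorModule.congr (LinearEquiv.refl (Poly τ) (Poly τ)) r.symm
  refine ⟨(b.toLinearMap.restrictScalars ℝ) ∘ₗ s ∘ₗ r.symm.toLinearMap, fun w => ?_,
    fun q w hw => (hb q _).2 (hs' q _ (hr₂ q w hw)), c ≪≫ₗ e, fun q x => (he q (c x)).trans
      ⟨fun h => ?_, congr_mem_tensorDeg r.symm hr₂⟩, fun a w => (hres a (r.symm w)).trans
        (map_smul b a _)⟩
  · change F'.reduction τ (b (s (r.symm w))) = w
    rw [← hr, hs, r.apply_symm_apply]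
  · have h1 := congr_mem_tensorDeg r hr₁ h
    convert h1
    exact (c.symm_apply_apply x).symm

/-- A submodule that is everything or zero, according to a condition. With it a family of modules
can be made to vanish at some of the cones, without a case distinction in the type. -/
def topIf (A M : Type*) [CommRing A] [AddCommGroup M] [Module A M] (p : Prop) : Submodule A M :=
  ⨆ _ : p, ⊤

theorem topIf_pos {A M : Type*} [CommRing A] [AddCommGroup M] [Module A M] {p : Prop} (hp : p) :
    topIf A M p = ⊤ := iSup_pos hp

theorem subsingleton_topIf {A M : Type*} [CommRing A] [AddCommGroup M] [Module A M] {p : Prop}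
    (hp : ¬ p) : Subsingleton (topIf A M p) := by
  rw [topIf, iSup_neg hp]
  infer_instance

theorem isGradedModule_topIf {A M : Type*} [CommRing A] [Algebra ℝ A] [AddCommGroup M] [Module ℝ M]
    [Module A M] [IsScalarTower ℝ A M] {a : ℤ → Submodule ℝ A} {d : ℤ → Submodule ℝ M}
    (h : IsGradedModule a d) (p : Prop) :
    IsGradedModule a fun q => (d q).comap ((topIf A M p).subtype.restrictScalars ℝ) where
  alg := h.alg
  isInternal := isInternal_comap h.isInternal ((topIf A M p).restrictScalars ℝ) fun q x hx => by
    by_cases hp : p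
    · rw [topIf_pos hp]
      trivial
    · rw [topIf, iSup_neg hp] at hx ⊢
      rw [(Submodule.mem_bot A).1 hx, map_zero]
      exact zero_mem _
  smul_mem := fun hc hx => h.smul_mem hc hx

/-- The zero sheaf. -/
def Sheaf.zero (Δ : Fan V) : Sheaf Δ where
  obj _ := PUnit
  deg _ _ := ⊤
  res _ := 0
  isInternal _ := isInternal_of_separating (κ := Unit) (N := fun _ => ℝ) (fun _ => 0) (fun _ => 0)
    (fun _ _ _ _ _ => rfl) (fun _ _ => rfl) fun _ => Submodule.mem_iSup_of_mem 0 trivial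
  smul_mem _ _ := trivial
  res_mem _ _ _ _ := trivial
  res_smul _ _ _ := rfl
  res_refl _ _ := rfl
  res_res _ _ _ := rfl

/-- A sheaf that satisfies the conditions on a simple sheaf on the cones of dimension at most `k`,
and vanishes on the other cones. The vanishing makes the summand `F_τ` of `F_τ ⊕ E_τ` disappear when
the sections over a cone `τ` of dimension `k + 1` are attached. -/
structure Sheaf.IsSimpleUpTo (F : Sheaf Δ) (σ : Δ.Cone) (k : ℕ) : Prop where
  self : ∃ e : Poly σ ≃ₗ[Poly σ] F.obj σ, ∀ q a, e a ∈ F.deg σ q ↔ a ∈ polyDeg σ q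
  eq_zero : ∀ τ, dim τ ≤ dim σ → τ ≠ σ → Subsingleton (F.obj τ)
  extend : ∀ τ, dim σ < dim τ → dim τ ≤ k → F.IsMinimalAt τ
  vanish : ∀ τ, k < dim τ → Subsingleton (F.obj τ)

section Projections

variable (A M N : Type*) [CommRing A] [AddCommGroup M] [AddCommGroup N] [Module A M] [Module A N]

/-- `M ≃ M × N` if `N = 0`. -/
def inlEquiv [Subsingleton N] : M ≃ₗ[A] M × N :=
  { LinearMap.inl A M N with
    invFun := Prod.fst
    left_inv := fun _ => rfl
    right_inv := fun _ => Prod.ext rfl (Subsingleton.elim _ _) }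

/-- `N ≃ M × N` if `M = 0`. -/
def inrEquiv [Subsingleton M] : N ≃ₗ[A] M × N :=
  { LinearMap.inr A M N with
    invFun := Prod.snd
    left_inv := fun _ => rfl
    right_inv := fun _ => Prod.ext (Subsingleton.elim _ _) rfl }

end Projections

/-- The sheaf with the single nonzero module `A_σ` at `σ`. -/
theorem Sheaf.exists_isSimpleUpTo_dim (σ : Δ.Cone) :
    ∃ F : Sheaf Δ, F.IsSimpleUpTo σ (dim σ) := by
  refine ⟨(Sheaf.zero Δ).attach (fun τ => topIf (Poly τ) (Poly τ) (τ = σ)) (fun _ => 0) _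
    (fun τ => isGradedModule_topIf (isGradedModule_poly τ) (τ = σ)) fun _ _ _ _ => zero_mem _,
    ?_, fun τ _ hne => ?_, fun τ h1 h2 => absurd h1 h2.not_gt, fun τ hlt => ?_⟩
  · have : Subsingleton ((Sheaf.zero Δ).obj σ) := inferInstanceAs (Subsingleton PUnit)
    exact ⟨(LinearEquiv.ofTop _ (topIf_pos rfl)).symm ≪≫ₗ inrEquiv _ _ _,
      fun q a => ⟨fun h => h.2, fun h => ⟨trivial, h⟩⟩⟩
  · have := subsingleton_topIf (A := Poly τ) (M := Poly τ) hne
    exact inferInstanceAs (Subsingleton (PUnit × _))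
  · have := subsingleton_topIf (A := Poly τ) (M := Poly τ) (p := τ = σ) fun e => by
      subst e; exact lt_irrefl _ hlt
    exact inferInstanceAs (Subsingleton (PUnit × _))

theorem Sheaf.liftBaseChange_mem_boundaryDeg (F : Sheaf Δ) (τ : Δ.Cone)
    (s : F.ReducedBoundary τ →ₗ[ℝ] F.Boundary τ)
    (hs : ∀ q, ∀ w ∈ F.reducedDeg τ q, s w ∈ F.boundaryDeg τ q) (q : ℤ)
    (x : Poly τ ⊗[ℝ] F.ReducedBoundary τ) (hx : x ∈ tensorDeg (polyDeg τ) (F.reducedDeg τ) q) :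
    LinearMap.liftBaseChange (Poly τ) s x ∈ F.boundaryDeg τ q := by
  have h : tensorDeg (polyDeg τ) (F.reducedDeg τ) q ≤ (F.boundaryDeg τ q).comap
      ((LinearMap.liftBaseChange (Poly τ) s).restrictScalars ℝ) := by
    refine iSup_le fun i => Submodule.map₂_le.2 fun a ha w hw => ?_
    change LinearMap.liftBaseChange (Poly τ) s (a ⊗ₜ w) ∈ F.boundaryDeg τ q
    rw [LinearMap.liftBaseChange_tmul]
    have := (F.isGradedModule_boundary τ).smul_mem ha (hs _ w hw)
    rwa [add_sub_cancel] at this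
  exact h hx

variable [FiniteDimensional ℝ V]

/-- Attaching the free modules on the reduced boundaries over the cones of dimension `k + 1` extends
a sheaf that is simple up to dimension `k` to dimension `k + 1`. -/
theorem Sheaf.IsSimpleUpTo.attach {F : Sheaf Δ} {σ : Δ.Cone} {k : ℕ} (hF : F.IsSimpleUpTo σ k)
    (hk : dim σ ≤ k) (E : Δ.Cone → Type u) [∀ τ, AddCommGroup (E τ)] [∀ τ, Module ℝ (E τ)]
    [∀ τ, Module (Poly τ) (E τ)] [∀ τ, IsScalarTower ℝ (Poly τ) (E τ)]
    (S : ∀ τ, E τ →ₗ[Poly τ] F.Boundary τ) (e : ∀ τ, ℤ → Submodule ℝ (E τ))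
    (he : ∀ τ, IsGradedModule (polyDeg τ) (e τ))
    (hS : ∀ τ q, ∀ x ∈ e τ q, S τ x ∈ F.boundaryDeg τ q)
    (hE : ∀ τ, dim τ ≠ k + 1 → Subsingleton (E τ))
    (s : ∀ τ, F.ReducedBoundary τ →ₗ[ℝ] F.Boundary τ) (hs : ∀ τ w, F.reduction τ (s τ w) = w)
    (hs' : ∀ τ q, ∀ w ∈ F.reducedDeg τ q, s τ w ∈ F.boundaryDeg τ q)
    (ε : ∀ τ, dim τ = k + 1 → (Poly τ ⊗[ℝ] F.ReducedBoundary τ) ≃ₗ[Poly τ] E τ)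
    (hε : ∀ τ h q x, ε τ h x ∈ e τ q ↔ x ∈ tensorDeg (polyDeg τ) (F.reducedDeg τ) q)
    (hεS : ∀ τ h a w, S τ (ε τ h (a ⊗ₜ w)) = a • s τ w) :
    (F.attach E S e he hS).IsSimpleUpTo σ (k + 1) := by
  refine ⟨?_, fun τ hd hne => ?_, fun τ h1 h2 => ?_, fun τ hlt => ?_⟩
  · obtain ⟨i, hi⟩ := hF.self
    have := hE σ (by omega)
    exact ⟨i ≪≫ₗ inlEquiv _ _ _, fun q a => (and_iff_left (zero_mem _)).trans (hi q a)⟩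
  · have := hF.eq_zero τ hd hne
    have := hE τ (by omega)
    exact inferInstanceAs (Subsingleton (F.obj τ × E τ))
  · have hsub : ∀ γ < τ, Subsingleton (E γ) := fun γ hγ => hE γ (by have := dim_lt hγ; omega)
    rcases h2.lt_or_eq with h2 | h2
    · obtain ⟨t, ht, ht', i, hi, hres⟩ := hF.extend τ h1 (by omega)
      have := hE τ (by omega)
      refine Sheaf.isMinimalAt_of_boundaryEquiv (attachBoundary F E S e he hS τ hsub)
        (attachBoundary_mem_iff F E S e he hS τ hsub) t ht ht' (i ≪≫ₗ inlEquiv _ _ _)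
        (fun q a => (and_iff_left (zero_mem _)).trans (hi q a)) fun a w => ?_
      refine (attach_resBoundary F E S e he hS τ hsub (i (a ⊗ₜ w)) 0).trans ?_
      rw [map_zero, add_zero, hres]
    · have := hF.vanish τ (by omega)
      refine Sheaf.isMinimalAt_of_boundaryEquiv (attachBoundary F E S e he hS τ hsub)
        (attachBoundary_mem_iff F E S e he hS τ hsub) (s τ) (hs τ) (hs' τ)
        (ε τ h2 ≪≫ₗ inrEquiv _ _ _)
        (fun q a => (and_iff_right (zero_mem _)).trans (hε τ h2 q a)) fun a w => ?_
      refine (attach_resBoundary F E S e he hS τ hsub 0 (ε τ h2 (a ⊗ₜ w))).trans ?_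
      rw [map_zero, zero_add, hεS]
  · have := hF.vanish τ (by omega)
    have := hE τ (by omega)
    exact inferInstanceAs (Subsingleton (F.obj τ × E τ))

theorem Sheaf.IsSimpleUpTo.exists_succ {F : Sheaf Δ} {σ : Δ.Cone} {k : ℕ} (hk : dim σ ≤ k)
    (hF : F.IsSimpleUpTo σ k) : ∃ F' : Sheaf Δ, F'.IsSimpleUpTo σ (k + 1) := by
  choose s hs hs' using fun τ => exists_graded_section (F.isInternal_boundaryDeg τ)
    (F.isInternal_reducedDeg τ) (F.reduction τ) (F.reduction_surjective τ)
    fun q x hx => ⟨x, hx, rfl⟩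
  exact ⟨_, hF.attach hk
    (fun τ => topIf (Poly τ) (Poly τ ⊗[ℝ] F.ReducedBoundary τ) (dim τ = k + 1))
    (fun τ => LinearMap.liftBaseChange (Poly τ) (s τ) ∘ₗ Submodule.subtype _) _
    (fun τ => isGradedModule_topIf (isGradedModule_tensor (F.isInternal_reducedDeg τ) τ) _)
    (fun τ q x hx => F.liftBaseChange_mem_boundaryDeg τ (s τ) (hs' τ) q _ hx)
    (fun τ h => subsingleton_topIf h) s hs hs'
    (fun τ h => (LinearEquiv.ofTop _ (topIf_pos h)).symm) (fun τ h q x => Iff.rfl)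
    (fun τ h a w => LinearMap.liftBaseChange_tmul (Poly τ) (s τ) a w)⟩

theorem exists_isSimple (σ : Δ.Cone) : ∃ L : Sheaf Δ, L.IsSimple σ := by
  have key : ∀ n : ℕ, ∃ F : Sheaf Δ, F.IsSimpleUpTo σ (dim σ + n) := by
    intro n
    induction n with
    | zero => exact Sheaf.exists_isSimpleUpTo_dim σ
    | succ n ih =>
      obtain ⟨F, hF⟩ := ih
      exact hF.exists_succ (Nat.le_add_right _ _)
  obtain ⟨L, hL⟩ := key (Module.finrank ℝ V)
  exact ⟨L, hL.self, hL.eq_zero, fun τ h =>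
    hL.extend τ h ((Submodule.finrank_le _).trans (Nat.le_add_left _ _))⟩

end Fan

end

theorem mainTheorem1 {V : Type u} [AddCommGroup V] [Module ℝ V] [FiniteDimensional ℝ V]
    (Δ : Fan V) (o : Fan.Orientations Δ) :
    (∀ σ : Δ.Cone, (∃ L : Fan.Sheaf Δ, L.IsSimple σ) ∧
      ∀ L : Fan.Sheaf Δ, L.IsSimple σ →
        ∃ hL : L.IsPerverse, Nonempty ((L.dual hL o).Iso (L.tensorDet σ))) ∧
    ∀ z : Δ.Cone, z.1 = ⊥ → ∀ E : Fan.Sheaf Δ, E.IsSimple z →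
      ∃ hE : E.IsPerverse, Nonempty ((E.dual hE o).Iso E.toModuleSystem) := by
  refine ⟨fun σ => ⟨Fan.exists_isSimple σ, fun L hs =>
    ⟨hs.isPerverse, hs.nonempty_dual_iso hs.isPerverse o⟩⟩, fun z hz E hs =>
    ⟨hs.isPerverse, hs.nonempty_dual_iso_self hs.isPerverse o hz⟩⟩
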